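/- Let $d\in\{2,3\}$, $\kappa\ge 2$. Let $\widetilde\Omega_f,\widetilde\Omega_s\subset\mathbb R^d$ be non-overlapping reference domains, each meshed by a finite conforming mesh of $d$-simplices ($\widetilde\Omega_f$ connected), with nonempty interface $\widetilde\Gamma=\partial\widetilde\Omega_f\cap\partial\widetilde\Omega_s$. Let $\widetilde\Gamma_f^{dir}\subset\partial\widetilde\Omega_f\setminus\widetilde\Gamma$ and $\widetilde\Gamma_s^{dir}\subset\partial\widetilde\Omega_s\setminus\widetilde\Gamma$ be the Dirichlet parts of the external boundaries; the rest of $\partial\widetilde\Omega_\bullet\setminus\widetilde\Gamma$ is the Neumann part $\widetilde\Gamma_\bullet^{neu}$, with prescribed surface forces $g_f$ (integrable in space at each time) and $g_s$. Use continuous $\mathbb P_\kappa$ finite elements for the fluid velocity, the solid displacement and the ALE displacement, and $\mathbb P_{\kappa-1}$ for the pressure. Fix finite families of finite element fields on the reference domains: - fluid velocity bubbles $\zeta_{f,i}$, vanishing on $\widetilde\Gamma\cup\widetilde\Gamma_f^{dir}$; solid bubbles $\zeta_{s,i}$, vanishing on $\widetilde\Gamma\cup\widetilde\Gamma_s^{dir}$;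 pressure modes $\zeta_{p,i}$; - port modes $e_{f,j}$, $e_{s,j}$ with $e_{f,j}=e_{s,j}$ on $\widetilde\Gamma$, vanishing on $\widetilde\Gamma_f^{dir}$, $\widetilde\Gamma_s^{dir}$ respectively; - ALE modes $a_j$ with $a_j=e_{s,j}$ on $\widetilde\Gamma$ and $a_j=0$ on $\partial\widetilde\Omega_f\setminus\widetilde\Gamma$; - a lifting $\bar u$ of the fluid Dirichlet profile: a finite element field that vanishes on $\widetilde\Gamma$ and is discretely harmonic with respect to the test fields vanishing on $\widetilde\Gamma\cup\widetilde\Gamma_f^{dir}$. Given coordinates $c$, $\alpha_f$, $\alpha_s$, $\alpha_p$, $\beta$ depending on $t\in(0,T)$, with $\alpha_f$ differentiable and $\alpha_s,\beta$ twice differentiable, put $\Phi_t=\mathrm{id}+\sum_j\beta_j(t)a_j$, $\Omega_f(t)=\Phi_t(\widetilde\Omega_f)$, $\Gamma(t)=\Phi_t(\widetilde\Gamma)$, $\omega_f=\partial_t\Phi_t\circ\Phi_t^{-1}$, $$\hat d_s=\sum_i\alpha_{s,i}\zeta_{s,i}+\sum_j\beta_je_{s,j},\quad \hat u_f=\Big(c\,\bar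 u+\sum_i\alpha_{f,i}\zeta_{f,i}+\sum_j\dot\beta_je_{f,j}\Big)\circ\Phi_t^{-1},\quad \hat p_f=\Big(\sum_i\alpha_{p,i}\zeta_{p,i}\Big)\circ\Phi_t^{-1},$$ and assume that for every $t\in(0,T)$ the ALE map $\Phi_t$ is injective on the closure of $\widetilde\Omega_f$ with $\det\nabla\Phi_t>0$ on each closed element. For reference test fields $\tilde v$, $w$, with $v=\tilde v\circ\Phi_t^{-1}$, define the residuals $$\hat R_f(\tilde v)=\frac{d}{dt}\int_{\Omega_f(t)}\rho_f\hat u_f\cdot v\,dx+\int_{\Omega_f(t)}\Big(2\mu_f\varepsilon(\hat u_f):\varepsilon(v)-\hat p_f\nabla\cdot v+\rho_f[(\hat u_f-\omega_f)\cdot\nabla]\hat u_f\cdot v-\rho_f(\nabla\cdot\omega_f)\hat u_f\cdot v+\tfrac{\rho_f}{2}(\nabla\cdot\hat u_f)\hat u_f\cdot v\Big)dx-\int_{\Phi_t(\widetilde\Gamma_f^{neu})}g_f\cdot v\,dS,$$ $$\hat R_s(w)=\int_{\widetilde\Omega_s}\rho_s\,\partial_{tt}\hat d_s\cdot w\,dx+\int_{\widetilde\Omega_s}\Pi_s(\hat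 d_s):\nabla w\,dx-\int_{\widetilde\Gamma_s^{neu}}g_s\cdot w\,dS.$$ Here either (linear elasticity) $\Pi_s=2\mu_sE+\lambda_s\mathrm{tr}(E)I$ with $E=\tfrac12(\nabla\hat d_s+\nabla\hat d_s^{T})$, or (Saint-Venant–Kirchhoff) $\Pi_s=F(2\mu_sE+\lambda_s\mathrm{tr}(E)I)$ with $F=I+\nabla\hat d_s$, $E=\tfrac12(F^{T}F-I)$. Suppose that the semi-discrete Galerkin ROM holds for all $t\in(0,T)$: $$\hat R_s(e_{s,j})+\hat R_f(e_{f,j})=0,\quad \hat R_f(\zeta_{f,i})=0,\quad \hat R_s(\zeta_{s,i})=0,\quad \int_{\Omega_f(t)}(\nabla\cdot\hat u_f)\,(\zeta_{p,i}\circ\Phi_t^{-1})\,dx=0\qquad\text{for all modes.}$$ Suppose finally that the system is isolated: for all $t\in(0,T)$, $\hat u_f=0$ on $\Phi_t(\partial\widetilde\Omega_f\setminus\widetilde\Gamma)=\partial\Omega_f(t)\setminus\Gamma(t)$, and the traction prescribed on the non-interface solid boundary vanishes, $g_s=0$ on $\widetilde\Gamma_s^{neu}$ (which is all of $\partial\widetilde\Omega_s\setminus\widetilde\Gamma$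 if $\widetilde\Gamma_s^{dir}=\emptyset$). Then, for every $t\in(0,T)$, the energy below is differentiable at $t$ and $$\frac{d}{dt}\bigl(\hat T_f+\hat T_s+\hat W_s\bigr)+D_f(\hat u_f)=0,$$ where $\hat T_f=\frac12\int_{\Omega_f(t)}\rho_f|\hat u_f|^2dx$, $\hat T_s=\frac12\int_{\widetilde\Omega_s}\rho_s|\partial_t\hat d_s|^2dx$, $\hat W_s=\int_{\widetilde\Omega_s}\bigl(\mu_sE:E+\tfrac{\lambda_s}{2}(\mathrm{tr}\,E)^2\bigr)dx$ and $D_f(\hat u_f)=2\mu_f\int_{\Omega_f(t)}\varepsilon(\hat u_f):\varepsilon(\hat u_f)\,dx$. -/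

import Mathlib

open MeasureTheory

noncomputable section

namespace FSI

/-! ### Vector calculus on `ℝᵈ` with the Euclidean norm -/

/-- The Euclidean space `ℝᵈ`. -/
abbrev E (d : ℕ) : Type := EuclideanSpace ℝ (Fin d)

/-- The gradient `(∇v)ᵢⱼ = ∂ⱼ vᵢ` of a vector field. -/
def grad {d : ℕ} (v : E d → E d) (x : E d) : Matrix (Fin d) (Fin d) ℝ :=
  Matrix.of fun i j => fderiv ℝ v x (EuclideanSpace.single j 1) i

/-- The divergence `∇ · v`. -/
def divg {d : ℕ} (v : E d → E d) (x : E d) : ℝ := (grad v x).trace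

/-- The symmetric gradient `ε(v) = (∇v + ∇vᵀ) / 2`. -/
def symGrad {d : ℕ} (v : E d → E d) (x : E d) : Matrix (Fin d) (Fin d) ℝ :=
  (1 / 2 : ℝ) • (grad v x + (grad v x).transpose)

/-- The Frobenius product `A : B`. -/
def contr {d : ℕ} (A B : Matrix (Fin d) (Fin d) ℝ) : ℝ := ∑ i, ∑ j, A i j * B i j

/-- `((a · ∇) u) · v = ∑ᵢⱼ aⱼ (∂ⱼ uᵢ) vᵢ` at the point `x`. -/
def convect {d : ℕ} (a u v : E d → E d) (x : E d) : ℝ :=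
  ∑ i, ∑ j, a x j * grad u x i j * v x i

/-! ### Meshes and Lagrange finite elements -/

/-- A conforming mesh of `d`-simplices in `ℝᵈ`: a finite geometric simplicial complex in which
every face is a face of some `d`-simplex. -/
structure Mesh (d : ℕ) where
  complex : Geometry.SimplicialComplex ℝ (E d)
  finite : complex.faces.Finite
  pure : ∀ s ∈ complex.faces, ∃ t ∈ complex.faces, s ⊆ t ∧ t.card = d + 1

namespace Mesh

variable {d : ℕ} (K : Mesh d)

/-- The closed meshed region (the closure of the domain). -/
def closedDomain : Set (E d) := K.complex.space

/-- The (open) meshed domain. -/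
def domain : Set (E d) := interior K.complex.space

/-- The boundary of the meshed domain. -/
def bdry : Set (E d) := frontier K.complex.space

/-- The vertex sets of the `d`-dimensional elements. -/
def elements : Set (Finset (E d)) := {s | s ∈ K.complex.faces ∧ s.card = d + 1}

/-- Scalar `P_k` Lagrange finite element functions: the restriction to every closed element is a
polynomial of total degree at most `k`. As the value at a point shared by several closed elements
is the same for all of them, such a function is continuous on the closed meshed region. Values
outside this region are irrelevant. -/
def IsFE (k : ℕ) (v : E d → ℝ) : Prop :=
  ∀ s ∈ K.elements, ∃ p : MvPolynomial (Fin d) ℝ, p.totalDegree ≤ k ∧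
    ∀ x ∈ convexHull ℝ (s : Set (E d)), v x = MvPolynomial.eval (fun i => x i) p

/-- Vector-valued `P_k` Lagrange finite element functions. -/
def IsFEVec (k : ℕ) (v : E d → E d) : Prop := ∀ i, K.IsFE k fun x => v x i

/-- `v` is a discretely harmonic `P_k` function, with Dirichlet conditions on the part `D` of the
boundary: it solves the finite element Laplace problem, tested with all finite element functions
that vanish on `D`. -/
def IsDiscretelyHarmonic (k : ℕ) (D : Set (E d)) (v : E d → E d) : Prop :=
  K.IsFEVec k v ∧ ∀ w : E d → E d, K.IsFEVec k w → (∀ x ∈ D, w x = 0) →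
    ∫ x in K.domain, contr (grad v x) (grad w x) = 0

end Mesh

/-! ### Elasticity -/

/-- The two constitutive models for the solid: small-strain linear elasticity, and
Saint-Venant--Kirchhoff hyperelasticity. -/
inductive ElasticModel where
  | linear
  | svk

/-- The strain as a function of the displacement gradient `G = ∇d`: the small strain
`(G + Gᵀ) / 2` in the linear model, the Green--Lagrange tensor `(FᵀF - I) / 2` with `F = I + G`
in the Saint-Venant--Kirchhoff model. -/
def strain {d : ℕ} (m : ElasticModel) (G : Matrix (Fin d) (Fin d) ℝ) :
    Matrix (Fin d) (Fin d) ℝ :=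
  match m with
  | .linear => (1 / 2 : ℝ) • (G + G.transpose)
  | .svk => (1 / 2 : ℝ) • ((1 + G).transpose * (1 + G) - 1)

/-- `2 μ E + λ tr(E) I`: the stress associated with the strain `E`. -/
def hookeStress {d : ℕ} (lam mu : ℝ) (E : Matrix (Fin d) (Fin d) ℝ) :
    Matrix (Fin d) (Fin d) ℝ :=
  (2 * mu) • E + (lam * E.trace) • (1 : Matrix (Fin d) (Fin d) ℝ)

/-- The first Piola--Kirchhoff stress as a function of the displacement gradient `G`:
`2 μ ε + λ tr(ε) I` in the linear model, `F Σ` with `Σ = 2 μ E + λ tr(E) I` in the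
Saint-Venant--Kirchhoff model. -/
def piolaStress {d : ℕ} (m : ElasticModel) (lam mu : ℝ) (G : Matrix (Fin d) (Fin d) ℝ) :
    Matrix (Fin d) (Fin d) ℝ :=
  match m with
  | .linear => hookeStress lam mu (strain .linear G)
  | .svk => (1 + G) * hookeStress lam mu (strain .svk G)

/-- The density of elastic energy `W(E) = μ E : E + (λ / 2) (tr E)²`. -/
def storedDensity {d : ℕ} (lam mu : ℝ) (E : Matrix (Fin d) (Fin d) ℝ) : ℝ :=
  mu * contr E E + lam / 2 * E.trace ^ 2

/-- The stress is the derivative of the energy density: `Σ = ∂W/∂E`. -/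
theorem storedDensity_hasDerivAt {d : ℕ} (lam mu : ℝ) (E H : Matrix (Fin d) (Fin d) ℝ) :
    HasDerivAt (fun s : ℝ => storedDensity lam mu (E + s • H))
      (contr (hookeStress lam mu E) H) 0 := by
  have key : (fun s : ℝ => storedDensity lam mu (E + s • H)) = fun s : ℝ =>
      storedDensity lam mu E + s * contr (hookeStress lam mu E) H
        + s ^ 2 * storedDensity lam mu H := by
    funext s
    have h1 : contr (E + s • H) (E + s • H)
        = contr E E + 2 * s * contr E H + s ^ 2 * contr H H := by
      simp only [contr, Finset.mul_sum, ← Finset.sum_add_distrib]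
      refine Finset.sum_congr rfl fun i _ => Finset.sum_congr rfl fun j _ => ?_
      simp only [Matrix.add_apply, Matrix.smul_apply, smul_eq_mul]
      ring
    have h2 : contr (hookeStress lam mu E) H = 2 * mu * contr E H + lam * E.trace * H.trace := by
      have : lam * E.trace * H.trace
          = ∑ i, ∑ j, (lam * E.trace) * (1 : Matrix (Fin d) (Fin d) ℝ) i j * H i j := by
        simp [Matrix.trace, Matrix.one_apply, Finset.mul_sum]
      rw [this]
      simp only [contr, hookeStress, Finset.mul_sum, ← Finset.sum_add_distrib]
      refine Finset.sum_congr rfl fun i _ => Finset.sum_congr rfl fun j _ => ?_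
      simp only [Matrix.add_apply, Matrix.smul_apply, smul_eq_mul]
      ring
    simp only [storedDensity, h1, h2, Matrix.trace_add, Matrix.trace_smul, smul_eq_mul]
    ring
  rw [key]
  have h1 : HasDerivAt (fun s : ℝ => s * contr (hookeStress lam mu E) H)
      (contr (hookeStress lam mu E) H) 0 := by
    simpa using (hasDerivAt_id (0 : ℝ)).mul_const (contr (hookeStress lam mu E) H)
  have h2 : HasDerivAt (fun s : ℝ => s ^ 2 * storedDensity lam mu H) 0 0 := by
    simpa using ((hasDerivAt_id (0 : ℝ)).fun_pow 2).mul_const (storedDensity lam mu H)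
  simpa using (h1.const_add (storedDensity lam mu E)).fun_add h2

/-! ### The reduced-order model -/

/-- The reference configuration: meshed fluid and solid domains that do not overlap and share a
nonempty interface, and the Dirichlet parts of their non-interface boundaries. -/
structure Geometry (d : ℕ) where
  fluid : Mesh d
  solid : Mesh d
  fluid_connected : IsConnected fluid.domain
  disjoint : Disjoint fluid.domain solid.domain
  interface_nonempty : (fluid.bdry ∩ solid.bdry).Nonempty
  /-- the Dirichlet part of the fluid boundary -/
  fluidDir : Set (E d)
  fluidDir_subset : fluidDir ⊆ fluid.bdry \ solid.bdry
  fluidDir_measurable : MeasurableSet fluidDir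
  /-- the Dirichlet part of the solid boundary -/
  solidDir : Set (E d)
  solidDir_subset : solidDir ⊆ solid.bdry \ fluid.bdry
  solidDir_measurable : MeasurableSet solidDir

namespace Geometry

variable {d : ℕ} (G : Geometry d)

/-- The reference fluid-structure interface `Γ`. -/
def interface : Set (E d) := G.fluid.bdry ∩ G.solid.bdry

/-- The non-interface part of the reference fluid boundary. -/
def fluidOuter : Set (E d) := G.fluid.bdry \ G.interface

/-- The non-interface part of the solid boundary. -/
def solidOuter : Set (E d) := G.solid.bdry \ G.interface

/-- The Neumann part of the reference fluid boundary. -/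
def fluidNeu : Set (E d) := G.fluidOuter \ G.fluidDir

/-- The Neumann part of the solid boundary. -/
def solidNeu : Set (E d) := G.solidOuter \ G.solidDir

end Geometry

/-- Physical data: densities, viscosity, Lamé coefficients, constitutive model of the solid, and
the Neumann data (surface forces) on the fluid and the solid boundary as functions of time. -/
structure Physics {d : ℕ} (G : Geometry d) where
  rhoF : ℝ
  muF : ℝ
  rhoS : ℝ
  lamS : ℝ
  muS : ℝ
  model : ElasticModel
  gF : ℝ → E d → E d
  gF_integrable : ∀ t, IntegrableOn (gF t) G.fluidNeu (μHE[d - 1])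
  gS : ℝ → E d → E d

/-- Bubble-port reduced spaces on `P_κ`/`P_{κ-1}` finite elements for the fluid velocity and
pressure, and `P_κ` elements for the solid displacement. All fields live on the reference
configuration. `lift` is the lifting of the Dirichlet profile for the fluid velocity; `zF`, `zS`
are the fluid-velocity (including supremizers) and solid-displacement bubble modes; `zP` are the
pressure modes; `eF j`, `eS j` are the extensions of the `j`-th interface mode into the fluid and
the solid domain; `ale j` is the extension of the `j`-th interface mode that drives the ALE map.
The families are otherwise arbitrary: it does not matter from which snapshots the modes were
computed, nor which extension operator was used for the port and the ALE modes. -/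
structure ReducedSpaces {d : ℕ} (G : Geometry d) (κ nu ns np m : ℕ) where
  /-- the lifting of the Dirichlet profile -/
  lift : E d → E d
  lift_harmonic : G.fluid.IsDiscretelyHarmonic κ (G.interface ∪ G.fluidDir) lift
  lift_interface : ∀ x ∈ G.interface, lift x = 0
  /-- fluid velocity bubbles -/
  zF : Fin nu → E d → E d
  zF_fe : ∀ i, G.fluid.IsFEVec κ (zF i)
  zF_bubble : ∀ i, ∀ x ∈ G.interface ∪ G.fluidDir, zF i x = 0
  /-- solid displacement bubbles -/
  zS : Fin ns → E d → E d
  zS_fe : ∀ i, G.solid.IsFEVec κ (zS i)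
  zS_bubble : ∀ i, ∀ x ∈ G.interface ∪ G.solidDir, zS i x = 0
  /-- pressure modes -/
  zP : Fin np → E d → ℝ
  zP_fe : ∀ i, G.fluid.IsFE (κ - 1) (zP i)
  /-- fluid port modes -/
  eF : Fin m → E d → E d
  eF_fe : ∀ j, G.fluid.IsFEVec κ (eF j)
  eF_dir : ∀ j, ∀ x ∈ G.fluidDir, eF j x = 0
  /-- solid port modes -/
  eS : Fin m → E d → E d
  eS_fe : ∀ j, G.solid.IsFEVec κ (eS j)
  eS_dir : ∀ j, ∀ x ∈ G.solidDir, eS j x = 0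
  /-- the port modes share their traces -/
  port_trace : ∀ j, ∀ x ∈ G.interface, eF j x = eS j x
  /-- ALE modes -/
  ale : Fin m → E d → E d
  ale_fe : ∀ j, G.fluid.IsFEVec κ (ale j)
  ale_interface : ∀ j, ∀ x ∈ G.interface, ale j x = eS j x
  ale_outer : ∀ j, ∀ x ∈ G.fluidOuter, ale j x = 0

/-- A semi-discrete reduced-order model. -/
structure ROM (d κ nu ns np m : ℕ) where
  geom : Geometry d
  phys : Physics geom
  red : ReducedSpaces geom κ nu ns np m

/-- Time-dependent generalized coordinates of the reduced approximation: the amplitude of the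
Dirichlet data, and the coordinates for the fluid bubbles, the solid bubbles, the pressure modes
and the port modes. -/
structure Coords (nu ns np m : ℕ) where
  cDir : ℝ → ℝ
  aF : ℝ → Fin nu → ℝ
  aS : ℝ → Fin ns → ℝ
  aP : ℝ → Fin np → ℝ
  b : ℝ → Fin m → ℝ

namespace ROM

variable {d κ nu ns np m : ℕ} (S : ROM d κ nu ns np m) (q : Coords nu ns np m)

/-- The reduced solid displacement. -/
def dS (t : ℝ) (x : E d) : E d :=
  ∑ i, q.aS t i • S.red.zS i x + ∑ j, q.b t j • S.red.eS j x

/-- The reduced solid velocity `∂ₜ dS`. -/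
def velS (t : ℝ) (x : E d) : E d := deriv (fun τ => S.dS q τ x) t

/-- The reduced solid acceleration `∂ₜₜ dS`. -/
def accS (t : ℝ) (x : E d) : E d := deriv (fun τ => S.velS q τ x) t

/-- The ALE map; it is the identity plus the ALE extension of the interface displacement. -/
def Phi (t : ℝ) (x : E d) : E d := x + ∑ j, q.b t j • S.red.ale j x

/-- The current fluid domain. -/
def OmegaF (t : ℝ) : Set (E d) := S.Phi q t '' S.geom.fluid.domain

/-- The inverse of the ALE map at time `t`, defined on the image of the closed fluid domain. -/
def PhiInv (t : ℝ) : E d → E d := Function.invFunOn (S.Phi q t) S.geom.fluid.closedDomain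

/-- The field `f ∘ Φ⁻¹` on the current fluid domain, for a field `f` on the reference one. -/
def push {Y : Type*} (t : ℝ) (f : E d → Y) : E d → Y := fun x => f (S.PhiInv q t x)

/-- The ALE velocity `∂ₜ Φ`, as a field on the current fluid domain. -/
def omegaF (t : ℝ) : E d → E d := S.push q t fun x => deriv (fun τ => S.Phi q τ x) t

/-- The reduced fluid velocity, as a field on the current fluid domain. -/
def uF (t : ℝ) : E d → E d :=
  S.push q t fun x => q.cDir t • S.red.lift x + ∑ i, q.aF t i • S.red.zF i x
    + ∑ j, deriv q.b t j • S.red.eF j x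

/-- The reduced fluid pressure, as a field on the current fluid domain. -/
def pF (t : ℝ) : E d → ℝ := S.push q t fun x => ∑ i, q.aP t i * S.red.zP i x

/-- The spatial part of the fluid residual at time `t`, for a reference velocity test field `v`
that is transported to the current domain. -/
def resF' (t : ℝ) (v : E d → E d) : ℝ :=
  (∫ x in S.OmegaF q t,
    (2 * S.phys.muF * contr (symGrad (S.uF q t) x) (symGrad (S.push q t v) x)
      - S.pF q t x * divg (S.push q t v) x
      + S.phys.rhoF *
        convect (fun y => S.uF q t y - S.omegaF q t y) (S.uF q t) (S.push q t v) x
      - S.phys.rhoF * divg (S.omegaF q t) x * inner ℝ (S.uF q t x) (S.push q t v x)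
      + S.phys.rhoF / 2 * divg (S.uF q t) x * inner ℝ (S.uF q t x) (S.push q t v x)))
  - ∫ x in S.Phi q t '' S.geom.fluidNeu,
      inner ℝ (S.phys.gF t x) (S.push q t v x) ∂(μHE[d - 1])

/-- The full fluid residual `d/dt ∫ ρ u · v + R'(u, p, ω, v)`. The test field `v` is fixed on the
reference domain and transported by the ALE map. -/
def resF (t : ℝ) (v : E d → E d) : ℝ :=
  deriv (fun τ => ∫ x in S.OmegaF q τ,
    S.phys.rhoF * inner ℝ (S.uF q τ x) (S.push q τ v x)) t + S.resF' q t v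

/-- The incompressibility form `-∫ (∇ · u) p` for a reference pressure test field `p` that is
transported to the current domain. -/
def incompr (t : ℝ) (p : E d → ℝ) : ℝ :=
  -∫ x in S.OmegaF q t, divg (S.uF q t) x * S.push q t p x

/-- The spatial part of the solid residual. -/
def resS' (t : ℝ) (w : E d → E d) : ℝ :=
  (∫ x in S.geom.solid.domain,
    contr (piolaStress S.phys.model S.phys.lamS S.phys.muS (grad (S.dS q t) x)) (grad w x))
  - ∫ x in S.geom.solidNeu, inner ℝ (S.phys.gS t x) (w x) ∂(μHE[d - 1])

/-- The full solid residual `∫ ρ ∂ₜₜd · w + R'(d, w)`. -/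
def resS (t : ℝ) (w : E d → E d) : ℝ :=
  (∫ x in S.geom.solid.domain, S.phys.rhoS * inner ℝ (S.accS q t x) (w x)) + S.resS' q t w

/-- The coordinates `q` solve the semi-discrete reduced-order model on the time interval `(0, T)`:
they have the regularity needed for the equations to make sense, the ALE map is an injective,
orientation-preserving map on the closed fluid domain (with Jacobian determinant positive up to
the boundary of every element), and the Galerkin equations hold: the sum of the fluid and the
solid residual vanishes on the pairs of port modes, the fluid and the solid residual vanish on the
respective bubbles, and the discrete incompressibility constraint holds. -/
structure IsSolution (T : ℝ) : Prop where
  aF_diff : ∀ t ∈ Set.Ioo 0 T, DifferentiableAt ℝ q.aF t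
  aS_diff : ∀ t ∈ Set.Ioo 0 T, DifferentiableAt ℝ q.aS t ∧ DifferentiableAt ℝ (deriv q.aS) t
  b_diff : ∀ t ∈ Set.Ioo 0 T, DifferentiableAt ℝ q.b t ∧ DifferentiableAt ℝ (deriv q.b) t
  ale_inj : ∀ t ∈ Set.Ioo 0 T, Set.InjOn (S.Phi q t) S.geom.fluid.closedDomain
  ale_jac : ∀ t ∈ Set.Ioo 0 T, ∀ s ∈ S.geom.fluid.elements,
    ∀ x ∈ convexHull ℝ (s : Set (E d)),
      0 < (fderivWithin ℝ (S.Phi q t) (convexHull ℝ (s : Set (E d))) x).det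
  port_eq : ∀ t ∈ Set.Ioo 0 T, ∀ j, S.resS q t (S.red.eS j) + S.resF q t (S.red.eF j) = 0
  fluid_eq : ∀ t ∈ Set.Ioo 0 T, ∀ i, S.resF q t (S.red.zF i) = 0
  incompr_eq : ∀ t ∈ Set.Ioo 0 T, ∀ i, S.incompr q t (S.red.zP i) = 0
  solid_eq : ∀ t ∈ Set.Ioo 0 T, ∀ i, S.resS q t (S.red.zS i) = 0

/-- The system is isolated on the time interval `(0, T)`: the reduced fluid velocity vanishes on
the non-interface boundary of the current fluid domain (the image under the ALE map of the
non-interface boundary of the reference fluid domain), and the traction that the system prescribes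
on the non-interface boundary of the solid is zero. The part `solidDir` of that boundary, where no
traction is prescribed, may be empty. -/
structure IsIsolated (T : ℝ) : Prop where
  fluid : ∀ t ∈ Set.Ioo 0 T, ∀ x ∈ S.Phi q t '' S.geom.fluidOuter, S.uF q t x = 0
  solid : ∀ t ∈ Set.Ioo 0 T, ∀ x ∈ S.geom.solidNeu, S.phys.gS t x = 0

/-- The kinetic energy of the fluid. -/
def kinF (t : ℝ) : ℝ := 1 / 2 * ∫ x in S.OmegaF q t, S.phys.rhoF * ‖S.uF q t x‖ ^ 2

/-- The kinetic energy of the solid. -/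
def kinS (t : ℝ) : ℝ :=
  1 / 2 * ∫ x in S.geom.solid.domain, S.phys.rhoS * ‖S.velS q t x‖ ^ 2

/-- The elastic energy stored in the solid. -/
def storedS (t : ℝ) : ℝ :=
  ∫ x in S.geom.solid.domain,
    storedDensity S.phys.lamS S.phys.muS (strain S.phys.model (grad (S.dS q t) x))

/-- The viscous dissipation. -/
def dissF (t : ℝ) : ℝ :=
  2 * S.phys.muF * ∫ x in S.OmegaF q t, contr (symGrad (S.uF q t) x) (symGrad (S.uF q t) x)

end ROM

end FSI

end

noncomputable section

namespace FSI

open Filter Topology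

set_option linter.unusedSectionVars false

/-! ### Lipschitz functions with compact support and the weak symmetry of second derivatives. -/

section Lipschitz

variable {V : Type*} [NormedAddCommGroup V] [NormedSpace ℝ V]

/-! The energy identity is the Galerkin system tested with the velocity of the coupled system. This
is admissible because the lifting drops out. If `c(t) ≠ 0`, isolation forces `ū = 0` on the
Dirichlet part; then `ū` may be tested against itself, its Dirichlet energy is zero, and it vanishes
because the domain is connected and `ū = 0` on the nonempty interface (`lift_eq_zero`). The fluid
velocity is then a combination of fluid bubbles and port modes, the solid velocity one of solid
bubbles and port modes, with the same port coefficients `β̇`, so the powers of the two residuals add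
up to zero (`resS_add_resF_eq_zero`).

In the solid, the stress power is the rate of the stored energy density, so the power of the
residual is the rate of the solid energy (`hasDerivAt_kinS_add_storedS`). In the fluid, everything
is pulled back to the reference domain. The pressure term vanishes because the pressure is itself a
combination of the pressure modes. With `J = det ∇Φ` and `J' = J div ω`, the inertial, convective
and ALE terms differ from the rate of the kinetic energy by `ρ/2 ∫ J div(|u|² (u - ω))`. The field
`|u|² (u - ω)` vanishes on the boundary: `u = ω` on the interface and `u = 0` elsewhere
(`hasDerivAt_kinF_resF`).

The analytic core is that this last integral is zero although the fields are only piecewise smooth.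
Pulled back, it is `∫ tr(∇w adj ∇Φ)` with `w = 0` on the boundary, a weak Piola identity
(`integral_trace_grad_mul_adjugate`). For `d = 2, 3` it expands into 2×2 or 3×3 Jacobian
determinants, null Lagrangians. For compactly supported Lipschitz functions their integrals vanish
by integration by parts, with mollification of one factor for 3×3; cutoffs with uniform gradient
bounds reduce the general case to this one.

Time derivatives pass under integrals because every field is a finite sum of functions of time
multiplied by functions of space (`Mesh.TimeSep`). -/

theorem exists_lipschitzOnWith_mul {s : Set V} {f g : V → ℝ} (hf : ∃ C, LipschitzOnWith C f s)
    (hg : ∃ C, LipschitzOnWith C g s) (hfb : ∃ A, ∀ x ∈ s, ‖f x‖ ≤ A)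
    (hgb : ∃ B, ∀ x ∈ s, ‖g x‖ ≤ B) : ∃ C, LipschitzOnWith C (fun x => f x * g x) s := by
  obtain ⟨C, hC⟩ := hf
  obtain ⟨D, hD⟩ := hg
  obtain ⟨A, hA⟩ := hfb
  obtain ⟨B, hB⟩ := hgb
  refine ⟨C * B.toNNReal + A.toNNReal * D, LipschitzOnWith.of_dist_le_mul fun x hx y hy => ?_⟩
  rw [Real.dist_eq, show f x * g x - f y * g y = (f x - f y) * g x + f y * (g x - g y) by ring]
  have h1 := hC.dist_le_mul x hx y hy
  have h2 := hD.dist_le_mul x hx y hy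
  rw [Real.dist_eq] at h1 h2
  calc |(f x - f y) * g x + f y * (g x - g y)|
      ≤ |f x - f y| * |g x| + |f y| * |g x - g y| := by
        refine (abs_add_le _ _).trans ?_
        rw [abs_mul, abs_mul]
    _ ≤ (C * dist x y) * B.toNNReal + A.toNNReal * (D * dist x y) := by
        gcongr
        · exact (hB x hx).trans (Real.le_coe_toNNReal B)
        · exact (hA y hy).trans (Real.le_coe_toNNReal A)
    _ = _ := by push_cast; ring

/-- Lipschitz functions with compact support. -/
def LipCompact (f : V → ℝ) : Prop := (∃ C, LipschitzWith C f) ∧ HasCompactSupport f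

namespace LipCompact

theorem continuous {f : V → ℝ} (hf : LipCompact f) : Continuous f := hf.1.choose_spec.continuous

theorem exists_norm_le {f : V → ℝ} (hf : LipCompact f) : ∃ C, ∀ x, ‖f x‖ ≤ C :=
  hf.continuous.bounded_above_of_compact_support hf.2

theorem mul {f g : V → ℝ} (hf : LipCompact f) (hg : LipCompact g) :
    LipCompact fun x => f x * g x := by
  refine ⟨?_, hf.2.mul_right⟩
  simp only [← lipschitzOnWith_univ]
  refine exists_lipschitzOnWith_mul (by simpa using hf.1) (by simpa using hg.1) ?_ ?_
  · simpa using hf.exists_norm_le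
  · simpa using hg.exists_norm_le

theorem translate [FiniteDimensional ℝ V] {f : V → ℝ} (hf : LipCompact f) (a : V) :
    LipCompact fun x => f (x + a) := by
  obtain ⟨⟨C, hC⟩, hfc⟩ := hf
  refine ⟨⟨C, ?_⟩, hfc.comp_homeomorph (Homeomorph.addRight a)⟩
  refine LipschitzWith.of_dist_le_mul fun x y => ?_
  simpa using hC.dist_le_mul (x + a) (y + a)

theorem of_contDiff {f : V → ℝ} (hf : ContDiff ℝ 1 f) (hc : HasCompactSupport f) :
    LipCompact f := ⟨ContDiff.lipschitzWith_of_hasCompactSupport hc hf (by simp), hc⟩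

variable [FiniteDimensional ℝ V] [MeasurableSpace V] [BorelSpace V]
  {μ : Measure V} [μ.IsAddHaarMeasure]

theorem ae_differentiableAt {f : V → ℝ} (hf : LipCompact f) : ∀ᵐ x ∂μ, DifferentiableAt ℝ f x :=
  hf.1.choose_spec.ae_differentiableAt

theorem exists_norm_fderiv_le {f : V → ℝ} (hf : LipCompact f) (v : V) :
    ∃ C, ∀ x, ‖fderiv ℝ f x v‖ ≤ C := by
  obtain ⟨⟨C, hC⟩, -⟩ := hf
  refine ⟨C * ‖v‖, fun x => ((fderiv ℝ f x).le_opNorm v).trans ?_⟩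
  gcongr
  exact norm_fderiv_le_of_lipschitz ℝ hC

theorem integrable_fderiv {f : V → ℝ} (hf : LipCompact f) (v : V) :
    Integrable (fun x => fderiv ℝ f x v) μ := by
  obtain ⟨C, hC⟩ := hf.exists_norm_fderiv_le v
  have hs : HasCompactSupport fun x => fderiv ℝ f x v := hf.2.fderiv_apply ℝ v
  have : IntegrableOn (fun x => fderiv ℝ f x v) (tsupport fun x => fderiv ℝ f x v) μ :=
    Measure.integrableOn_of_bounded hs.isCompact.measure_lt_top.ne
      (measurable_fderiv_apply_const ℝ f v).aestronglyMeasurable (ae_of_all _ hC)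
  rwa [integrableOn_iff_integrable_of_support_subset (subset_tsupport _)] at this

theorem integrable_mul_fderiv {f : V → ℝ} (hf : LipCompact f) (v : V) {h : V → ℝ}
    (hm : AEStronglyMeasurable h μ) {C : ℝ} (hC : ∀ x, ‖h x‖ ≤ C) :
    Integrable (fun x => h x * fderiv ℝ f x v) μ :=
  (hf.integrable_fderiv v).bdd_mul hm (ae_of_all _ hC)

theorem integrable_fderiv_mul_fderiv {f g : V → ℝ} (hf : LipCompact f) (hg : LipCompact g)
    (u v : V) : Integrable (fun x => fderiv ℝ f x u * fderiv ℝ g x v) μ := by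
  obtain ⟨C, hC⟩ := hf.exists_norm_fderiv_le u
  exact hg.integrable_mul_fderiv v (measurable_fderiv_apply_const ℝ f u).aestronglyMeasurable hC

theorem ae_lineDeriv {f : V → ℝ} (hf : LipCompact f) (v : V) :
    (fun x => lineDeriv ℝ f x v) =ᵐ[μ] fun x => fderiv ℝ f x v := by
  filter_upwards [hf.ae_differentiableAt] with x hx using hx.lineDeriv_eq_fderiv

theorem integral_fderiv_mul {f g : V → ℝ} (hf : LipCompact f) (hg : LipCompact g) (v : V) :
    ∫ x, fderiv ℝ f x v * g x ∂μ = -∫ x, f x * fderiv ℝ g x v ∂μ := by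
  obtain ⟨C, hC⟩ := hf.1
  obtain ⟨D, hD⟩ := hg.1
  have h := LipschitzWith.integral_lineDeriv_mul_eq (μ := μ) hC hD hg.2 v
  rw [← integral_neg]
  refine Eq.trans (integral_congr_ae ?_) (h.trans (integral_congr_ae ?_))
  · filter_upwards [hf.ae_lineDeriv v] with x hx
    rw [hx]
  · filter_upwards [hg.ae_lineDeriv (-v)] with x hx
    rw [hx, map_neg]
    ring

/-- Second derivatives commute, in the weak sense. -/
theorem integral_fderiv_mul_fderiv_comm {f g : V → ℝ} (hf : LipCompact f) (hg : LipCompact g)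
    (u v : V) :
    ∫ x, fderiv ℝ f x u * fderiv ℝ g x v ∂μ = ∫ x, fderiv ℝ f x v * fderiv ℝ g x u ∂μ := by
  obtain ⟨C, hC⟩ := hf.1
  obtain ⟨D, hD⟩ := hg.1
  have A := LipschitzWith.integral_inv_smul_sub_mul_tendsto_integral_lineDeriv_mul (μ := μ) hC
    (hg.integrable_fderiv v) u
  have B := (LipschitzWith.integral_inv_smul_sub_mul_tendsto_integral_lineDeriv_mul (μ := μ) hD
    (hf.integrable_fderiv v) (-u)).neg
  -- At a fixed step `t`, the difference quotient in direction `u` moves from `f` to `g` by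
  -- translation invariance, and the `v`-derivative moves from `g` to `f` by parts. Second
  -- derivatives never appear; the claim is the limit `t → 0⁺`.
  have key : ∀ t : ℝ, ∫ x, (t⁻¹ • (f (x + t • u) - f x)) * fderiv ℝ g x v ∂μ =
      -∫ x, (t⁻¹ • (g (x + t • (-u)) - g x)) * fderiv ℝ f x v ∂μ := by
    intro t
    have hgt := hg.translate (t • (-u))
    have hft := hf.translate (t • u)
    have e1 : ∫ x, f (x + t • u) * fderiv ℝ g x v ∂μ =
        -∫ x, fderiv ℝ f x v * g (x + t • (-u)) ∂μ := by
      rw [hf.integral_fderiv_mul hgt v, neg_neg,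
        ← integral_add_right_eq_self _ (t • (-u))]
      refine integral_congr_ae (ae_of_all _ fun x => ?_)
      simp only [fderiv_comp_add_right]
      simp
    have e2 : ∫ x, f x * fderiv ℝ g x v ∂μ = -∫ x, fderiv ℝ f x v * g x ∂μ := by
      rw [hf.integral_fderiv_mul hg v, neg_neg]
    obtain ⟨b1, hb1⟩ := hft.continuous.bounded_above_of_compact_support hft.2
    obtain ⟨b2, hb2⟩ := hf.continuous.bounded_above_of_compact_support hf.2
    obtain ⟨b3, hb3⟩ := hgt.continuous.bounded_above_of_compact_support hgt.2
    obtain ⟨b4, hb4⟩ := hg.continuous.bounded_above_of_compact_support hg.2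
    have i1 := hg.integrable_mul_fderiv (μ := μ) v hft.continuous.aestronglyMeasurable hb1
    have i2 := hg.integrable_mul_fderiv (μ := μ) v hf.continuous.aestronglyMeasurable hb2
    have i3 := hf.integrable_mul_fderiv (μ := μ) v hgt.continuous.aestronglyMeasurable hb3
    have i4 := hf.integrable_mul_fderiv (μ := μ) v hg.continuous.aestronglyMeasurable hb4
    simp only [smul_eq_mul, mul_assoc, integral_const_mul, sub_mul]
    rw [integral_sub i1 i2, integral_sub i3 i4, e1, e2]
    simp only [mul_comm (fderiv ℝ f _ v)]
    ring
  simp only [key] at A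
  have := tendsto_nhds_unique A B
  refine Eq.trans (integral_congr_ae ?_) (this.trans ?_)
  · filter_upwards [hf.ae_lineDeriv u] with x hx
    rw [hx]
  · rw [← integral_neg]
    refine integral_congr_ae ?_
    filter_upwards [hg.ae_lineDeriv (-u)] with x hx
    rw [hx, map_neg]
    ring

end LipCompact

end Lipschitz

/-! ### Mollification and the 3×3 Jacobian of compactly supported Lipschitz functions. -/

section Mollify

variable {V : Type*} [NormedAddCommGroup V] [NormedSpace ℝ V] [FiniteDimensional ℝ V]
  [MeasurableSpace V] [BorelSpace V] {μ : Measure V} [μ.IsAddHaarMeasure]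

/-- The function `det (∇w, ∇f, ∇g)` in three directions. -/
def tripleJac (e₀ e₁ e₂ : V) (w f g : V → ℝ) (x : V) : ℝ :=
  (fderiv ℝ w x e₀ * fderiv ℝ f x e₁ - fderiv ℝ w x e₁ * fderiv ℝ f x e₀) * fderiv ℝ g x e₂
  + (fderiv ℝ w x e₁ * fderiv ℝ f x e₂ - fderiv ℝ w x e₂ * fderiv ℝ f x e₁) * fderiv ℝ g x e₀
  + (fderiv ℝ w x e₂ * fderiv ℝ f x e₀ - fderiv ℝ w x e₀ * fderiv ℝ f x e₂) * fderiv ℝ g x e₁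

/-- A mollification at scale `1/(n+1)` of a Lipschitz function. -/
theorem LipCompact.exists_smooth_approx {g : V → ℝ} (hg : LipCompact g) :
    ∃ G : ℕ → V → ℝ, (∀ n, ContDiff ℝ 2 (G n) ∧ HasCompactSupport (G n)) ∧
      (∃ C, ∀ n x v, ‖fderiv ℝ (G n) x v‖ ≤ C * ‖v‖) ∧
      ∀ v, ∀ᵐ x ∂μ, Tendsto (fun n => fderiv ℝ (G n) x v) atTop (𝓝 (fderiv ℝ g x v)) := by
  obtain ⟨C, hC⟩ := hg.1
  -- The outer radius is twice the inner one; this ratio is the bound `K = 2` used below for almost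
  -- everywhere convergence of the convolutions.
  let φ : ℕ → ContDiffBump (0 : V) := fun n =>
    ⟨1 / (n + 1 : ℝ), 2 / (n + 1 : ℝ), by positivity, by gcongr; norm_num⟩
  let G : ℕ → V → ℝ := fun n =>
    convolution ((φ n).normed μ) g (ContinuousLinearMap.lsmul ℝ ℝ) μ
  have hG : ∀ n, ContDiff ℝ 2 (G n) := fun n =>
    (φ n).hasCompactSupport_normed.contDiff_convolution_left _ (φ n).contDiff_normed
      hg.continuous.locallyIntegrable
  have hφi : ∀ n, Integrable ((φ n).normed μ) μ := fun n => (φ n).integrable_normed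
  have hgb := hg.exists_norm_le
  -- The derivative is placed on `g`, not on the bump. Hence the Lipschitz constant of `g` bounds
  -- all the gradients, and these converge almost everywhere as averages of an integrable function.
  have hder : ∀ v n, ∀ x, fderiv ℝ (G n) x v = convolution ((φ n).normed μ)
      (fun y => fderiv ℝ g y v) (ContinuousLinearMap.lsmul ℝ ℝ) μ x := by
    intro v n x
    have h1 : HasDerivAt (fun t : ℝ => G n (x + t • v)) (fderiv ℝ (G n) x v) 0 := by
      have := ((hG n).differentiable (by norm_num) x).hasFDerivAt
      exact (this.hasLineDerivAt v)
    have hdiff : ∀ᵐ y ∂μ, DifferentiableAt ℝ g (x - y) := by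
      have := hg.ae_differentiableAt (μ := μ)
      exact (quasiMeasurePreserving_sub_left μ x).ae this
    have h2 := (hasDerivAt_integral_of_dominated_loc_of_lip (μ := μ) (𝕜 := ℝ) (x₀ := (0 : ℝ))
      (s := Set.univ) (F := fun t y => (φ n).normed μ y * g (x + t • v - y))
      (F' := fun y => (φ n).normed μ y * fderiv ℝ g (x - y) v)
      (bound := fun y => (φ n).normed μ y * (C * ‖v‖)) univ_mem ?_ ?_ ?_ ?_ ?_ ?_).2
    · have e : (fun t : ℝ => G n (x + t • v)) =
          fun t : ℝ => ∫ y, (φ n).normed μ y * g (x + t • v - y) ∂μ := by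
        funext t
        simp [G, convolution]
      rw [e] at h1
      rw [h1.unique h2]
      simp [convolution]
    · refine Eventually.of_forall fun t => ?_
      exact ((φ n).continuous_normed.mul (hg.continuous.comp (by fun_prop))).aestronglyMeasurable
    · obtain ⟨b, hb⟩ := hgb
      exact (hφi n).mul_bdd (c := b)
        (hg.continuous.comp (by fun_prop : Continuous fun y => x + (0 : ℝ) • v - y)).aestronglyMeasurable
        (ae_of_all _ fun y => hb _)
    · refine ((φ n).continuous_normed.aestronglyMeasurable).mul ?_
      exact ((measurable_fderiv_apply_const ℝ g v).comp
        (measurable_const.sub measurable_id)).aestronglyMeasurable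
    · refine ae_of_all _ fun y => ?_
      refine LipschitzWith.lipschitzOnWith (LipschitzWith.of_dist_le_mul fun s t => ?_)
      have h3 := hC.dist_le_mul (x + s • v - y) (x + t • v - y)
      have h4 : dist (x + s • v - y) (x + t • v - y) = dist s t * ‖v‖ := by
        rw [dist_eq_norm, dist_eq_norm, ← norm_smul]
        congr 1
        module
      rw [h4] at h3
      have h0 : 0 ≤ (φ n).normed μ y := (φ n).nonneg_normed y
      have h0' : 0 ≤ (φ n).normed μ y * (C * ‖v‖) := mul_nonneg h0 (by positivity)
      rw [Real.dist_eq, ← mul_sub, abs_mul, abs_of_nonneg h0, Real.coe_nnabs, abs_of_nonneg h0',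
        ← Real.dist_eq]
      calc _ ≤ (φ n).normed μ y * (C * (dist s t * ‖v‖)) := by gcongr
        _ = _ := by ring
    · exact (hφi n).mul_const _
    · filter_upwards [hdiff] with y hy
      have h5 := hy.hasFDerivAt.hasLineDerivAt v
      have h6 : HasDerivAt (fun t : ℝ => g (x + t • v - y)) (fderiv ℝ g (x - y) v) 0 := by
        refine HasDerivAt.congr_of_eventuallyEq h5 (Eventually.of_forall fun t => ?_)
        simp only
        congr 1
        abel
      exact h6.const_mul _
  refine ⟨G, fun n => ⟨hG n, ?_⟩, ⟨C, fun n x v => ?_⟩, fun v => ?_⟩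
  · exact (φ n).hasCompactSupport_normed.convolution _ hg.2
  · rw [hder v n x]
    have hb : ∀ y, ‖fderiv ℝ g y v‖ ≤ C * ‖v‖ := fun y =>
      ((fderiv ℝ g y).le_opNorm v).trans (by gcongr; exact norm_fderiv_le_of_lipschitz ℝ hC)
    simp only [convolution, ContinuousLinearMap.lsmul_apply, smul_eq_mul]
    calc _ ≤ ∫ y, (φ n).normed μ y * (C * ‖v‖) ∂μ := by
          refine norm_integral_le_of_norm_le ((hφi n).mul_const _) (ae_of_all _ fun y => ?_)
          rw [norm_mul, Real.norm_of_nonneg ((φ n).nonneg_normed y)]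
          exact mul_le_mul_of_nonneg_left (hb _) ((φ n).nonneg_normed y)
      _ = _ := by rw [integral_mul_const, (φ n).integral_normed, one_mul]
  · simp only [hder v]
    refine ContDiffBump.ae_convolution_tendsto_right_of_locallyIntegrable (K := 2) ?_ ?_ ?_
    · have : Tendsto (fun n : ℕ => 2 * (1 / ((n : ℝ) + 1))) atTop (𝓝 (2 * 0)) :=
        tendsto_one_div_add_atTop_nhds_zero_nat.const_mul 2
      rw [mul_zero] at this
      refine this.congr fun n => ?_
      simp only [φ]
      ring
    · refine Eventually.of_forall fun n => ?_
      simp only [φ]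
      exact le_of_eq (by ring)
    · exact (hg.integrable_fderiv v).locallyIntegrable

theorem LipCompact.integrable_tripleJac {w f g : V → ℝ} (hw : LipCompact w) (hf : LipCompact f)
    (hg : LipCompact g) (e₀ e₁ e₂ : V) : Integrable (tripleJac e₀ e₁ e₂ w f g) μ := by
  have h : ∀ a b c, Integrable (fun x => fderiv ℝ w x a * fderiv ℝ f x b * fderiv ℝ g x c) μ := by
    intro a b c
    obtain ⟨C, hC⟩ := hw.exists_norm_fderiv_le a
    obtain ⟨D, hD⟩ := hf.exists_norm_fderiv_le b
    refine hg.integrable_mul_fderiv (C := C * D) c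
      ((measurable_fderiv_apply_const ℝ w a).mul
        (measurable_fderiv_apply_const ℝ f b)).aestronglyMeasurable fun x => ?_
    rw [norm_mul]
    exact mul_le_mul (hC x) (hD x) (norm_nonneg _) ((norm_nonneg _).trans (hC x))
  unfold tripleJac
  simp only [sub_mul]
  exact (((h e₀ e₁ e₂).sub (h e₁ e₀ e₂)).add ((h e₁ e₂ e₀).sub (h e₂ e₁ e₀))).add
    ((h e₂ e₀ e₁).sub (h e₀ e₂ e₁))

/-- For `g` of class C², the determinant is a cyclic sum of 2×2 Jacobians of `w` and `f ∂_c g`: the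
extra terms with second derivatives of `g` cancel by symmetry of the Hessian. Each 2×2 Jacobian
integrates to zero by weak commutation of derivatives. -/
theorem LipCompact.integral_tripleJac_of_contDiff {w f g : V → ℝ} (hw : LipCompact w)
    (hf : LipCompact f) (hg : ContDiff ℝ 2 g) (hgc : HasCompactSupport g) (e₀ e₁ e₂ : V) :
    ∫ x, tripleJac e₀ e₁ e₂ w f g x ∂μ = 0 := by
  have hγc : ∀ c, ContDiff ℝ 1 fun x => fderiv ℝ g x c := fun c =>
    (hg.fderiv_right (m := 1) (by norm_num)).clm_apply contDiff_const
  have hγ : ∀ c, LipCompact fun x => fderiv ℝ g x c := fun c =>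
    .of_contDiff (hγc c) (hgc.fderiv_apply ℝ c)
  have hsymm : ∀ x a b, fderiv ℝ (fun y => fderiv ℝ g y a) x b =
      fderiv ℝ (fun y => fderiv ℝ g y b) x a := by
    intro x a b
    have hd : DifferentiableAt ℝ (fderiv ℝ g) x :=
      (hg.fderiv_right (m := 1) (by norm_num)).differentiable (by norm_num) x
    rw [fderiv_clm_apply hd (differentiableAt_const _), fderiv_clm_apply hd
      (differentiableAt_const _)]
    simp only [fderiv_fun_const, Pi.zero_apply, ContinuousLinearMap.comp_zero, zero_add,
      ContinuousLinearMap.flip_apply]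
    exact hg.contDiffAt.isSymmSndFDerivAt (by simp) b a
  have hmain : ∀ a b c, ∫ x, (fderiv ℝ w x a * fderiv ℝ (fun y => f y * fderiv ℝ g y c) x b
      - fderiv ℝ w x b * fderiv ℝ (fun y => f y * fderiv ℝ g y c) x a) ∂μ = 0 := by
    intro a b c
    rw [integral_sub (hw.integrable_fderiv_mul_fderiv (hf.mul (hγ c)) a b)
      (hw.integrable_fderiv_mul_fderiv (hf.mul (hγ c)) b a),
      hw.integral_fderiv_mul_fderiv_comm (hf.mul (hγ c)) a b, sub_self]
  have hint : ∀ a b c, Integrable (fun x => fderiv ℝ w x a *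
      fderiv ℝ (fun y => f y * fderiv ℝ g y c) x b
      - fderiv ℝ w x b * fderiv ℝ (fun y => f y * fderiv ℝ g y c) x a) μ := fun a b c =>
    (hw.integrable_fderiv_mul_fderiv (hf.mul (hγ c)) a b).sub
      (hw.integrable_fderiv_mul_fderiv (hf.mul (hγ c)) b a)
  calc ∫ x, tripleJac e₀ e₁ e₂ w f g x ∂μ
      = ∫ x, ((fderiv ℝ w x e₀ * fderiv ℝ (fun y => f y * fderiv ℝ g y e₂) x e₁
          - fderiv ℝ w x e₁ * fderiv ℝ (fun y => f y * fderiv ℝ g y e₂) x e₀)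
        + (fderiv ℝ w x e₁ * fderiv ℝ (fun y => f y * fderiv ℝ g y e₀) x e₂
          - fderiv ℝ w x e₂ * fderiv ℝ (fun y => f y * fderiv ℝ g y e₀) x e₁)
        + (fderiv ℝ w x e₂ * fderiv ℝ (fun y => f y * fderiv ℝ g y e₁) x e₀
          - fderiv ℝ w x e₀ * fderiv ℝ (fun y => f y * fderiv ℝ g y e₁) x e₂)) ∂μ := by
        refine integral_congr_ae ?_
        filter_upwards [hf.ae_differentiableAt] with x hx
        have hp : ∀ a c, fderiv ℝ (fun y => f y * fderiv ℝ g y c) x a =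
            fderiv ℝ f x a * fderiv ℝ g x c
              + f x * fderiv ℝ (fun y => fderiv ℝ g y c) x a := by
          intro a c
          rw [fderiv_fun_mul hx ((hγc c).differentiable (by norm_num) x)]
          simp
          ring
        simp only [tripleJac, hp, hsymm x e₁ e₀, hsymm x e₂ e₀, hsymm x e₂ e₁]
        ring
    _ = 0 := by
        refine (integral_add ((hint e₀ e₁ e₂).add (hint e₁ e₂ e₀)) (hint e₂ e₀ e₁)).trans ?_
        rw [hmain, integral_add' (hint _ _ _) (hint _ _ _), hmain, hmain]
        simp

/-- The Jacobian determinant of three compactly supported Lipschitz functions integrates to zero. -/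
theorem LipCompact.integral_tripleJac {w f g : V → ℝ} (hw : LipCompact w)
    (hf : LipCompact f) (hg : LipCompact g) (e₀ e₁ e₂ : V) :
    ∫ x, tripleJac e₀ e₁ e₂ w f g x ∂μ = 0 := by
  obtain ⟨G, hG, ⟨C, hC⟩, hlim⟩ := hg.exists_smooth_approx (μ := μ)
  have hb : ∀ a b, Integrable (fun x => ‖fderiv ℝ w x a * fderiv ℝ f x b‖) μ := fun a b =>
    (hw.integrable_fderiv_mul_fderiv hf a b).norm
  -- Only `g` is mollified, so products of first derivatives of `w` and `f` provide a fixed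
  -- integrable majorant.
  have hT : Tendsto (fun n => ∫ x, tripleJac e₀ e₁ e₂ w f (G n) x ∂μ) atTop
      (𝓝 (∫ x, tripleJac e₀ e₁ e₂ w f g x ∂μ)) := by
    refine tendsto_integral_of_dominated_convergence
      (fun x => (‖fderiv ℝ w x e₀ * fderiv ℝ f x e₁‖ + ‖fderiv ℝ w x e₁ * fderiv ℝ f x e₀‖)
          * (C * ‖e₂‖)
        + (‖fderiv ℝ w x e₁ * fderiv ℝ f x e₂‖ + ‖fderiv ℝ w x e₂ * fderiv ℝ f x e₁‖)
          * (C * ‖e₀‖)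
        + (‖fderiv ℝ w x e₂ * fderiv ℝ f x e₀‖ + ‖fderiv ℝ w x e₀ * fderiv ℝ f x e₂‖)
          * (C * ‖e₁‖)) (fun n => ?_) ?_ (fun n => ae_of_all _ fun x => ?_) ?_
    · exact (hw.integrable_tripleJac hf
        (.of_contDiff ((hG n).1.of_le (by norm_num)) (hG n).2) _ _ _).aestronglyMeasurable
    · exact ((((hb _ _).add (hb _ _)).mul_const _).add (((hb _ _).add (hb _ _)).mul_const _)).add
        (((hb _ _).add (hb _ _)).mul_const _)
    · unfold tripleJac
      refine (norm_add₃_le).trans ?_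
      simp only [norm_mul (_ - _)]
      gcongr
      all_goals first | exact norm_sub_le _ _ | exact hC _ _ _
    · filter_upwards [hlim e₀, hlim e₁, hlim e₂] with x h0 h1 h2
      exact ((h2.const_mul _).add (h0.const_mul _)).add (h1.const_mul _)
  simp only [fun n => hw.integral_tripleJac_of_contDiff (μ := μ) hf (hG n).1 (hG n).2 e₀ e₁ e₂]
    at hT
  exact (tendsto_nhds_unique hT tendsto_const_nhds)

end Mollify

/-! ### Closed simplices, the union of the open elements, and piecewise smooth functions. -/

section Mesh

variable {d : ℕ}

/-- The closed simplex spanned by a finite set of vertices. -/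
abbrev cell (s : Finset (E d)) : Set (E d) := convexHull ℝ (s : Set (E d))

theorem isCompact_cell (s : Finset (E d)) : IsCompact (cell s) :=
  s.finite_toSet.isCompact_convexHull (𝕜 := ℝ)

theorem isClosed_cell (s : Finset (E d)) : IsClosed (cell s) := (isCompact_cell s).isClosed

theorem convex_cell (s : Finset (E d)) : Convex ℝ (cell s) := convex_convexHull _ _

namespace Mesh

variable (K : Mesh d)

theorem elements_finite : K.elements.Finite := K.finite.subset fun _ h => h.1

instance : Finite K.elements := K.elements_finite

variable {K}

theorem interior_cell_nonempty {s : Finset (E d)} (hs : s ∈ K.elements) :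
    (interior (cell s)).Nonempty := by
  rw [interior_convexHull_nonempty_iff_affineSpan_eq_top]
  have h := (K.complex.indep hs.1).affineSpan_eq_top_iff_card_eq_finrank_add_one.2
    (by simp [hs.2])
  simpa using h

theorem cell_eq_closure_interior {s : Finset (E d)} (hs : s ∈ K.elements) :
    closure (interior (cell s)) = cell s := by
  rw [(convex_cell s).closure_interior_eq_closure_of_nonempty_interior (interior_cell_nonempty hs),
    (isClosed_cell s).closure_eq]

theorem cell_subset_closedDomain {s : Finset (E d)} (hs : s ∈ K.elements) :
    cell s ⊆ K.closedDomain := K.complex.convexHull_subset_space hs.1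

variable (K) in
theorem closedDomain_eq : K.closedDomain = ⋃ s : K.elements, cell (s : Finset (E d)) := by
  refine Set.Subset.antisymm (fun x hx => ?_) (Set.iUnion_subset fun s =>
    cell_subset_closedDomain s.2)
  obtain ⟨s, hs, hxs⟩ := K.complex.mem_space_iff.1 hx
  obtain ⟨t, ht, hst, hc⟩ := K.pure s hs
  exact Set.mem_iUnion.2 ⟨⟨t, ht, hc⟩, convexHull_mono (by exact_mod_cast hst) hxs⟩

theorem exists_cell_of_mem {x : E d} (hx : x ∈ K.closedDomain) :
    ∃ s ∈ K.elements, x ∈ cell s := by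
  rw [K.closedDomain_eq] at hx
  obtain ⟨s, hs⟩ := Set.mem_iUnion.1 hx
  exact ⟨s, s.2, hs⟩

variable (K)

theorem isCompact_closedDomain : IsCompact K.closedDomain := by
  rw [K.closedDomain_eq]
  exact isCompact_iUnion fun s => isCompact_cell _

theorem isClosed_closedDomain : IsClosed K.closedDomain := K.isCompact_closedDomain.isClosed

theorem domain_subset_closedDomain : K.domain ⊆ K.closedDomain := interior_subset

theorem isOpen_domain : IsOpen K.domain := isOpen_interior

theorem bdry_eq : K.bdry = K.closedDomain \ K.domain :=
  K.isClosed_closedDomain.frontier_eq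

theorem bdry_subset_closedDomain : K.bdry ⊆ K.closedDomain :=
  K.bdry_eq ▸ Set.sdiff_subset

/-- The union of the open elements. -/
def core : Set (E d) := ⋃ s : K.elements, interior (cell (s : Finset (E d)))

theorem isOpen_core : IsOpen K.core := isOpen_iUnion fun _ => isOpen_interior

variable {K} in
theorem exists_of_mem_core {x : E d} (hx : x ∈ K.core) :
    ∃ s ∈ K.elements, x ∈ interior (cell s) := by
  obtain ⟨s, hs⟩ := Set.mem_iUnion.1 hx
  exact ⟨s, s.2, hs⟩

theorem core_subset_domain : K.core ⊆ K.domain :=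
  Set.iUnion_subset fun s => interior_mono (cell_subset_closedDomain s.2)

theorem core_subset_closedDomain : K.core ⊆ K.closedDomain :=
  K.core_subset_domain.trans K.domain_subset_closedDomain

theorem closedDomain_diff_core_subset :
    K.closedDomain \ K.core ⊆ ⋃ s : K.elements, frontier (cell (s : Finset (E d))) := by
  rintro x ⟨hx, hxc⟩
  obtain ⟨s, hs, hxs⟩ := exists_cell_of_mem hx
  refine Set.mem_iUnion.2 ⟨⟨s, hs⟩, subset_closure hxs, fun h => hxc ?_⟩
  exact Set.mem_iUnion.2 ⟨⟨s, hs⟩, h⟩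

theorem volume_closedDomain_diff_core : volume (K.closedDomain \ K.core) = 0 :=
  measure_mono_null K.closedDomain_diff_core_subset
    (measure_iUnion_null fun _ => (convex_cell _).addHaar_frontier _)

theorem core_ae_eq_domain : K.core =ᵐ[volume] K.domain := by
  refine (K.core_subset_domain.eventuallyLE).antisymm ?_
  rw [ae_le_set]
  exact measure_mono_null (Set.sdiff_subset_sdiff_left K.domain_subset_closedDomain)
    K.volume_closedDomain_diff_core

theorem setIntegral_domain (f : E d → ℝ) : ∫ x in K.domain, f x = ∫ x in K.core, f x :=
  (setIntegral_congr_set K.core_ae_eq_domain).symm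

/-- Purity of the complex excludes lower-dimensional parts sticking out of the closure of the
interior. This carries connectedness from the open domain to the closed one. -/
theorem closedDomain_eq_closure : K.closedDomain = closure K.domain := by
  refine Set.Subset.antisymm (fun x hx => ?_)
    (closure_minimal K.domain_subset_closedDomain K.isClosed_closedDomain)
  obtain ⟨s, hs, hxs⟩ := exists_cell_of_mem hx
  rw [← cell_eq_closure_interior hs] at hxs
  exact closure_mono (interior_mono (cell_subset_closedDomain hs)) hxs

/-! ### Piecewise smooth functions -/

/-- Functions that agree on every closed element with a continuously differentiable function. -/
def PwSmooth (v : E d → ℝ) : Prop :=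
  ∀ s ∈ K.elements, ∃ p : E d → ℝ, ContDiff ℝ 1 p ∧ Set.EqOn v p (cell s)

/-- Functions that agree on every open element with a function that is continuous on the closed
element. -/
def PwCont (v : E d → ℝ) : Prop :=
  ∀ s ∈ K.elements, ∃ g : E d → ℝ, ContinuousOn g (cell s) ∧ Set.EqOn v g (interior (cell s))

variable {K}

theorem contDiff_mvPolynomial_eval (p : MvPolynomial (Fin d) ℝ) :
    ContDiff ℝ 1 fun x : E d => MvPolynomial.eval (fun i => x i) p := by
  induction p using MvPolynomial.induction_on with
  | C a => simpa using contDiff_const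
  | add p q hp hq => simpa using hp.add hq
  | mul_X p i hp => simpa using hp.mul (by fun_prop : ContDiff ℝ 1 fun x : E d => x i)

theorem IsFE.pwSmooth {k : ℕ} {v : E d → ℝ} (h : K.IsFE k v) : K.PwSmooth v := by
  intro s hs
  obtain ⟨p, -, hp⟩ := h s hs
  exact ⟨_, contDiff_mvPolynomial_eval p, fun x hx => hp x hx⟩

namespace PwSmooth

variable {v w : E d → ℝ}

theorem of_contDiff (hv : ContDiff ℝ 1 v) : K.PwSmooth v := fun _ _ => ⟨v, hv, fun _ _ => rfl⟩

theorem const (c : ℝ) : K.PwSmooth fun _ => c := of_contDiff contDiff_const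

theorem coord (i : Fin d) : K.PwSmooth fun x => x i :=
  of_contDiff (by fun_prop)

theorem add (hv : K.PwSmooth v) (hw : K.PwSmooth w) : K.PwSmooth fun x => v x + w x := by
  intro s hs
  obtain ⟨p, hp, hvp⟩ := hv s hs
  obtain ⟨r, hr, hwr⟩ := hw s hs
  exact ⟨fun x => p x + r x, hp.add hr, fun x hx => by simp only [hvp hx, hwr hx]⟩

theorem mul (hv : K.PwSmooth v) (hw : K.PwSmooth w) : K.PwSmooth fun x => v x * w x := by
  intro s hs
  obtain ⟨p, hp, hvp⟩ := hv s hs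
  obtain ⟨r, hr, hwr⟩ := hw s hs
  exact ⟨fun x => p x * r x, hp.mul hr, fun x hx => by simp only [hvp hx, hwr hx]⟩

theorem const_mul (c : ℝ) (hv : K.PwSmooth v) : K.PwSmooth fun x => c * v x := (const c).mul hv

theorem sub (hv : K.PwSmooth v) (hw : K.PwSmooth w) : K.PwSmooth fun x => v x - w x := by
  simpa [sub_eq_add_neg] using hv.add (hw.const_mul (-1))

theorem sum {ι : Type*} (t : Finset ι) {f : ι → E d → ℝ} (h : ∀ i ∈ t, K.PwSmooth (f i)) :
    K.PwSmooth fun x => ∑ i ∈ t, f i x := by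
  classical
  induction t using Finset.induction_on with
  | empty => simpa using const 0
  | insert a t ha ih =>
    simp only [Finset.sum_insert ha]
    exact (h a (by simp)).add (ih fun i hi => h i (by simp [hi]))

theorem eventuallyEq (hv : K.PwSmooth v) {x : E d} (hx : x ∈ K.core) :
    ∃ p : E d → ℝ, ContDiff ℝ 1 p ∧ v =ᶠ[𝓝 x] p := by
  obtain ⟨s, hs, hxs⟩ := exists_of_mem_core hx
  obtain ⟨p, hp, h⟩ := hv s hs
  exact ⟨p, hp, eventuallyEq_of_mem (mem_interior_iff_mem_nhds.1 hxs) h⟩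

theorem contDiffAt (hv : K.PwSmooth v) {x : E d} (hx : x ∈ K.core) : ContDiffAt ℝ 1 v x := by
  obtain ⟨p, hp, h⟩ := hv.eventuallyEq hx
  exact hp.contDiffAt.congr_of_eventuallyEq h

theorem differentiableAt (hv : K.PwSmooth v) {x : E d} (hx : x ∈ K.core) :
    DifferentiableAt ℝ v x := (hv.contDiffAt hx).differentiableAt (by norm_num)

theorem continuousOn (hv : K.PwSmooth v) : ContinuousOn v K.closedDomain := by
  rw [K.closedDomain_eq]
  refine (locallyFinite_of_finite _).continuousOn_iUnion (fun s => isClosed_cell _) fun s => ?_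
  obtain ⟨p, hp, h⟩ := hv s s.2
  exact hp.continuous.continuousOn.congr h

theorem pwCont (hv : K.PwSmooth v) : K.PwCont v := fun s hs => by
  obtain ⟨p, hp, h⟩ := hv s hs
  exact ⟨p, hp.continuous.continuousOn, h.mono interior_subset⟩

/-- Gradients jump across faces, and `fderiv` on a face may be a default value. On each open element
they agree with the gradient of a C¹ extension, which is all that integrals over the core need. -/
theorem fderiv_pwCont (hv : K.PwSmooth v) (e : E d) : K.PwCont fun x => fderiv ℝ v x e :=
  fun s hs => by
    obtain ⟨p, hp, h⟩ := hv s hs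
    refine ⟨fun x => fderiv ℝ p x e, ?_, fun x hx => ?_⟩
    · exact ((hp.continuous_fderiv (by norm_num)).clm_apply continuous_const).continuousOn
    · have : v =ᶠ[𝓝 x] p := eventuallyEq_of_mem (mem_interior_iff_mem_nhds.1 hx) h
      simp only [this.fderiv_eq]

theorem exists_lipschitzOnWith (hv : K.PwSmooth v) {s : Finset (E d)} (hs : s ∈ K.elements) :
    ∃ C, LipschitzOnWith C v (cell s) := by
  obtain ⟨p, hp, h⟩ := hv s hs
  obtain ⟨C, hC⟩ := hp.contDiffOn.exists_lipschitzOnWith (by norm_num) (convex_cell s)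
    (isCompact_cell s)
  exact ⟨C, fun x hx y hy => by rw [h hx, h hy]; exact hC hx hy⟩

end PwSmooth

namespace PwCont

variable {v w : E d → ℝ}

theorem const (c : ℝ) : K.PwCont fun _ => c := (PwSmooth.const c).pwCont

theorem add (hv : K.PwCont v) (hw : K.PwCont w) : K.PwCont fun x => v x + w x := by
  intro s hs
  obtain ⟨p, hp, hvp⟩ := hv s hs
  obtain ⟨r, hr, hwr⟩ := hw s hs
  exact ⟨fun x => p x + r x, hp.add hr, fun x hx => by simp only [hvp hx, hwr hx]⟩

theorem mul (hv : K.PwCont v) (hw : K.PwCont w) : K.PwCont fun x => v x * w x := by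
  intro s hs
  obtain ⟨p, hp, hvp⟩ := hv s hs
  obtain ⟨r, hr, hwr⟩ := hw s hs
  exact ⟨fun x => p x * r x, hp.mul hr, fun x hx => by simp only [hvp hx, hwr hx]⟩

theorem const_mul (c : ℝ) (hv : K.PwCont v) : K.PwCont fun x => c * v x := (const c).mul hv

theorem neg (hv : K.PwCont v) : K.PwCont fun x => -v x := by
  simpa using hv.const_mul (-1)

theorem sub (hv : K.PwCont v) (hw : K.PwCont w) : K.PwCont fun x => v x - w x := by
  simpa [sub_eq_add_neg] using hv.add hw.neg

theorem sum {ι : Type*} (t : Finset ι) {f : ι → E d → ℝ} (h : ∀ i ∈ t, K.PwCont (f i)) :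
    K.PwCont fun x => ∑ i ∈ t, f i x := by
  classical
  induction t using Finset.induction_on with
  | empty => simpa using const 0
  | insert a t ha ih =>
    simp only [Finset.sum_insert ha]
    exact (h a (by simp)).add (ih fun i hi => h i (by simp [hi]))

theorem prod {ι : Type*} (t : Finset ι) {f : ι → E d → ℝ} (h : ∀ i ∈ t, K.PwCont (f i)) :
    K.PwCont fun x => ∏ i ∈ t, f i x := by
  classical
  induction t using Finset.induction_on with
  | empty => simpa using const 1
  | insert a t ha ih =>
    simp only [Finset.prod_insert ha]
    exact (h a (by simp)).mul (ih fun i hi => h i (by simp [hi]))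

theorem congr (hv : K.PwCont v) (h : Set.EqOn w v K.core) : K.PwCont w := by
  intro s hs
  obtain ⟨p, hp, hvp⟩ := hv s hs
  exact ⟨p, hp, fun x hx => (h (Set.mem_iUnion.2 ⟨⟨s, hs⟩, hx⟩)).trans (hvp hx)⟩

theorem integrableOn (hv : K.PwCont v) : IntegrableOn v K.core := by
  refine integrableOn_finite_iUnion.2 fun s => ?_
  obtain ⟨p, hp, hvp⟩ := hv s s.2
  exact ((hp.integrableOn_compact (isCompact_cell _)).mono_set interior_subset).congr_fun hvp.symm
    isOpen_interior.measurableSet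

end PwCont

end Mesh

end Mesh

/-! ### Gluing Lipschitz functions -/

section Glue

variable {V : Type*} [NormedAddCommGroup V] [NormedSpace ℝ V]

/-- The constant survives gluing because distances are additive along a segment. The parameters
where the bound from `x` holds form a closed set. From any such parameter it extends further: one of
the finitely many closed pieces is met arbitrarily soon afterwards, hence also contains the current
point. -/
theorem lipschitzWith_of_finite_closed_cover {ι : Type*} [Finite ι] {A : ι → Set V}
    (hA : ∀ i, IsClosed (A i)) (hU : ⋃ i, A i = Set.univ) {f : V → ℝ} {C : NNReal}
    (hf : ∀ i, LipschitzOnWith C f (A i)) : LipschitzWith C f := by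
  have hcont : Continuous f := (locallyFinite_of_finite A).continuous hU hA fun i =>
    (hf i).continuousOn
  refine LipschitzWith.of_dist_le_mul fun x y => ?_
  let γ : ℝ → V := fun s => x + s • (y - x)
  have hγ : Continuous γ := by fun_prop
  have hγd : ∀ s t, dist (γ s) (γ t) = |s - t| * dist x y := by
    intro s t
    rw [dist_eq_norm, dist_comm, dist_eq_norm, ← Real.norm_eq_abs, ← norm_smul]
    congr 1
    simp only [γ]
    module
  let S : Set ℝ := {s | dist (f x) (f (γ s)) ≤ C * (s * dist x y)}
  have hS : IsClosed S := isClosed_le (by fun_prop) (by fun_prop)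
  have key : Set.Icc (0 : ℝ) 1 ⊆ S := by
    refine (hS.inter isClosed_Icc).Icc_subset_of_forall_exists_gt ?_ ?_
    · simp [S, γ]
    · rintro s ⟨hs, -⟩ y' (hy' : s < y')
      have hfreq : ∃ i, ∃ᶠ t in 𝓝[>] s, γ t ∈ A i := by
        by_contra hcon
        push Not at hcon
        have : ∀ᶠ t in 𝓝[>] s, ∀ i, γ t ∉ A i := eventually_all.2 fun i => by
          simpa [Filter.Frequently] using hcon i
        obtain ⟨t, ht⟩ := this.exists
        have : γ t ∈ ⋃ i, A i := hU ▸ Set.mem_univ _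
        obtain ⟨i, hi⟩ := Set.mem_iUnion.1 this
        exact ht i hi
      obtain ⟨i, hi⟩ := hfreq
      have hsi : γ s ∈ A i := by
        have hmem : s ∈ closure (γ ⁻¹' A i) :=
          mem_closure_iff_frequently.2 (hi.filter_mono nhdsWithin_le_nhds)
        rwa [((hA i).preimage hγ).closure_eq] at hmem
      obtain ⟨t, ht, hti⟩ := (hi.and_eventually (Ioc_mem_nhdsGT hy')).exists
      refine ⟨t, ?_, hti⟩
      have h1 := (hf i).dist_le_mul _ hsi _ ht
      rw [hγd, abs_sub_comm, abs_of_pos (sub_pos.2 hti.1)] at h1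
      calc dist (f x) (f (γ t)) ≤ dist (f x) (f (γ s)) + dist (f (γ s)) (f (γ t)) :=
            dist_triangle _ _ _
        _ ≤ C * (s * dist x y) + C * ((t - s) * dist x y) := add_le_add hs h1
        _ = C * (t * dist x y) := by ring
  simpa [S, γ] using key (Set.right_mem_Icc.2 zero_le_one)

end Glue

/-! ### Cutoffs by the distance to a set, with Lipschitz constants independent of the scale. -/

section Cutoff

variable {V : Type*} [NormedAddCommGroup V] [NormedSpace ℝ V]

/-- A cutoff function that vanishes where the distance to `A` is at most `1 / c`, and equals `1`
where it is at least `2 / c`. -/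
def ramp (A : Set V) (c : ℝ) (x : V) : ℝ := min 1 (max 0 (c * Metric.infDist x A - 1))

variable (A : Set V) {c : ℝ}

theorem ramp_nonneg (c : ℝ) (x : V) : 0 ≤ ramp A c x := le_min zero_le_one (le_max_left _ _)

theorem ramp_le_one (c : ℝ) (x : V) : ramp A c x ≤ 1 := min_le_left _ _

theorem norm_ramp_le (c : ℝ) (x : V) : ‖ramp A c x‖ ≤ 1 := by
  rw [Real.norm_of_nonneg (ramp_nonneg A c x)]
  exact ramp_le_one A c x

variable {A} in
theorem ramp_eq_zero {x : V} (h : c * Metric.infDist x A ≤ 1) : ramp A c x = 0 := by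
  rw [ramp, max_eq_left (by linarith), min_eq_right zero_le_one]

variable {A} in
theorem ramp_eq_one {x : V} (h : 2 ≤ c * Metric.infDist x A) : ramp A c x = 1 := by
  rw [ramp, max_eq_right (by linarith), min_eq_left (by linarith)]

theorem ramp_lipschitz (hc : 0 ≤ c) : LipschitzWith c.toNNReal (ramp A c) := by
  have h : LipschitzWith c.toNNReal fun x => c * Metric.infDist x A - 1 := by
    refine LipschitzWith.of_dist_le_mul fun x y => ?_
    have := (Metric.lipschitz_infDist_pt A).dist_le_mul x y
    rw [Real.coe_toNNReal _ hc, Real.dist_eq, show c * Metric.infDist x A - 1 -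
      (c * Metric.infDist y A - 1) = c * (Metric.infDist x A - Metric.infDist y A) by ring,
      abs_mul, abs_of_nonneg hc, ← Real.dist_eq]
    gcongr
    simpa using this
  exact (h.const_max 0).const_min 1

variable {A} in
-- The cutoff has slope `c`, but it is constant where the distance to `A` is at least `2 / c`, and
-- elsewhere `|w| ≤ 2L / c`. The product therefore has slope at most `L + 2L`, uniformly in `c`.
-- Taking `y` to be the point nearer to `A` lets the bound on `w y` control the variation of the
-- cutoff.
theorem abs_ramp_mul_sub_le (hc : 0 < c) {w : V → ℝ} {L : NNReal} (hw : LipschitzWith L w)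
    (hwA : ∀ x, |w x| ≤ L * Metric.infDist x A) {x y : V}
    (hxy : Metric.infDist y A ≤ Metric.infDist x A) :
    |ramp A c x * w x - ramp A c y * w y| ≤ 3 * L * dist x y := by
  have h1 := hw.dist_le_mul x y
  have h2 := (ramp_lipschitz A hc.le).dist_le_mul x y
  rw [Real.dist_eq] at h1 h2
  rw [Real.coe_toNNReal _ hc.le] at h2
  have h3 : |ramp A c x - ramp A c y| * |w y| ≤ 2 * L * dist x y := by
    rcases le_or_gt 2 (c * Metric.infDist y A) with h | h
    · rw [ramp_eq_one h, ramp_eq_one (h.trans (by gcongr)), sub_self, abs_zero, zero_mul]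
      positivity
    · calc |ramp A c x - ramp A c y| * |w y| ≤ (c * dist x y) * (L * Metric.infDist y A) := by
            gcongr
            exact hwA y
        _ = (c * Metric.infDist y A) * (L * dist x y) := by ring
        _ ≤ 2 * (L * dist x y) := by gcongr
        _ = _ := by ring
  calc |ramp A c x * w x - ramp A c y * w y|
      = |ramp A c x * (w x - w y) + (ramp A c x - ramp A c y) * w y| := by ring_nf
    _ ≤ ramp A c x * |w x - w y| + |ramp A c x - ramp A c y| * |w y| := by
        refine (abs_add_le _ _).trans ?_
        rw [abs_mul, abs_mul, abs_of_nonneg (ramp_nonneg A c x)]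
    _ ≤ 1 * (L * dist x y) + 2 * L * dist x y := by
        gcongr
        exact ramp_le_one A c x
    _ = _ := by ring

variable {A} in
theorem lipschitzWith_ramp_mul (hc : 0 < c) {w : V → ℝ} {L : NNReal} (hw : LipschitzWith L w)
    (hwA : ∀ x, |w x| ≤ L * Metric.infDist x A) :
    LipschitzWith (3 * L) fun x => ramp A c x * w x := by
  refine LipschitzWith.of_dist_le_mul fun x y => ?_
  rw [Real.dist_eq]
  push_cast
  rcases le_total (Metric.infDist y A) (Metric.infDist x A) with h | h
  · exact abs_ramp_mul_sub_le hc hw hwA h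
  · rw [abs_sub_comm, dist_comm]
    exact abs_ramp_mul_sub_le hc hw hwA h

end Cutoff

/-! ### Jacobian integrals of piecewise smooth functions, one of which vanishes on the boundary. -/

namespace Mesh

variable {d : ℕ} {K : Mesh d}

/-- The closed elements and the complement of the open domain form a finite closed cover of space.
-/
theorem exists_lipschitzWith_of_cells {h : E d → ℝ}
    (hc : ∀ s ∈ K.elements, ∃ C, LipschitzOnWith C h (cell s)) (h0 : ∀ x ∉ K.domain, h x = 0) :
    ∃ C, LipschitzWith C h := by
  choose! C hC using hc
  obtain ⟨B, hB⟩ := (Set.finite_range fun s : K.elements => C s).bddAbove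
  let A : Option K.elements → Set (E d) := fun o => o.elim K.domainᶜ fun s => cell s
  refine ⟨B, lipschitzWith_of_finite_closed_cover (A := A) ?_ ?_ ?_⟩
  · rintro (_ | s)
    · exact K.isOpen_domain.isClosed_compl
    · exact isClosed_cell _
  · refine Set.eq_univ_of_forall fun x => ?_
    by_cases hx : x ∈ K.domain
    · obtain ⟨s, hs, hxs⟩ := exists_cell_of_mem (K.domain_subset_closedDomain hx)
      exact Set.mem_iUnion.2 ⟨some ⟨s, hs⟩, hxs⟩
    · exact Set.mem_iUnion.2 ⟨none, hx⟩
  · rintro (_ | s)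
    · intro x hx y hy
      rw [h0 x hx, h0 y hy, edist_self]
      exact zero_le
    · exact (hC s s.2).weaken (hB ⟨s, rfl⟩)

theorem hasCompactSupport_of_zero {h : E d → ℝ} (h0 : ∀ x ∉ K.domain, h x = 0) :
    HasCompactSupport h :=
  HasCompactSupport.intro K.isCompact_closedDomain fun x hx =>
    h0 x fun hxd => hx (K.domain_subset_closedDomain hxd)

/-- The distance to an empty set is 0 by convention, which would make the cutoffs trivial. In
dimension 0 the domain could be the whole space. -/
theorem compl_domain_nonempty (hd : 0 < d) (K : Mesh d) : (K.domainᶜ).Nonempty := by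
  have : Nonempty (Fin d) := ⟨⟨0, hd⟩⟩
  rw [Set.nonempty_compl]
  intro h
  have h1 : K.closedDomain = Set.univ :=
    Set.eq_univ_of_univ_subset (h ▸ K.domain_subset_closedDomain)
  exact noncompact_univ (E d) (h1 ▸ K.isCompact_closedDomain)

/-- A piecewise smooth function that vanishes on the boundary is approximated by compactly supported
Lipschitz functions, such that all piecewise smooth functions can be replaced by compactly supported
Lipschitz functions on the support of the approximation. -/
theorem PwSmooth.exists_approx (hd : 0 < d) {w : E d → ℝ} (hw : K.PwSmooth w)
    (hw0 : ∀ x ∈ K.bdry, w x = 0) :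
    ∃ W : ℕ → E d → ℝ, (∀ n, LipCompact (W n)) ∧
      (∃ C : ℝ, ∀ n x v, ‖fderiv ℝ (W n) x v‖ ≤ C * ‖v‖) ∧
      (∀ x ∈ K.core, ∀ᶠ n in atTop, W n =ᶠ[𝓝 x] w) ∧
      (∀ n, ∀ x ∉ K.closedDomain, fderiv ℝ (W n) x = 0) ∧
      ∀ n f, K.PwSmooth f → ∃ F, LipCompact F ∧
        ∀ x ∈ K.core, fderiv ℝ (W n) x = 0 ∨ F =ᶠ[𝓝 x] f := by
  classical
  set A : Set (E d) := K.domainᶜ with hA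
  have hAne : A.Nonempty := K.compl_domain_nonempty hd
  have hAcl : IsClosed A := K.isOpen_domain.isClosed_compl
  -- The extension by zero agrees with `w` on the closed domain because `w` vanishes on the
  -- boundary, and it is Lipschitz by gluing.
  let w₀ : E d → ℝ := K.domain.indicator w
  have hw₀ : ∀ x ∈ K.closedDomain, w₀ x = w x := by
    intro x hx
    by_cases hxd : x ∈ K.domain
    · exact Set.indicator_of_mem hxd _
    · rw [hw0 x (K.bdry_eq ▸ ⟨hx, hxd⟩)]
      exact Set.indicator_of_notMem hxd _
  have hw₀z : ∀ x ∉ K.domain, w₀ x = 0 := fun x hx => Set.indicator_of_notMem hx _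
  obtain ⟨L, hL⟩ : ∃ L, LipschitzWith L w₀ := by
    refine exists_lipschitzWith_of_cells (K := K) (fun s hs => ?_) hw₀z
    obtain ⟨C, hC⟩ := hw.exists_lipschitzOnWith hs
    refine ⟨C, fun x hx y hy => ?_⟩
    rw [hw₀ x (cell_subset_closedDomain hs hx), hw₀ y (cell_subset_closedDomain hs hy)]
    exact hC hx hy
  have hLA : ∀ x, |w₀ x| ≤ L * Metric.infDist x A := by
    intro x
    obtain ⟨y, hy, hxy⟩ := hAcl.exists_infDist_eq_dist hAne x
    have := hL.dist_le_mul x y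
    rwa [Real.dist_eq, hw₀z y hy, sub_zero, ← hxy] at this
  have hpos : ∀ x ∈ K.domain, 0 < Metric.infDist x A := fun x hx =>
    (hAcl.notMem_iff_infDist_pos hAne).1 (by simpa [hA] using hx)
  have hzero : ∀ x ∉ K.domain, Metric.infDist x A = 0 := fun x hx =>
    Metric.infDist_zero_of_mem hx
  have hcont : Continuous fun x => Metric.infDist x A := Metric.continuous_infDist_pt A
  let W : ℕ → E d → ℝ := fun n x => ramp A (n + 1) x * w₀ x
  have hWlip : ∀ n, LipschitzWith (3 * L) (W n) := fun n =>
    lipschitzWith_ramp_mul (by positivity) hL hLA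
  have hWz : ∀ n, ∀ x ∉ K.domain, W n x = 0 := fun n x hx => by simp [W, hw₀z x hx]
  refine ⟨W, fun n => ⟨⟨_, hWlip n⟩, hasCompactSupport_of_zero (hWz n)⟩, ⟨(3 * L : NNReal),
    fun n x v => ((fderiv ℝ (W n) x).le_opNorm v).trans ?_⟩, fun x hx => ?_, fun n x hx => ?_,
    fun n f hf => ?_⟩
  · gcongr
    exact norm_fderiv_le_of_lipschitz ℝ (hWlip n)
  · have hx' := K.core_subset_domain hx
    have h1 : ∀ᶠ n : ℕ in atTop, 2 < ((n : ℝ) + 1) * Metric.infDist x A :=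
      ((tendsto_atTop_add_const_right _ 1 tendsto_natCast_atTop_atTop).atTop_mul_const
        (hpos x hx')).eventually_gt_atTop 2
    filter_upwards [h1] with n hn
    have h2 : ∀ᶠ y in 𝓝 x, 2 < ((n : ℝ) + 1) * Metric.infDist y A :=
      (continuous_const.mul hcont).continuousAt.eventually (lt_mem_nhds hn)
    filter_upwards [h2, K.isOpen_domain.mem_nhds hx'] with y hy hyd
    simp only [W, ramp_eq_one hy.le, one_mul]
    exact hw₀ y (K.domain_subset_closedDomain hyd)
  · have : W n =ᶠ[𝓝 x] fun _ => 0 := by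
      filter_upwards [K.isClosed_closedDomain.isOpen_compl.mem_nhds hx] with y hy
      exact hWz n y fun h => hy (K.domain_subset_closedDomain h)
    rw [this.fderiv_eq]
    simp
  -- Where the gradient of `W n` can be nonzero, `(n + 1) dist ≥ 1`; the factor 4 then makes the
  -- argument of this cutoff exceed 2 in a neighbourhood, so that `F = f` there.
  · let F : E d → ℝ := fun x => ramp A (4 * (n + 1)) x * f x
    have hFz : ∀ x ∉ K.domain, F x = 0 := fun x hx => by
      simp only [F]
      rw [ramp_eq_zero (by rw [hzero x hx]; simp), zero_mul]
    refine ⟨F, ⟨exists_lipschitzWith_of_cells (fun s hs => ?_) hFz,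
      hasCompactSupport_of_zero hFz⟩, fun x _ => ?_⟩
    · refine exists_lipschitzOnWith_mul ⟨_, (ramp_lipschitz A (by positivity)).lipschitzOnWith⟩
        (hf.exists_lipschitzOnWith hs) ⟨1, fun x _ => norm_ramp_le A _ x⟩ ?_
      exact (isCompact_cell s).exists_bound_of_continuousOn
        (hf.continuousOn.mono (cell_subset_closedDomain hs))
    · rcases lt_or_ge (((n : ℝ) + 1) * Metric.infDist x A) 1 with h | h
      · left
        have : W n =ᶠ[𝓝 x] fun _ => 0 := by
          filter_upwards [(continuous_const.mul hcont).continuousAt.eventually (gt_mem_nhds h)]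
            with y hy
          simp only [W]
          rw [ramp_eq_zero (le_of_lt hy), zero_mul]
        rw [this.fderiv_eq]
        simp
      · right
        have h' : 2 < 4 * ((n : ℝ) + 1) * Metric.infDist x A := by linarith
        filter_upwards [(continuous_const.mul hcont).continuousAt.eventually (lt_mem_nhds h')]
          with y hy
        simp only [F]
        rw [ramp_eq_one (le_of_lt hy), one_mul]

theorem setIntegral_core_eq {f : E d → ℝ} (h : ∀ x ∉ K.closedDomain, f x = 0) :
    ∫ x in K.core, f x = ∫ x, f x := by
  rw [setIntegral_congr_set (s := K.core) (t := K.closedDomain)]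
  · exact setIntegral_eq_integral_of_forall_compl_eq_zero h
  · exact (K.core_subset_closedDomain.eventuallyLE).antisymm
      (ae_le_set.2 K.volume_closedDomain_diff_core)

/-- The Jacobian determinant of two piecewise smooth functions, the first of which vanishes on the
boundary, integrates to zero. -/
theorem integral_doubleJac_eq_zero (hd : 0 < d) {w f : E d → ℝ} (hw : K.PwSmooth w)
    (hw0 : ∀ x ∈ K.bdry, w x = 0) (hf : K.PwSmooth f) (e₀ e₁ : E d) :
    ∫ x in K.core, (fderiv ℝ w x e₀ * fderiv ℝ f x e₁ - fderiv ℝ w x e₁ * fderiv ℝ f x e₀) = 0 := by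
  obtain ⟨W, hW, ⟨C, hC⟩, hlim, hout, happ⟩ := hw.exists_approx hd hw0
  have hz : ∀ n, ∫ x in K.core, (fderiv ℝ (W n) x e₀ * fderiv ℝ f x e₁
      - fderiv ℝ (W n) x e₁ * fderiv ℝ f x e₀) = 0 := by
    intro n
    obtain ⟨F, hF, hFf⟩ := happ n f hf
    have h1 : ∫ x in K.core, (fderiv ℝ (W n) x e₀ * fderiv ℝ f x e₁
        - fderiv ℝ (W n) x e₁ * fderiv ℝ f x e₀) =
        ∫ x in K.core, (fderiv ℝ (W n) x e₀ * fderiv ℝ F x e₁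
        - fderiv ℝ (W n) x e₁ * fderiv ℝ F x e₀) := by
      refine setIntegral_congr_fun K.isOpen_core.measurableSet fun x hx => ?_
      rcases hFf x hx with h | h
      · simp [h]
      · simp only [h.fderiv_eq]
    rw [h1, setIntegral_core_eq fun x hx => by simp [hout n x hx],
      integral_sub ((hW n).integrable_fderiv_mul_fderiv hF e₀ e₁)
      ((hW n).integrable_fderiv_mul_fderiv hF e₁ e₀),
      (hW n).integral_fderiv_mul_fderiv_comm hF, sub_self]
  -- At each point of the core the integrand is eventually constant in `n`; the gradient bound
  -- uniform in `n` gives the majorant.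
  have hlim' : Tendsto (fun n => ∫ x in K.core, (fderiv ℝ (W n) x e₀ * fderiv ℝ f x e₁
      - fderiv ℝ (W n) x e₁ * fderiv ℝ f x e₀)) atTop
      (𝓝 (∫ x in K.core, (fderiv ℝ w x e₀ * fderiv ℝ f x e₁
        - fderiv ℝ w x e₁ * fderiv ℝ f x e₀))) := by
    have hi := fun e => (hf.fderiv_pwCont e).integrableOn
    refine tendsto_integral_of_dominated_convergence
      (fun x => C * ‖e₀‖ * ‖fderiv ℝ f x e₁‖ + C * ‖e₁‖ * ‖fderiv ℝ f x e₀‖) (fun n => ?_)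
      (((hi e₁).norm.const_mul _).add ((hi e₀).norm.const_mul _))
      (fun n => ae_of_all _ fun x => ?_) ?_
    · exact ((((measurable_fderiv_apply_const ℝ _ _).mul (measurable_fderiv_apply_const ℝ _ _)).sub
        ((measurable_fderiv_apply_const ℝ _ _).mul
          (measurable_fderiv_apply_const ℝ _ _)))).aestronglyMeasurable
    · refine (norm_sub_le _ _).trans ?_
      rw [norm_mul, norm_mul]
      gcongr
      all_goals exact hC _ _ _
    · filter_upwards [ae_restrict_mem K.isOpen_core.measurableSet] with x hx
      refine tendsto_const_nhds.congr' ?_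
      filter_upwards [hlim x hx] with n hn
      rw [hn.fderiv_eq]
  simp only [hz] at hlim'
  exact (tendsto_nhds_unique hlim' tendsto_const_nhds)

/-- The Jacobian determinant of three piecewise smooth functions, the first of which vanishes on the
boundary, integrates to zero. -/
theorem integral_tripleJac_eq_zero (hd : 0 < d) {w f g : E d → ℝ} (hw : K.PwSmooth w)
    (hw0 : ∀ x ∈ K.bdry, w x = 0) (hf : K.PwSmooth f) (hg : K.PwSmooth g) (e₀ e₁ e₂ : E d) :
    ∫ x in K.core, tripleJac e₀ e₁ e₂ w f g x = 0 := by
  obtain ⟨W, hW, ⟨C, hC⟩, hlim, hout, happ⟩ := hw.exists_approx hd hw0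
  have hz : ∀ n, ∫ x in K.core, tripleJac e₀ e₁ e₂ (W n) f g x = 0 := by
    intro n
    obtain ⟨F, hF, hFf⟩ := happ n f hf
    obtain ⟨G, hG, hGg⟩ := happ n g hg
    have h1 : ∫ x in K.core, tripleJac e₀ e₁ e₂ (W n) f g x =
        ∫ x in K.core, tripleJac e₀ e₁ e₂ (W n) F G x := by
      refine setIntegral_congr_fun K.isOpen_core.measurableSet fun x hx => ?_
      rcases hFf x hx with h | h
      · simp [tripleJac, h]
      rcases hGg x hx with h' | h'
      · simp [tripleJac, h']
      · simp only [tripleJac, h.fderiv_eq, h'.fderiv_eq]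
    rw [h1, setIntegral_core_eq fun x hx => by simp [tripleJac, hout n x hx],
      (hW n).integral_tripleJac hF hG]
  have hlim' : Tendsto (fun n => ∫ x in K.core, tripleJac e₀ e₁ e₂ (W n) f g x) atTop
      (𝓝 (∫ x in K.core, tripleJac e₀ e₁ e₂ w f g x)) := by
    have hi : ∀ a b, IntegrableOn (fun x => ‖fderiv ℝ f x a * fderiv ℝ g x b‖) K.core := fun a b =>
      ((hf.fderiv_pwCont a).mul (hg.fderiv_pwCont b)).integrableOn.norm
    refine tendsto_integral_of_dominated_convergence
      (fun x => C * ‖e₀‖ * (‖fderiv ℝ f x e₁ * fderiv ℝ g x e₂‖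
          + ‖fderiv ℝ f x e₂ * fderiv ℝ g x e₁‖)
        + C * ‖e₁‖ * (‖fderiv ℝ f x e₂ * fderiv ℝ g x e₀‖
          + ‖fderiv ℝ f x e₀ * fderiv ℝ g x e₂‖)
        + C * ‖e₂‖ * (‖fderiv ℝ f x e₀ * fderiv ℝ g x e₁‖
          + ‖fderiv ℝ f x e₁ * fderiv ℝ g x e₀‖)) (fun n => ?_)
      (((((hi _ _).add (hi _ _)).const_mul _).add (((hi _ _).add (hi _ _)).const_mul _)).add
        (((hi _ _).add (hi _ _)).const_mul _))
      (fun n => ae_of_all _ fun x => ?_) ?_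
    · have hm : ∀ (h : E d → ℝ) e, Measurable fun x => fderiv ℝ h x e := fun h e =>
        measurable_fderiv_apply_const ℝ h e
      unfold tripleJac
      refine (((((hm _ _).mul (hm _ _)).sub ((hm _ _).mul (hm _ _))).mul (hm _ _)).add
        ((((hm _ _).mul (hm _ _)).sub ((hm _ _).mul (hm _ _))).mul (hm _ _)) |>.add
        ((((hm _ _).mul (hm _ _)).sub ((hm _ _).mul (hm _ _))).mul
          (hm _ _))).aestronglyMeasurable
    · have e : tripleJac e₀ e₁ e₂ (W n) f g x =
          fderiv ℝ (W n) x e₀ * (fderiv ℝ f x e₁ * fderiv ℝ g x e₂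
            - fderiv ℝ f x e₂ * fderiv ℝ g x e₁)
          + fderiv ℝ (W n) x e₁ * (fderiv ℝ f x e₂ * fderiv ℝ g x e₀
            - fderiv ℝ f x e₀ * fderiv ℝ g x e₂)
          + fderiv ℝ (W n) x e₂ * (fderiv ℝ f x e₀ * fderiv ℝ g x e₁
            - fderiv ℝ f x e₁ * fderiv ℝ g x e₀) := by
        unfold tripleJac
        ring
      rw [e]
      refine norm_add₃_le.trans ?_
      rw [norm_mul, norm_mul, norm_mul]
      have hC' := hC n x
      gcongr
      all_goals first | exact hC' _ | exact norm_sub_le _ _ | exact (norm_nonneg _).trans (hC' _)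
    · filter_upwards [ae_restrict_mem K.isOpen_core.measurableSet] with x hx
      refine tendsto_const_nhds.congr' ?_
      filter_upwards [hlim x hx] with n hn
      simp only [tripleJac, hn.fderiv_eq]
  simp only [hz] at hlim'
  exact (tendsto_nhds_unique hlim' tendsto_const_nhds)

end Mesh

/-! ### Calculus of the gradient matrix. -/

section Grad

variable {d : ℕ} {v w : E d → E d} {x : E d}

/-- Differentiability of the whole field matters: without it the left side is the default 0, while a
single component may still be differentiable. -/
theorem fderiv_apply_eq (hv : DifferentiableAt ℝ v x) (h : E d) (i : Fin d) :
    fderiv ℝ v x h i = fderiv ℝ (fun y => v y i) x h := by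
  have := ((EuclideanSpace.proj i : E d →L[ℝ] ℝ).hasFDerivAt.comp x hv.hasFDerivAt).fderiv
  have e : (⇑(EuclideanSpace.proj i : E d →L[ℝ] ℝ) ∘ v) = fun y => v y i := rfl
  rw [e] at this
  rw [this]
  rfl

theorem grad_apply (hv : DifferentiableAt ℝ v x) (i j : Fin d) :
    grad v x i j = fderiv ℝ (fun y => v y i) x (EuclideanSpace.single j 1) :=
  fderiv_apply_eq hv _ i

theorem fderiv_eq_sum_grad (v : E d → E d) (x h : E d) (i : Fin d) :
    fderiv ℝ v x h i = ∑ j, grad v x i j * h j := by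
  have e : h = ∑ j, h j • EuclideanSpace.single j (1 : ℝ) := by
    ext k
    simp [Pi.single_apply]
  conv_lhs => rw [e]
  simp [grad, mul_comm]

theorem grad_add (hv : DifferentiableAt ℝ v x) (hw : DifferentiableAt ℝ w x) :
    grad (fun y => v y + w y) x = grad v x + grad w x := by
  ext i j
  simp [grad, fderiv_fun_add hv hw]

theorem grad_sub (hv : DifferentiableAt ℝ v x) (hw : DifferentiableAt ℝ w x) :
    grad (fun y => v y - w y) x = grad v x - grad w x := by
  ext i j
  simp [grad, fderiv_fun_sub hv hw]

theorem grad_smul (hv : DifferentiableAt ℝ v x) (c : ℝ) :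
    grad (fun y => c • v y) x = c • grad v x := by
  ext i j
  simp [grad, fderiv_fun_const_smul hv c]

theorem grad_sum {ι : Type*} (t : Finset ι) {f : ι → E d → E d}
    (hf : ∀ i ∈ t, DifferentiableAt ℝ (f i) x) :
    grad (fun y => ∑ i ∈ t, f i y) x = ∑ i ∈ t, grad (f i) x := by
  ext i j
  simp [grad, fderiv_fun_sum hf, Matrix.sum_apply]

theorem grad_id (x : E d) : grad (fun y : E d => y) x = 1 := by
  ext i j
  simp [grad, Matrix.one_apply]

theorem grad_congr (h : v =ᶠ[𝓝 x] w) : grad v x = grad w x := by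
  ext i j
  simp [grad, h.fderiv_eq]

theorem grad_comp {f g : E d → E d} (hf : DifferentiableAt ℝ f (g x))
    (hg : DifferentiableAt ℝ g x) :
    grad (fun y => f (g y)) x = grad f (g x) * grad g x := by
  ext i j
  have : fderiv ℝ (fun y => f (g y)) x = (fderiv ℝ f (g x)).comp (fderiv ℝ g x) :=
    fderiv_comp x hf hg
  simp only [grad, Matrix.of_apply, Matrix.mul_apply, this, ContinuousLinearMap.comp_apply]
  rw [fderiv_eq_sum_grad, grad]
  rfl

theorem det_fderiv (v : E d → E d) (x : E d) : (fderiv ℝ v x).det = (grad v x).det := by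
  rw [ContinuousLinearMap.det, ← LinearMap.det_toMatrix (EuclideanSpace.basisFun (Fin d) ℝ).toBasis]
  congr 1

end Grad

/-! ### Piecewise smooth vector fields and the weak Piola identity. -/

namespace Mesh

variable {d : ℕ} {K : Mesh d}

variable (K) in
/-- Vector fields that agree on every closed element with a continuously differentiable field. -/
def PwSmoothVec (v : E d → E d) : Prop := ∀ i, K.PwSmooth fun x => v x i

theorem IsFEVec.pwSmoothVec {k : ℕ} {v : E d → E d} (h : K.IsFEVec k v) : K.PwSmoothVec v :=
  fun i => (h i).pwSmooth

namespace PwSmoothVec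

variable {v w : E d → E d}

theorem add (hv : K.PwSmoothVec v) (hw : K.PwSmoothVec w) : K.PwSmoothVec fun x => v x + w x :=
  fun i => (hv i).add (hw i)

theorem sub (hv : K.PwSmoothVec v) (hw : K.PwSmoothVec w) : K.PwSmoothVec fun x => v x - w x :=
  fun i => (hv i).sub (hw i)

theorem smul {f : E d → ℝ} (hf : K.PwSmooth f) (hv : K.PwSmoothVec v) :
    K.PwSmoothVec fun x => f x • v x := fun i => hf.mul (hv i)

theorem const_smul (c : ℝ) (hv : K.PwSmoothVec v) : K.PwSmoothVec fun x => c • v x :=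
  smul (.const c) hv

theorem id : K.PwSmoothVec fun x => x := fun i => .coord i

theorem sum {ι : Type*} (t : Finset ι) {f : ι → E d → E d} (h : ∀ i ∈ t, K.PwSmoothVec (f i)) :
    K.PwSmoothVec fun x => ∑ i ∈ t, f i x := fun k => by
  simpa using PwSmooth.sum t fun i hi => h i hi k

theorem inner (hv : K.PwSmoothVec v) (hw : K.PwSmoothVec w) :
    K.PwSmooth fun x => inner ℝ (v x) (w x) := by
  simp only [PiLp.inner_apply]
  exact PwSmooth.sum _ fun i _ => by simpa using (hw i).mul (hv i)

theorem differentiableAt (hv : K.PwSmoothVec v) {x : E d} (hx : x ∈ K.core) :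
    DifferentiableAt ℝ v x :=
  differentiableAt_euclidean.2 fun i => (hv i).differentiableAt hx

theorem contDiffAt (hv : K.PwSmoothVec v) {x : E d} (hx : x ∈ K.core) :
    ContDiffAt ℝ 1 v x :=
  contDiffAt_euclidean.2 fun i => (hv i).contDiffAt hx

theorem continuousOn (hv : K.PwSmoothVec v) : ContinuousOn v K.closedDomain := by
  have h : ContinuousOn (fun x i => v x i) K.closedDomain :=
    continuousOn_pi.2 fun i => (hv i).continuousOn
  exact (PiLp.continuous_toLp 2 (fun _ : Fin d => ℝ)).comp_continuousOn h

theorem grad_pwCont (hv : K.PwSmoothVec v) (i j : Fin d) : K.PwCont fun x => grad v x i j :=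
  ((hv i).fderiv_pwCont _).congr fun _ hx => grad_apply (hv.differentiableAt hx) i j

theorem exists_contDiff (hv : K.PwSmoothVec v) {s : Finset (E d)} (hs : s ∈ K.elements) :
    ∃ p : E d → E d, ContDiff ℝ 1 p ∧ Set.EqOn v p (cell s) := by
  choose p hp hvp using fun i => hv i s hs
  refine ⟨fun x => WithLp.toLp 2 fun i => p i x, contDiff_euclidean.2 fun i => hp i, fun x hx => ?_⟩
  ext i
  exact hvp i hx

/-- The weak form of the Piola identity. -/
theorem integral_trace_grad_mul_adjugate (hd : d = 2 ∨ d = 3) (hw : K.PwSmoothVec w)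
    (hw0 : ∀ x ∈ K.bdry, w x = 0) (hv : K.PwSmoothVec v) :
    ∫ x in K.core, (grad w x * (grad v x).adjugate).trace = 0 := by
  have hw0' : ∀ i, ∀ x ∈ K.bdry, w x i = 0 := fun i x hx => by simp [hw0 x hx]
  rcases hd with rfl | rfl
  · have hi : ∀ i j a b, IntegrableOn (fun x =>
        fderiv ℝ (fun y => w y i) x a * fderiv ℝ (fun y => v y j) x b
        - fderiv ℝ (fun y => w y i) x b * fderiv ℝ (fun y => v y j) x a) K.core := fun i j a b =>
      ((((hw i).fderiv_pwCont a).mul ((hv j).fderiv_pwCont b)).sub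
        (((hw i).fderiv_pwCont b).mul ((hv j).fderiv_pwCont a))).integrableOn
    -- The trace is the derivative of `det` at `∇v` in the direction `∇w`: the sum of the
    -- determinants of `∇v` with one row replaced by that of `∇w`. Each is a Jacobian containing one
    -- component of `w`.
    have e : ∀ x ∈ K.core, (grad w x * (grad v x).adjugate).trace = (fun x =>
        fderiv ℝ (fun y => w y 0) x (EuclideanSpace.single 0 1) *
          fderiv ℝ (fun y => v y 1) x (EuclideanSpace.single 1 1)
        - fderiv ℝ (fun y => w y 0) x (EuclideanSpace.single 1 1) *
          fderiv ℝ (fun y => v y 1) x (EuclideanSpace.single 0 1)) x - (fun x =>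
        fderiv ℝ (fun y => w y 1) x (EuclideanSpace.single 0 1) *
          fderiv ℝ (fun y => v y 0) x (EuclideanSpace.single 1 1)
        - fderiv ℝ (fun y => w y 1) x (EuclideanSpace.single 1 1) *
          fderiv ℝ (fun y => v y 0) x (EuclideanSpace.single 0 1)) x := by
      intro x hx
      simp only [← grad_apply (hw.differentiableAt hx), ← grad_apply (hv.differentiableAt hx)]
      simp [Matrix.trace_fin_two, Matrix.mul_apply, Fin.sum_univ_two, Matrix.adjugate_fin_two]
      ring
    rw [setIntegral_congr_fun K.isOpen_core.measurableSet e, integral_sub (hi _ _ _ _)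
      (hi _ _ _ _), integral_doubleJac_eq_zero (by norm_num) (hw 0) (hw0' 0) (hv 1),
      integral_doubleJac_eq_zero (by norm_num) (hw 1) (hw0' 1) (hv 0), sub_zero]
  · let T : Fin 3 → Fin 3 → Fin 3 → E 3 → ℝ := fun i j k =>
      tripleJac (EuclideanSpace.single 0 1) (EuclideanSpace.single 1 1) (EuclideanSpace.single 2 1)
        (fun y => w y i) (fun y => v y j) (fun y => v y k)
    have hi : ∀ i j k, IntegrableOn (T i j k) K.core := by
      intro i j k
      have h := fun a => (hw i).fderiv_pwCont a
      have h' := fun j a => (hv j).fderiv_pwCont a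
      exact ((((((h _).mul (h' j _)).sub ((h _).mul (h' j _))).mul (h' k _)).add
        ((((h _).mul (h' j _)).sub ((h _).mul (h' j _))).mul (h' k _))).add
        ((((h _).mul (h' j _)).sub ((h _).mul (h' j _))).mul (h' k _))).integrableOn
    have e : ∀ x ∈ K.core, (grad w x * (grad v x).adjugate).trace =
        T 0 1 2 x + T 1 2 0 x + T 2 0 1 x := by
      intro x hx
      simp only [T, tripleJac]
      simp only [← grad_apply (hw.differentiableAt hx), ← grad_apply (hv.differentiableAt hx)]
      simp [Matrix.trace_fin_three, Matrix.mul_apply, Fin.sum_univ_three,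
        Matrix.adjugate_fin_three]
      ring
    have hz : ∀ i j k, ∫ x in K.core, T i j k x = 0 := fun i j k =>
      integral_tripleJac_eq_zero (by norm_num) (hw i) (hw0' i) (hv j) (hv k) _ _ _
    have hi2 : IntegrableOn (fun x => T 0 1 2 x + T 1 2 0 x) K.core := (hi _ _ _).add (hi _ _ _)
    rw [setIntegral_congr_fun K.isOpen_core.measurableSet e, integral_add hi2 (hi _ _ _),
      integral_add (hi _ _ _) (hi _ _ _), hz, hz, hz]
    simp

end PwSmoothVec

theorem PwCont.det {M : E d → Matrix (Fin d) (Fin d) ℝ} (h : ∀ i j, K.PwCont fun x => M x i j) :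
    K.PwCont fun x => (M x).det := by
  simp only [Matrix.det_apply']
  exact PwCont.sum _ fun σ _ => (PwCont.prod _ fun i _ => h _ _).const_mul _

theorem PwCont.adjugate {M : E d → Matrix (Fin d) (Fin d) ℝ}
    (h : ∀ i j, K.PwCont fun x => M x i j) (i j : Fin d) :
    K.PwCont fun x => (M x).adjugate i j := by
  simp only [Matrix.adjugate_apply]
  refine PwCont.det fun k l => ?_
  simp only [Matrix.updateRow_apply]
  split_ifs
  · exact .const _
  · exact h k l

theorem PwCont.matMul {M N : E d → Matrix (Fin d) (Fin d) ℝ}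
    (h : ∀ i j, K.PwCont fun x => M x i j) (h' : ∀ i j, K.PwCont fun x => N x i j)
    (i j : Fin d) : K.PwCont fun x => (M x * N x) i j := by
  simp only [Matrix.mul_apply]
  exact PwCont.sum _ fun k _ => (h i k).mul (h' k j)

end Mesh

/-! ### Differentiation under the integral for sums of products of time and space functions. -/

section TimeSep

variable {d : ℕ}

/-- Finite sums of products of a function of time that is differentiable at `t` and a piecewise
continuous function of space. -/
inductive Mesh.TimeSep (K : Mesh d) (t : ℝ) : (ℝ → E d → ℝ) → Prop
  | zero : Mesh.TimeSep K t fun _ _ => 0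
  | single (c : ℝ → ℝ) (φ : E d → ℝ) (hc : DifferentiableAt ℝ c t) (hφ : K.PwCont φ) :
      Mesh.TimeSep K t fun τ x => c τ * φ x
  | add (f g : ℝ → E d → ℝ) (hf : Mesh.TimeSep K t f) (hg : Mesh.TimeSep K t g) :
      Mesh.TimeSep K t fun τ x => f τ x + g τ x

namespace Mesh.TimeSep

variable {K : Mesh d} {t : ℝ} {f g : ℝ → E d → ℝ}

theorem single_mul (hg : K.TimeSep t g) {c : ℝ → ℝ} {φ : E d → ℝ} (hc : DifferentiableAt ℝ c t)
    (hφ : K.PwCont φ) : K.TimeSep t fun τ x => c τ * φ x * g τ x := by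
  induction hg with
  | zero => simpa using zero
  | single c' φ' hc' hφ' =>
    convert single (K := K) _ _ (hc.fun_mul hc') (hφ.mul hφ') using 3
    ring
  | add f g _ _ ihf ihg =>
    convert add _ _ ihf ihg using 3
    ring

theorem mul (hf : K.TimeSep t f) (hg : K.TimeSep t g) :
    K.TimeSep t fun τ x => f τ x * g τ x := by
  induction hf with
  | zero => simpa using zero
  | single c φ hc hφ => exact single_mul hg hc hφ
  | add f g _ _ ihf ihg =>
    convert add _ _ ihf ihg using 3
    ring

theorem of_pwCont {φ : E d → ℝ} (h : K.PwCont φ) : K.TimeSep t fun _ x => φ x := by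
  simpa using single (K := K) (t := t) (fun _ => 1) φ (differentiableAt_const _) h

theorem const (a : ℝ) : K.TimeSep t fun _ _ => a := of_pwCont (.const a)

theorem const_mul (a : ℝ) (hf : K.TimeSep t f) : K.TimeSep t fun τ x => a * f τ x :=
  (const a).mul hf

theorem sub (hf : K.TimeSep t f) (hg : K.TimeSep t g) :
    K.TimeSep t fun τ x => f τ x - g τ x := by
  simpa [sub_eq_add_neg] using add _ _ hf (hg.const_mul (-1))

theorem sum {ι : Type*} (s : Finset ι) {f : ι → ℝ → E d → ℝ} (h : ∀ i ∈ s, K.TimeSep t (f i)) :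
    K.TimeSep t fun τ x => ∑ i ∈ s, f i τ x := by
  classical
  induction s using Finset.induction_on with
  | empty => simpa using zero
  | insert a s ha ih =>
    simp only [Finset.sum_insert ha]
    exact add _ _ (h a (by simp)) (ih fun i hi => h i (by simp [hi]))

theorem prod {ι : Type*} (s : Finset ι) {f : ι → ℝ → E d → ℝ} (h : ∀ i ∈ s, K.TimeSep t (f i)) :
    K.TimeSep t fun τ x => ∏ i ∈ s, f i τ x := by
  classical
  induction s using Finset.induction_on with
  | empty => simpa using const 1
  | insert a s ha ih =>
    simp only [Finset.prod_insert ha]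
    exact mul (h a (by simp)) (ih fun i hi => h i (by simp [hi]))

/-- Determinants, strains and the stored energy are polynomials in the matrix entries, so they stay
in this class. -/
theorem det {M : ℝ → E d → Matrix (Fin d) (Fin d) ℝ}
    (h : ∀ i j, K.TimeSep t fun τ x => M τ x i j) : K.TimeSep t fun τ x => (M τ x).det := by
  simp only [Matrix.det_apply']
  exact sum _ fun σ _ => (prod _ fun i _ => h _ _).const_mul _

theorem trace {M : ℝ → E d → Matrix (Fin d) (Fin d) ℝ}
    (h : ∀ i j, K.TimeSep t fun τ x => M τ x i j) : K.TimeSep t fun τ x => (M τ x).trace :=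
  sum _ fun i _ => h i i

theorem contr {M N : ℝ → E d → Matrix (Fin d) (Fin d) ℝ}
    (h : ∀ i j, K.TimeSep t fun τ x => M τ x i j) (h' : ∀ i j, K.TimeSep t fun τ x => N τ x i j) :
    K.TimeSep t fun τ x => contr (M τ x) (N τ x) :=
  sum _ fun i _ => sum _ fun j _ => (h i j).mul (h' i j)

theorem strain (m : ElasticModel) {M : ℝ → E d → Matrix (Fin d) (Fin d) ℝ}
    (h : ∀ i j, K.TimeSep t fun τ x => M τ x i j) (i j : Fin d) :
    K.TimeSep t fun τ x => strain m (M τ x) i j := by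
  cases m with
  | linear =>
    simp only [FSI.strain, Matrix.smul_apply, Matrix.add_apply, Matrix.transpose_apply,
      smul_eq_mul]
    exact const_mul _ (add _ _ (h _ _) (h _ _))
  | svk =>
    simp only [FSI.strain, Matrix.smul_apply, Matrix.sub_apply, Matrix.mul_apply, Matrix.add_apply,
      Matrix.transpose_apply, smul_eq_mul]
    exact const_mul _ (sub (sum _ fun k _ => mul (add _ _ (const _) (h _ _))
      (add _ _ (const _) (h _ _))) (const _))

theorem storedDensity (lam mu : ℝ) {M : ℝ → E d → Matrix (Fin d) (Fin d) ℝ}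
    (h : ∀ i j, K.TimeSep t fun τ x => M τ x i j) :
    K.TimeSep t fun τ x => storedDensity lam mu (M τ x) := by
  simp only [FSI.storedDensity, sq]
  exact add _ _ (const_mul _ (contr h h)) (const_mul _ (mul (trace h) (trace h)))

theorem pwCont (hf : K.TimeSep t f) (τ : ℝ) : K.PwCont (f τ) := by
  induction hf with
  | zero => exact .const 0
  | single c φ _ hφ => exact hφ.const_mul _
  | add f g _ _ ihf ihg => exact ihf.add ihg

/-- The integral of `c(τ) φ(x)` is `c(τ) ∫ φ`, so induction over the finite sum replaces any
domination argument. -/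
theorem exists_hasDerivAt (hf : K.TimeSep t f) : ∃ f' : E d → ℝ, K.PwCont f' ∧
    (∀ x, HasDerivAt (fun τ => f τ x) (f' x) t) ∧
    HasDerivAt (fun τ => ∫ x in K.core, f τ x) (∫ x in K.core, f' x) t := by
  induction hf with
  | zero => exact ⟨fun _ => 0, .const 0, fun _ => hasDerivAt_const _ _, by
      simpa using hasDerivAt_const t (0 : ℝ)⟩
  | single c φ hc hφ =>
    refine ⟨fun x => deriv c t * φ x, hφ.const_mul _, fun x => hc.hasDerivAt.mul_const _, ?_⟩
    simp only [integral_const_mul]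
    exact hc.hasDerivAt.mul_const _
  | add f g hf hg ihf ihg =>
    obtain ⟨f', hf1, hf2, hf3⟩ := ihf
    obtain ⟨g', hg1, hg2, hg3⟩ := ihg
    refine ⟨fun x => f' x + g' x, hf1.add hg1, fun x => (hf2 x).fun_add (hg2 x), ?_⟩
    rw [integral_add hf1.integrableOn hg1.integrableOn]
    simp only [fun τ => integral_add (hf.pwCont τ).integrableOn (hg.pwCont τ).integrableOn]
    exact hf3.fun_add hg3

/-- Differentiation under the integral. -/
theorem hasDerivAt_integral (hf : K.TimeSep t f) {f' : E d → ℝ}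
    (h : ∀ x ∈ K.core, HasDerivAt (fun τ => f τ x) (f' x) t) :
    IntegrableOn f' K.core ∧
      HasDerivAt (fun τ => ∫ x in K.core, f τ x) (∫ x in K.core, f' x) t := by
  obtain ⟨g, hg, hd, hi⟩ := hf.exists_hasDerivAt
  have e : Set.EqOn g f' K.core := fun x hx => (hd x).unique (h x hx)
  rw [← setIntegral_congr_fun K.isOpen_core.measurableSet e]
  exact ⟨hg.integrableOn.congr_fun e K.isOpen_core.measurableSet, hi⟩

end Mesh.TimeSep

end TimeSep

/-! ### Derivatives of matrix functions -/

section MatrixDeriv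

variable {d : ℕ} {t : ℝ}

/-- Jacobi's formula. -/
theorem hasDerivAt_det (hd : d = 2 ∨ d = 3) {M : ℝ → Matrix (Fin d) (Fin d) ℝ}
    {M' : Matrix (Fin d) (Fin d) ℝ} (h : ∀ i j, HasDerivAt (fun τ => M τ i j) (M' i j) t) :
    HasDerivAt (fun τ => (M τ).det) (M' * (M t).adjugate).trace t := by
  rcases hd with rfl | rfl
  · simp only [Matrix.det_fin_two]
    refine (((h 0 0).fun_mul (h 1 1)).fun_sub ((h 0 1).fun_mul (h 1 0))).congr_deriv ?_
    simp [Matrix.trace_fin_two, Matrix.mul_apply, Fin.sum_univ_two, Matrix.adjugate_fin_two]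
    ring
  · simp only [Matrix.det_fin_three]
    refine ((((((((h 0 0).fun_mul (h 1 1)).fun_mul (h 2 2)).fun_sub
      (((h 0 0).fun_mul (h 1 2)).fun_mul (h 2 1))).fun_sub
      (((h 0 1).fun_mul (h 1 0)).fun_mul (h 2 2))).fun_add
      (((h 0 1).fun_mul (h 1 2)).fun_mul (h 2 0))).fun_add
      (((h 0 2).fun_mul (h 1 0)).fun_mul (h 2 1))).fun_sub
      (((h 0 2).fun_mul (h 1 1)).fun_mul (h 2 0))).congr_deriv ?_
    simp [Matrix.trace_fin_three, Matrix.mul_apply, Fin.sum_univ_three, Matrix.adjugate_fin_three]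
    ring

theorem contr_eq_trace (A B : Matrix (Fin d) (Fin d) ℝ) : contr A B = (A.transpose * B).trace := by
  simp only [contr, Matrix.trace, Matrix.diag_apply, Matrix.mul_apply, Matrix.transpose_apply]
  exact Finset.sum_comm

theorem contr_hookeStress (lam mu : ℝ) (A B : Matrix (Fin d) (Fin d) ℝ) :
    contr (hookeStress lam mu A) B = 2 * mu * contr A B + lam * A.trace * B.trace := by
  simp [contr_eq_trace, hookeStress, add_mul]

theorem hookeStress_transpose (lam mu : ℝ) {A : Matrix (Fin d) (Fin d) ℝ} (h : A.transpose = A) :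
    (hookeStress lam mu A).transpose = hookeStress lam mu A := by
  simp [hookeStress, h]

theorem strain_transpose (m : ElasticModel) (G : Matrix (Fin d) (Fin d) ℝ) :
    (strain m G).transpose = strain m G := by
  cases m <;> simp [strain, add_comm]

/-- The stress power is the time derivative of the energy density. -/
theorem hasDerivAt_storedDensity_strain (m : ElasticModel) (lam mu : ℝ)
    {G : ℝ → Matrix (Fin d) (Fin d) ℝ} {G' : Matrix (Fin d) (Fin d) ℝ}
    (h : ∀ i j, HasDerivAt (fun τ => G τ i j) (G' i j) t) :
    HasDerivAt (fun τ => storedDensity lam mu (strain m (G τ)))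
      (contr (piolaStress m lam mu (G t)) G') t := by
  have key : ∀ (A : ℝ → Matrix (Fin d) (Fin d) ℝ) (A' : Matrix (Fin d) (Fin d) ℝ),
      (∀ i j, HasDerivAt (fun τ => A τ i j) (A' i j) t) →
      HasDerivAt (fun τ => storedDensity lam mu (A τ)) (contr (hookeStress lam mu (A t)) A') t := by
    intro A A' hA
    have h1 : HasDerivAt (fun τ => contr (A τ) (A τ)) (2 * contr (A t) A') t := by
      have : HasDerivAt (fun τ => contr (A τ) (A τ))
          (∑ i, ∑ j, (A' i j * A t i j + A t i j * A' i j)) t :=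
        HasDerivAt.fun_sum fun i _ => HasDerivAt.fun_sum fun j _ => (hA i j).fun_mul (hA i j)
      refine this.congr_deriv ?_
      simp only [contr, Finset.mul_sum]
      exact Finset.sum_congr rfl fun i _ => Finset.sum_congr rfl fun j _ => by ring
    have h2 : HasDerivAt (fun τ => (A τ).trace) A'.trace t :=
      HasDerivAt.fun_sum fun i _ => hA i i
    have h3 := (h1.const_mul mu).fun_add ((h2.fun_pow 2).const_mul (lam / 2))
    refine h3.congr_deriv ?_
    rw [contr_hookeStress]
    push_cast
    ring
  -- A symmetric stress does not distinguish a velocity gradient from its transpose, so the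
  -- symmetrization in the strain rate can be removed.
  have hS : ∀ A : Matrix (Fin d) (Fin d) ℝ, A.transpose = A → ∀ B, contr A B.transpose = contr A B := by
    intro A hA B
    rw [contr_eq_trace, contr_eq_trace, ← Matrix.trace_transpose, Matrix.transpose_mul,
      Matrix.transpose_transpose, Matrix.transpose_transpose, hA, Matrix.trace_mul_comm]
  have hadd : ∀ A B C : Matrix (Fin d) (Fin d) ℝ, contr A (B + C) = contr A B + contr A C := by
    intro A B C
    simp [contr_eq_trace, mul_add]
  have hsmul : ∀ (c : ℝ) (A B : Matrix (Fin d) (Fin d) ℝ), contr A (c • B) = c * contr A B := by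
    intro c A B
    simp [contr_eq_trace]
  have hsym := hookeStress_transpose lam mu (strain_transpose m (G t))
  cases m with
  | linear =>
    have h1 := key (fun τ => strain .linear (G τ)) ((1 / 2 : ℝ) • (G' + G'.transpose)) fun i j => by
      simpa [strain] using ((h i j).fun_add (h j i)).const_mul (1 / 2 : ℝ)
    refine h1.congr_deriv ?_
    rw [hsmul, hadd, hS _ hsym, piolaStress]
    ring
  | svk =>
    -- With `F = 1 + G`, the strain rate is the symmetric part of `Fᵀ F'`, and `Σ : Fᵀ F' = (F Σ) :
    -- F'`.
    have h1 := key (fun τ => strain .svk (G τ))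
      ((1 / 2 : ℝ) • (((1 + G t).transpose * G').transpose + (1 + G t).transpose * G'))
      fun i j => by
        have hF : ∀ i j, HasDerivAt (fun τ => (1 + G τ) i j) (G' i j) t := fun i j => by
          simpa using (h i j).const_add ((1 : Matrix (Fin d) (Fin d) ℝ) i j)
        have h2 : HasDerivAt (fun τ => ∑ k, (1 + G τ) k i * (1 + G τ) k j)
            (∑ k, (G' k i * (1 + G t) k j + (1 + G t) k i * G' k j)) t :=
          HasDerivAt.fun_sum fun k _ => (hF k i).fun_mul (hF k j)
        refine ((h2.sub_const ((1 : Matrix (Fin d) (Fin d) ℝ) i j)).const_mul (1 / 2 : ℝ)).congr_deriv ?_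
        rw [Matrix.smul_apply, Matrix.add_apply, Matrix.transpose_apply, Matrix.mul_apply,
          Matrix.mul_apply, smul_eq_mul, ← Finset.sum_add_distrib]
        simp only [Matrix.transpose_apply, mul_comm (G' _ _)]
    refine h1.congr_deriv ?_
    rw [hsmul, hadd, hS _ hsym, piolaStress, contr_eq_trace, contr_eq_trace, Matrix.transpose_mul,
      hsym, Matrix.mul_assoc]
    ring

end MatrixDeriv

/-! ### Deformations: differentiability of the inverse, transported gradients, change of variables.
-/

namespace Mesh

variable {d : ℕ}

/-- Injective and orientation-preserving piecewise smooth maps of the closed meshed region. -/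
structure IsDeformation (K : Mesh d) (Φ : E d → E d) : Prop where
  smooth : K.PwSmoothVec Φ
  injOn : Set.InjOn Φ K.closedDomain
  jac_pos : ∀ s ∈ K.elements, ∀ x ∈ cell s, 0 < (fderivWithin ℝ Φ (cell s) x).det

namespace IsDeformation

variable {K : Mesh d} {Φ : E d → E d} (hΦ : K.IsDeformation Φ)
include hΦ

theorem det_grad_pos {x : E d} (hx : x ∈ K.core) : 0 < (grad Φ x).det := by
  obtain ⟨s, hs, hxs⟩ := exists_of_mem_core hx
  have h := hΦ.jac_pos s hs x (interior_subset hxs)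
  rwa [fderivWithin_of_mem_nhds (mem_interior_iff_mem_nhds.1 hxs), det_fderiv] at h

theorem pwCont_det : K.PwCont fun x => (grad Φ x).det :=
  PwCont.det fun i j => hΦ.smooth.grad_pwCont i j

/-- Positivity up to the boundary of each element is essential: it keeps the reciprocal continuous
on the compact cell. There `fderivWithin` is the derivative of the C¹ extension, by unique
differentiability on a convex set with interior. -/
theorem pwCont_inv_det : K.PwCont fun x => ((grad Φ x).det)⁻¹ := by
  intro s hs
  obtain ⟨p, hp, hΦp⟩ := hΦ.smooth.exists_contDiff hs
  have hpos : ∀ x ∈ cell s, 0 < (grad p x).det := by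
    intro x hx
    have h := hΦ.jac_pos s hs x hx
    rwa [fderivWithin_congr hΦp (hΦp hx), (hp.differentiable (by norm_num) x).fderivWithin
      ((uniqueDiffOn_convex (convex_cell s) (interior_cell_nonempty hs)) x hx), det_fderiv] at h
  have hcont : Continuous fun x => grad p x := by
    refine continuous_matrix fun i j => ?_
    exact (EuclideanSpace.proj i : E d →L[ℝ] ℝ).continuous.comp
      ((hp.continuous_fderiv (by norm_num)).clm_apply continuous_const)
  refine ⟨fun x => ((grad p x).det)⁻¹, hcont.matrix_det.continuousOn.inv₀ fun x hx =>
    (hpos x hx).ne', fun x hx => ?_⟩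
  simp only [grad_congr (eventuallyEq_of_mem (mem_interior_iff_mem_nhds.1 hx) hΦp)]

theorem pwCont_inv (i j : Fin d) : K.PwCont fun x => (grad Φ x)⁻¹ i j := by
  simp only [Matrix.inv_def, Matrix.smul_apply, smul_eq_mul, Ring.inverse_eq_inv']
  exact hΦ.pwCont_inv_det.mul (PwCont.adjugate (fun i j => hΦ.smooth.grad_pwCont i j) i j)

theorem inv_apply {x : E d} (hx : x ∈ K.closedDomain) :
    Function.invFunOn Φ K.closedDomain (Φ x) = x :=
  hΦ.injOn.leftInvOn_invFunOn hx

/-- By the inverse function theorem, statements about the inverse near `Φ x` need only be checked at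
the points `Φ y` with `y` near `x`. -/
theorem map_nhds {x : E d} (hx : x ∈ K.core) : map Φ (𝓝 x) = 𝓝 (Φ x) := by
  have h := (hΦ.smooth.contDiffAt hx).hasStrictFDerivAt (by norm_num)
  have hdet : (fderiv ℝ Φ x).det ≠ 0 := by
    rw [det_fderiv]
    exact (hΦ.det_grad_pos hx).ne'
  refine HasStrictFDerivAt.map_nhds_eq_of_equiv
    (f' := (fderiv ℝ Φ x).toContinuousLinearEquivOfDetNeZero hdet) ?_
  simpa using h

/-- The chosen inverse is a left inverse near `x`; with `map_nhds` this gives its continuity at `Φ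
x` and makes it a local right inverse, after which the derivative of the inverse follows. -/
theorem differentiableAt_inv {x : E d} (hx : x ∈ K.core) :
    DifferentiableAt ℝ (Function.invFunOn Φ K.closedDomain) (Φ x) := by
  set Ψ := Function.invFunOn Φ K.closedDomain
  have hdet : (fderiv ℝ Φ x).det ≠ 0 := by
    rw [det_fderiv]
    exact (hΦ.det_grad_pos hx).ne'
  have hΨx : Ψ (Φ x) = x := hΦ.inv_apply (K.core_subset_closedDomain hx)
  have hleft : ∀ᶠ y in 𝓝 x, Ψ (Φ y) = y := by
    filter_upwards [K.isOpen_core.mem_nhds hx] with y hy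
    exact hΦ.inv_apply (K.core_subset_closedDomain hy)
  have hcont : ContinuousAt Ψ (Φ x) := by
    rw [ContinuousAt, hΨx, ← hΦ.map_nhds hx, tendsto_map'_iff]
    exact tendsto_id.congr' (hleft.mono fun y hy => hy.symm)
  have hright : ∀ᶠ y in 𝓝 (Φ x), Φ (Ψ y) = y := by
    rw [← hΦ.map_nhds hx, eventually_map]
    filter_upwards [hleft] with y hy
    rw [hy]
  have hd : HasFDerivAt Φ
      ((fderiv ℝ Φ x).toContinuousLinearEquivOfDetNeZero hdet : E d →L[ℝ] E d) (Ψ (Φ x)) := by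
    rw [hΨx]
    simpa using (hΦ.smooth.differentiableAt hx).hasFDerivAt
  exact (HasFDerivAt.of_local_left_inverse hcont hd hright).differentiableAt

theorem grad_inv {x : E d} (hx : x ∈ K.core) :
    grad (Function.invFunOn Φ K.closedDomain) (Φ x) = (grad Φ x)⁻¹ := by
  refine (Matrix.inv_eq_left_inv ?_).symm
  rw [← grad_comp (hΦ.differentiableAt_inv hx) (hΦ.smooth.differentiableAt hx), ← grad_id x]
  refine grad_congr ?_
  filter_upwards [K.isOpen_core.mem_nhds hx] with y hy
  exact hΦ.inv_apply (K.core_subset_closedDomain hy)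

/-- The gradient of a transported field. -/
theorem grad_comp_inv {x : E d} (hx : x ∈ K.core) {f : E d → E d} (hf : DifferentiableAt ℝ f x) :
    grad (fun y => f (Function.invFunOn Φ K.closedDomain y)) (Φ x) =
      grad f x * (grad Φ x)⁻¹ := by
  have h : Function.invFunOn Φ K.closedDomain (Φ x) = x :=
    hΦ.inv_apply (K.core_subset_closedDomain hx)
  rw [grad_comp (by rwa [h]) (hΦ.differentiableAt_inv hx), h, hΦ.grad_inv hx]

/-- Element boundaries are null by convexity, and on each one `Φ` agrees with a C¹ map, which
preserves null sets. -/
theorem image_core_ae_eq : (Φ '' K.core : Set (E d)) =ᵐ[volume] Φ '' K.domain := by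
  refine (Set.image_mono K.core_subset_domain).eventuallyLE.antisymm (ae_le_set.2 ?_)
  have h : Φ '' K.domain \ Φ '' K.core ⊆
      ⋃ s : K.elements, Φ '' frontier (cell (s : Finset (E d))) := by
    rintro _ ⟨⟨x, hx, rfl⟩, hxc⟩
    have hx' : x ∈ K.closedDomain \ K.core :=
      ⟨K.domain_subset_closedDomain hx, fun h => hxc ⟨x, h, rfl⟩⟩
    obtain ⟨s, hs⟩ := Set.mem_iUnion.1 (K.closedDomain_diff_core_subset hx')
    exact Set.mem_iUnion.2 ⟨s, x, hs, rfl⟩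
  refine measure_mono_null h (measure_iUnion_null fun s => ?_)
  obtain ⟨p, hp, hΦp⟩ := hΦ.smooth.exists_contDiff s.2
  rw [Set.EqOn.image_eq (hΦp.mono (isClosed_cell _).frontier_subset)]
  exact addHaar_image_eq_zero_of_differentiableOn_of_addHaar_eq_zero volume
    (hp.differentiable (by norm_num)).differentiableOn ((convex_cell _).addHaar_frontier _)

/-- The change of variables formula. -/
theorem setIntegral_image (h : E d → ℝ) :
    ∫ y in Φ '' K.domain, h y = ∫ x in K.core, (grad Φ x).det * h (Φ x) := by
  rw [← setIntegral_congr_set hΦ.image_core_ae_eq,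
    integral_image_eq_integral_abs_det_fderiv_smul volume K.isOpen_core.measurableSet
      (fun x hx => (hΦ.smooth.differentiableAt hx).hasFDerivAt.hasFDerivWithinAt)
      (hΦ.injOn.mono K.core_subset_closedDomain)]
  refine setIntegral_congr_fun K.isOpen_core.measurableSet fun x hx => ?_
  simp only [det_fderiv, abs_of_pos (hΦ.det_grad_pos hx), smul_eq_mul]

end IsDeformation

end Mesh

/-! ### Fields of zero Dirichlet energy. -/

theorem contr_self_nonneg {d : ℕ} (A : Matrix (Fin d) (Fin d) ℝ) : 0 ≤ contr A A :=
  Finset.sum_nonneg fun _ _ => Finset.sum_nonneg fun _ _ => mul_self_nonneg _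

theorem contr_self_eq_zero {d : ℕ} {A : Matrix (Fin d) (Fin d) ℝ} (h : contr A A = 0) : A = 0 := by
  ext i j
  have h1 := (Finset.sum_eq_zero_iff_of_nonneg fun i _ =>
    Finset.sum_nonneg fun j _ => mul_self_nonneg (A i j)).1 h i (Finset.mem_univ _)
  have h2 := (Finset.sum_eq_zero_iff_of_nonneg fun j _ => mul_self_nonneg (A i j)).1 h1 j
    (Finset.mem_univ _)
  exact mul_self_eq_zero.1 h2

/-- A continuous piecewise smooth field on a connected domain whose Dirichlet energy is zero, and
which vanishes somewhere, is zero. -/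
theorem Mesh.PwSmoothVec.eq_zero_of_dirichlet_eq_zero {d : ℕ} {K : Mesh d} {v : E d → E d}
    (hv : K.PwSmoothVec v) (hK : IsConnected K.domain)
    (h0 : ∫ x in K.domain, contr (grad v x) (grad v x) = 0)
    (hx₀ : ∃ x ∈ K.closedDomain, v x = 0) : ∀ x ∈ K.closedDomain, v x = 0 := by
  have hpc : K.PwCont fun x => contr (grad v x) (grad v x) :=
    .sum _ fun i _ => .sum _ fun j _ => (hv.grad_pwCont i j).mul (hv.grad_pwCont i j)
  have hgrad : ∀ x ∈ K.core, contr (grad v x) (grad v x) = 0 := by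
    rw [K.setIntegral_domain, setIntegral_eq_zero_iff_of_nonneg_ae
      (ae_of_all _ fun x => contr_self_nonneg _) hpc.integrableOn] at h0
    -- The gradient is continuous on the open core, so vanishing almost everywhere becomes vanishing
    -- everywhere there.
    refine Measure.eqOn_open_of_ae_eq h0 K.isOpen_core (fun x hx => ?_) continuousOn_const
    have h1 : ∀ i j, ContinuousAt (fun y => grad v y i j) x := fun i j => by
      have h2 : ContinuousAt (fderiv ℝ v) x :=
        ((hv.contDiffAt hx).fderiv_right (m := 0) (by norm_num)).continuousAt
      exact (EuclideanSpace.proj i : E d →L[ℝ] ℝ).continuous.continuousAt.comp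
        (h2.clm_apply continuousAt_const)
    have h3 : ContinuousAt (fun y => ∑ i, ∑ j, grad v y i j * grad v y i j) x :=
      tendsto_finsetSum _ fun i _ => tendsto_finsetSum _ fun j _ => (h1 i j).mul (h1 i j)
    exact h3.continuousWithinAt
  have hfd : ∀ x ∈ K.core, fderiv ℝ v x = 0 := by
    intro x hx
    ext h i
    rw [fderiv_eq_sum_grad, contr_self_eq_zero (hgrad x hx)]
    simp
  have hcell : ∀ s : K.elements, ∃ c, ∀ x ∈ cell (s : Finset (E d)), v x = c := by
    intro s
    obtain ⟨z, hz⟩ := interior_cell_nonempty s.2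
    have hsub : interior (cell (s : Finset (E d))) ⊆ K.core := fun x hx =>
      Set.mem_iUnion.2 ⟨s, hx⟩
    have hint : ∀ x ∈ interior (cell (s : Finset (E d))), v x = v z := by
      intro x hx
      refine (convex_cell _).interior.is_const_of_fderivWithin_eq_zero (𝕜 := ℝ)
        (fun y hy => (hv.differentiableAt (hsub hy)).differentiableWithinAt) (fun y hy => ?_) hx hz
      rw [fderivWithin_of_mem_nhds (isOpen_interior.mem_nhds hy), hfd y (hsub hy)]
    refine ⟨v z, fun x hx => ?_⟩
    have hcl : x ∈ closure (interior (cell (s : Finset (E d)))) := by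
      rwa [cell_eq_closure_interior s.2]
    have hc : ContinuousWithinAt v (interior (cell (s : Finset (E d)))) x :=
      (hv.continuousOn x (cell_subset_closedDomain s.2 hx)).mono
        (interior_subset.trans (cell_subset_closedDomain s.2))
    have h4 := hc.mem_closure_image hcl
    have h5 : v '' interior (cell (s : Finset (E d))) ⊆ {v z} := by
      rintro _ ⟨y, hy, rfl⟩
      exact hint y hy
    simpa using closure_mono h5 h4
  choose c hc using hcell
  have hmaps : Set.MapsTo v K.closedDomain (Set.range c) := by
    intro x hx
    obtain ⟨s, hs, hxs⟩ := exists_cell_of_mem hx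
    exact ⟨⟨s, hs⟩, (hc ⟨s, hs⟩ x hxs).symm⟩
  have hconn : IsPreconnected K.closedDomain := by
    rw [K.closedDomain_eq_closure]
    exact hK.isPreconnected.closure
  -- The field takes finitely many values, one per element; continuity and connectedness leave only
  -- one, so no chain of adjacent elements has to be found.
  have hdisc : IsDiscrete (Set.range c) := (Set.finite_range c).isDiscrete
  obtain ⟨x₀, hx₀, hv₀⟩ := hx₀
  intro x hx
  rw [hconn.constant_of_mapsTo hdisc hv.continuousOn hmaps hx hx₀, hv₀]

theorem Geometry.measurableSet_fluidNeu {d : ℕ} (G : Geometry d) : MeasurableSet G.fluidNeu :=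
  (isClosed_frontier.measurableSet.diff
    (isClosed_frontier.measurableSet.inter isClosed_frontier.measurableSet)).diff
    G.fluidDir_measurable

theorem Geometry.measurableSet_solidNeu {d : ℕ} (G : Geometry d) : MeasurableSet G.solidNeu :=
  (isClosed_frontier.measurableSet.diff
    (isClosed_frontier.measurableSet.inter isClosed_frontier.measurableSet)).diff
    G.solidDir_measurable

/-! ### Reference fields of the fluid, removal of the lifting, boundary traces. -/

namespace ROM

variable {d κ nu ns np m : ℕ} (S : ROM d κ nu ns np m) (q : Coords nu ns np m)

/-- The homogeneous part of the reduced fluid velocity, on the reference domain. -/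
def refVel (t : ℝ) (x : E d) : E d :=
  ∑ i, q.aF t i • S.red.zF i x + ∑ j, deriv q.b t j • S.red.eF j x

/-- The ALE velocity on the reference domain. -/
def refAle (t : ℝ) (x : E d) : E d := ∑ j, deriv q.b t j • S.red.ale j x

/-- The deformation gradient of the ALE map. -/
def defGrad (t : ℝ) (x : E d) : Matrix (Fin d) (Fin d) ℝ := grad (S.Phi q t) x

/-- The reduced pressure on the reference domain. -/
def refPres (t : ℝ) (x : E d) : ℝ := ∑ i, q.aP t i * S.red.zP i x

theorem refVel_smooth (t : ℝ) : S.geom.fluid.PwSmoothVec (S.refVel q t) :=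
  .add (.sum _ fun i _ => (S.red.zF_fe i).pwSmoothVec.const_smul _)
    (.sum _ fun j _ => (S.red.eF_fe j).pwSmoothVec.const_smul _)

theorem refAle_smooth (t : ℝ) : S.geom.fluid.PwSmoothVec (S.refAle q t) :=
  .sum _ fun j _ => (S.red.ale_fe j).pwSmoothVec.const_smul _

theorem phi_smooth (t : ℝ) : S.geom.fluid.PwSmoothVec (S.Phi q t) :=
  .add .id (.sum _ fun j _ => (S.red.ale_fe j).pwSmoothVec.const_smul _)

theorem refPres_smooth (t : ℝ) : S.geom.fluid.PwSmooth (S.refPres q t) :=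
  .sum _ fun i _ => (S.red.zP_fe i).pwSmooth.const_mul _

variable {S q} {T : ℝ} {t : ℝ}

namespace IsSolution

variable (hsol : S.IsSolution q T) (ht : t ∈ Set.Ioo 0 T)
include hsol ht

theorem isDeformation : S.geom.fluid.IsDeformation (S.Phi q t) :=
  ⟨S.phi_smooth q t, hsol.ale_inj t ht, hsol.ale_jac t ht⟩

theorem hasDerivAt_b (j : Fin m) : HasDerivAt (fun τ => q.b τ j) (deriv q.b t j) t :=
  hasDerivAt_pi.1 (hsol.b_diff t ht).1.hasDerivAt j

theorem hasDerivAt_deriv_b (j : Fin m) :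
    HasDerivAt (fun τ => deriv q.b τ j) (deriv (deriv q.b) t j) t :=
  hasDerivAt_pi.1 (hsol.b_diff t ht).2.hasDerivAt j

theorem hasDerivAt_aF (i : Fin nu) : HasDerivAt (fun τ => q.aF τ i) (deriv q.aF t i) t :=
  hasDerivAt_pi.1 (hsol.aF_diff t ht).hasDerivAt i

theorem hasDerivAt_aS (i : Fin ns) : HasDerivAt (fun τ => q.aS τ i) (deriv q.aS t i) t :=
  hasDerivAt_pi.1 (hsol.aS_diff t ht).1.hasDerivAt i

theorem hasDerivAt_deriv_aS (i : Fin ns) :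
    HasDerivAt (fun τ => deriv q.aS τ i) (deriv (deriv q.aS) t i) t :=
  hasDerivAt_pi.1 (hsol.aS_diff t ht).2.hasDerivAt i

theorem hasDerivAt_phi (x : E d) : HasDerivAt (fun τ => S.Phi q τ x) (S.refAle q t x) t :=
  (HasDerivAt.fun_sum fun j _ => (hsol.hasDerivAt_b ht j).smul_const _).const_add x

theorem omegaF_eq : S.omegaF q t = S.push q t (S.refAle q t) := by
  unfold omegaF
  congr 1
  funext x
  exact (hsol.hasDerivAt_phi ht x).deriv

theorem push_phi {Y : Type*} (f : E d → Y) {x : E d} (hx : x ∈ S.geom.fluid.closedDomain) :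
    S.push q t f (S.Phi q t x) = f x := by
  simp only [push, PhiInv]
  rw [(hsol.isDeformation ht).inv_apply hx]

theorem grad_push {f : E d → E d} {x : E d} (hx : x ∈ S.geom.fluid.core)
    (hf : DifferentiableAt ℝ f x) :
    grad (S.push q t f) (S.Phi q t x) = grad f x * (S.defGrad q t x)⁻¹ :=
  (hsol.isDeformation ht).grad_comp_inv hx hf

/-- The lifting does not contribute in an isolated system. -/
theorem lift_eq_zero (hiso : S.IsIsolated q T) {x : E d} (hx : x ∈ S.geom.fluid.closedDomain) :
    q.cDir t • S.red.lift x = 0 := by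
  by_cases hc : q.cDir t = 0
  · rw [hc, zero_smul]
  -- Bubbles and port modes vanish on the Dirichlet part, so there the isolation condition reads `c
  -- ū = 0`.
  have hdir : ∀ y ∈ S.geom.fluidDir, S.red.lift y = 0 := by
    intro y hy
    have hy' := S.geom.fluidDir_subset hy
    have hyo : y ∈ S.geom.fluidOuter := ⟨hy'.1, fun h => hy'.2 h.2⟩
    have h := hiso.fluid t ht _ ⟨y, hyo, rfl⟩
    rw [uF, hsol.push_phi ht _ (S.geom.fluid.bdry_subset_closedDomain hy'.1)] at h
    simpa [S.red.eF_dir _ y hy, S.red.zF_bubble _ y (Or.inr hy), hc] using h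
  have hzero : ∀ y ∈ S.geom.interface ∪ S.geom.fluidDir, S.red.lift y = 0 := by
    rintro y (hy | hy)
    · exact S.red.lift_interface y hy
    · exact hdir y hy
  have hfe := S.red.lift_harmonic.1
  obtain ⟨z, hz⟩ := S.geom.interface_nonempty
  -- The lifting is now an admissible test field in its own Laplace problem. A point of the
  -- interface supplies the zero needed to exclude constants, even if the Dirichlet part is empty.
  rw [hfe.pwSmoothVec.eq_zero_of_dirichlet_eq_zero S.geom.fluid_connected
    (S.red.lift_harmonic.2 _ hfe hzero)
    ⟨z, S.geom.fluid.bdry_subset_closedDomain hz.1, S.red.lift_interface z hz⟩ x hx, smul_zero]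

theorem uF_phi (hiso : S.IsIsolated q T) {x : E d} (hx : x ∈ S.geom.fluid.closedDomain) :
    S.uF q t (S.Phi q t x) = S.refVel q t x := by
  rw [uF, hsol.push_phi ht _ hx, hsol.lift_eq_zero ht hiso hx, zero_add, refVel]

theorem grad_uF (hiso : S.IsIsolated q T) {x : E d} (hx : x ∈ S.geom.fluid.core) :
    grad (S.uF q t) (S.Phi q t x) = grad (S.refVel q t) x * (S.defGrad q t x)⁻¹ := by
  have h : (fun x => q.cDir t • S.red.lift x + ∑ i, q.aF t i • S.red.zF i x
      + ∑ j, deriv q.b t j • S.red.eF j x) =ᶠ[𝓝 x] S.refVel q t := by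
    filter_upwards [S.geom.fluid.isOpen_core.mem_nhds hx] with y hy
    rw [hsol.lift_eq_zero ht hiso (S.geom.fluid.core_subset_closedDomain hy), zero_add, refVel]
  rw [uF, hsol.grad_push ht hx, grad_congr h]
  exact ((S.refVel_smooth q t).differentiableAt hx).congr_of_eventuallyEq h

theorem refVel_outer (hiso : S.IsIsolated q T) {x : E d} (hx : x ∈ S.geom.fluidOuter) :
    S.refVel q t x = 0 := by
  rw [← hsol.uF_phi ht hiso (S.geom.fluid.bdry_subset_closedDomain hx.1)]
  exact hiso.fluid t ht _ ⟨x, hx, rfl⟩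

omit hsol ht in
-- Kinematic coupling: bubbles vanish on the interface, and fluid port, solid port and ALE modes
-- share their traces. Hence the moving interface carries no flux relative to the mesh.
theorem refVel_interface {x : E d} (hx : x ∈ S.geom.interface) :
    S.refVel q t x = S.refAle q t x := by
  simp [refVel, refAle, S.red.zF_bubble _ x (Or.inl hx), S.red.port_trace _ x hx,
    S.red.ale_interface _ x hx]

omit hsol ht in
theorem phi_outer {x : E d} (hx : x ∈ S.geom.fluidOuter) : S.Phi q t x = x := by
  simp [Phi, S.red.ale_outer _ x hx]

omit hsol ht in
-- The outer boundary does not move, so the Neumann term needs no change of variables for surface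
-- measure.
theorem image_fluidNeu : S.Phi q t '' S.geom.fluidNeu = S.geom.fluidNeu := by
  have h : Set.EqOn (S.Phi q t) id S.geom.fluidNeu := fun x hx => phi_outer hx.1
  rw [h.image_eq, Set.image_id]

end IsSolution

end ROM

namespace Mesh.PwCont

variable {d : ℕ} {K : Mesh d} {M N : E d → Matrix (Fin d) (Fin d) ℝ}

theorem trace (h : ∀ i j, K.PwCont fun x => M x i j) : K.PwCont fun x => (M x).trace :=
  .sum _ fun i _ => h i i

theorem contr (h : ∀ i j, K.PwCont fun x => M x i j) (h' : ∀ i j, K.PwCont fun x => N x i j) :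
    K.PwCont fun x => contr (M x) (N x) :=
  .sum _ fun i _ => .sum _ fun j _ => (h i j).mul (h' i j)

end Mesh.PwCont

/-- The symmetric part of a matrix. -/
def symPart {d : ℕ} (A : Matrix (Fin d) (Fin d) ℝ) : Matrix (Fin d) (Fin d) ℝ :=
  (1 / 2 : ℝ) • (A + A.transpose)

theorem Mesh.PwCont.symPart {d : ℕ} {K : Mesh d} {M : E d → Matrix (Fin d) (Fin d) ℝ}
    (h : ∀ i j, K.PwCont fun x => M x i j) (i j : Fin d) :
    K.PwCont fun x => symPart (M x) i j := by
  simp only [FSI.symPart, Matrix.smul_apply, Matrix.add_apply, Matrix.transpose_apply, smul_eq_mul]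
  exact ((h i j).add (h j i)).const_mul _

theorem contr_symPart_add {d : ℕ} (A B C : Matrix (Fin d) (Fin d) ℝ) :
    contr (symPart A) (symPart (B + C)) =
      contr (symPart A) (symPart B) + contr (symPart A) (symPart C) := by
  simp only [contr, symPart, ← Finset.sum_add_distrib]
  refine Finset.sum_congr rfl fun i _ => Finset.sum_congr rfl fun j _ => ?_
  simp only [Matrix.smul_apply, Matrix.add_apply, Matrix.transpose_apply, smul_eq_mul]
  ring

theorem contr_symPart_smul {d : ℕ} (c : ℝ) (A B : Matrix (Fin d) (Fin d) ℝ) :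
    contr (symPart A) (symPart (c • B)) = c * contr (symPart A) (symPart B) := by
  simp only [contr, symPart, Finset.mul_sum]
  refine Finset.sum_congr rfl fun i _ => Finset.sum_congr rfl fun j _ => ?_
  simp only [Matrix.smul_apply, Matrix.add_apply, Matrix.transpose_apply, smul_eq_mul]
  ring

/-! ### The fluid residual as an integral over the reference domain, and its linearity in the test
field. -/

namespace ROM

variable {d κ nu ns np m : ℕ} (S : ROM d κ nu ns np m) (q : Coords nu ns np m)

/-- The time derivative of the reduced fluid velocity, at fixed reference position. -/
def refAcc (t : ℝ) (x : E d) : E d :=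
  ∑ i, deriv q.aF t i • S.red.zF i x + ∑ j, deriv (deriv q.b) t j • S.red.eF j x

theorem refAcc_smooth (t : ℝ) : S.geom.fluid.PwSmoothVec (S.refAcc q t) :=
  .add (.sum _ fun i _ => (S.red.zF_fe i).pwSmoothVec.const_smul _)
    (.sum _ fun j _ => (S.red.eF_fe j).pwSmoothVec.const_smul _)

/-- The spatial gradient, in the current configuration, of a field on the reference domain. -/
def spGrad (t : ℝ) (v : E d → E d) (x : E d) : Matrix (Fin d) (Fin d) ℝ :=
  grad v x * (S.defGrad q t x)⁻¹

/-- The Jacobian determinant of the ALE map. -/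
def jac (t : ℝ) (x : E d) : ℝ := (S.defGrad q t x).det

/-- The time derivative of the Jacobian determinant of the ALE map. -/
def jacRate (t : ℝ) (x : E d) : ℝ :=
  (grad (S.refAle q t) x * (S.defGrad q t x).adjugate).trace

/-- The integrand of the spatial part of the fluid residual, pulled back to the reference domain. -/
def spatialDensity (t : ℝ) (v : E d → E d) (x : E d) : ℝ :=
  2 * S.phys.muF * contr (symPart (S.spGrad q t (S.refVel q t) x)) (symPart (S.spGrad q t v x))
  - S.refPres q t x * (S.spGrad q t v x).trace
  + S.phys.rhoF * ∑ i, ∑ j, (S.refVel q t x j - S.refAle q t x j) *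
      S.spGrad q t (S.refVel q t) x i j * v x i
  - S.phys.rhoF * (S.spGrad q t (S.refAle q t) x).trace * inner ℝ (S.refVel q t x) (v x)
  + S.phys.rhoF / 2 * (S.spGrad q t (S.refVel q t) x).trace * inner ℝ (S.refVel q t x) (v x)

/-- The integrand of the fluid residual, pulled back to the reference domain. -/
def fluidDensity (t : ℝ) (v : E d → E d) (x : E d) : ℝ :=
  S.jacRate q t x * (S.phys.rhoF * inner ℝ (S.refVel q t x) (v x))
  + S.jac q t x * (S.phys.rhoF * inner ℝ (S.refAcc q t x) (v x))
  + S.jac q t x * S.spatialDensity q t v x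

variable {S q} {T : ℝ} {t : ℝ}

theorem defGrad_eq {x : E d} (hx : x ∈ S.geom.fluid.core) (τ : ℝ) :
    S.defGrad q τ x = 1 + ∑ j, q.b τ j • grad (S.red.ale j) x := by
  have h : ∀ j, DifferentiableAt ℝ (S.red.ale j) x := fun j =>
    (S.red.ale_fe j).pwSmoothVec.differentiableAt hx
  have h' : ∀ j, DifferentiableAt ℝ (fun y => q.b τ j • S.red.ale j y) x := fun j =>
    (h j).fun_const_smul _
  have e : S.Phi q τ = fun y => y + ∑ j, q.b τ j • S.red.ale j y := rfl
  rw [defGrad, e, grad_add differentiableAt_fun_id (DifferentiableAt.fun_sum fun j _ => h' j),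
    grad_id, grad_sum _ fun j _ => h' j]
  simp only [fun j => grad_smul (h j) (q.b τ j)]

theorem grad_refAle {x : E d} (hx : x ∈ S.geom.fluid.core) (τ : ℝ) :
    grad (S.refAle q τ) x = ∑ j, deriv q.b τ j • grad (S.red.ale j) x := by
  have h : ∀ j, DifferentiableAt ℝ (S.red.ale j) x := fun j =>
    (S.red.ale_fe j).pwSmoothVec.differentiableAt hx
  have e : S.refAle q τ = fun y => ∑ j, deriv q.b τ j • S.red.ale j y := rfl
  rw [e, grad_sum _ fun j _ => (h j).fun_const_smul _]
  simp only [fun j => grad_smul (h j) (deriv q.b τ j)]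

theorem spGrad_add {x : E d} {v w : E d → E d} (hv : DifferentiableAt ℝ v x)
    (hw : DifferentiableAt ℝ w x) :
    S.spGrad q t (fun y => v y + w y) x = S.spGrad q t v x + S.spGrad q t w x := by
  rw [spGrad, grad_add hv hw, add_mul]
  rfl

theorem spGrad_smul {x : E d} {v : E d → E d} (hv : DifferentiableAt ℝ v x) (c : ℝ) :
    S.spGrad q t (fun y => c • v y) x = c • S.spGrad q t v x := by
  rw [spGrad, grad_smul hv, Matrix.smul_mul]
  rfl

theorem fluidDensity_add {x : E d} {v w : E d → E d} (hv : DifferentiableAt ℝ v x)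
    (hw : DifferentiableAt ℝ w x) :
    S.fluidDensity q t (fun y => v y + w y) x =
      S.fluidDensity q t v x + S.fluidDensity q t w x := by
  simp only [fluidDensity, spatialDensity, spGrad_add hv hw, contr_symPart_add, Matrix.trace_add,
    inner_add_right, PiLp.add_apply, mul_add, Finset.sum_add_distrib]
  ring

theorem fluidDensity_smul {x : E d} {v : E d → E d} (hv : DifferentiableAt ℝ v x) (c : ℝ) :
    S.fluidDensity q t (fun y => c • v y) x = c * S.fluidDensity q t v x := by
  have h : ∀ a : Fin d → Fin d → ℝ, ∑ i, ∑ j, a i j * (c * v x i) =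
      c * ∑ i, ∑ j, a i j * v x i := by
    intro a
    simp only [Finset.mul_sum]
    exact Finset.sum_congr rfl fun i _ => Finset.sum_congr rfl fun j _ => by ring
  simp only [fluidDensity, spatialDensity, spGrad_smul hv, contr_symPart_smul, Matrix.trace_smul,
    inner_smul_right, PiLp.smul_apply, smul_eq_mul, h]
  ring

namespace IsSolution

variable (hsol : S.IsSolution q T) (ht : t ∈ Set.Ioo 0 T)
include hsol ht

theorem jac_pwCont : S.geom.fluid.PwCont (S.jac q t) := (hsol.isDeformation ht).pwCont_det

theorem spGrad_pwCont {v : E d → E d} (hv : S.geom.fluid.PwSmoothVec v) (i j : Fin d) :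
    S.geom.fluid.PwCont fun x => S.spGrad q t v x i j :=
  Mesh.PwCont.matMul hv.grad_pwCont (hsol.isDeformation ht).pwCont_inv i j

omit hsol ht in
theorem jacRate_pwCont : S.geom.fluid.PwCont (S.jacRate q t) :=
  Mesh.PwCont.trace fun i j => Mesh.PwCont.matMul (S.refAle_smooth q t).grad_pwCont
    (Mesh.PwCont.adjugate (S.phi_smooth q t).grad_pwCont) i j

theorem fluidDensity_pwCont {v : E d → E d} (hv : S.geom.fluid.PwSmoothVec v) :
    S.geom.fluid.PwCont (S.fluidDensity q t v) := by
  have hU := S.refVel_smooth q t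
  have hA := S.refAle_smooth q t
  have hJ := hsol.jac_pwCont ht
  have hUv := (hU.inner hv).pwCont
  have h := fun {v : E d → E d} (hv : S.geom.fluid.PwSmoothVec v) i j =>
    hsol.spGrad_pwCont ht hv i j
  refine ((jacRate_pwCont.mul (hUv.const_mul _)).add
    (hJ.mul (((S.refAcc_smooth q t).inner hv).pwCont.const_mul _))).add (hJ.mul ?_)
  refine ((((Mesh.PwCont.const_mul _ (Mesh.PwCont.contr (Mesh.PwCont.symPart (h hU))
    (Mesh.PwCont.symPart (h hv)))).sub ((S.refPres_smooth q t).pwCont.mul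
    (Mesh.PwCont.trace (h hv)))).add (Mesh.PwCont.const_mul _ ?_)).sub
    (((Mesh.PwCont.trace (h hA)).const_mul _).mul hUv)).add
    (((Mesh.PwCont.trace (h hU)).const_mul _).mul hUv)
  exact .sum _ fun i _ => .sum _ fun j _ =>
    ((((hU j).pwCont.sub (hA j).pwCont).mul (h hU i j)).mul (hv i).pwCont)

/-- Integrals over the current fluid domain, pulled back to the reference domain. -/
theorem setIntegral_omegaF (h : E d → ℝ) :
    ∫ y in S.OmegaF q t, h y = ∫ x in S.geom.fluid.core, S.jac q t x * h (S.Phi q t x) :=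
  (hsol.isDeformation ht).setIntegral_image h

theorem hasDerivAt_refVel (x : E d) :
    HasDerivAt (fun τ => S.refVel q τ x) (S.refAcc q t x) t :=
  (HasDerivAt.fun_sum fun i _ => (hsol.hasDerivAt_aF ht i).smul_const _).fun_add
    (HasDerivAt.fun_sum fun j _ => (hsol.hasDerivAt_deriv_b ht j).smul_const _)

theorem timeSep_refVel (k : Fin d) :
    S.geom.fluid.TimeSep t fun τ x => S.refVel q τ x k := by
  have e : (fun τ x => S.refVel q τ x k) = fun τ x =>
      (∑ i, q.aF τ i * S.red.zF i x k) + ∑ j, deriv q.b τ j * S.red.eF j x k := by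
    funext τ x
    simp [refVel]
  rw [e]
  exact .add _ _ (.sum _ fun i _ => .single _ _ (hsol.hasDerivAt_aF ht i).differentiableAt
      ((S.red.zF_fe i).pwSmoothVec k).pwCont)
    (.sum _ fun j _ => .single _ _ (hsol.hasDerivAt_deriv_b ht j).differentiableAt
      ((S.red.eF_fe j).pwSmoothVec k).pwCont)

/-- Reynolds' transport theorem, on the reference domain. -/
theorem hasDerivAt_integral_jac_mul (hd : d = 2 ∨ d = 3) {F : ℝ → E d → ℝ} {F' : E d → ℝ}
    (hF : S.geom.fluid.TimeSep t F)
    (hF' : ∀ x ∈ S.geom.fluid.core, HasDerivAt (fun τ => F τ x) (F' x) t) :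
    HasDerivAt (fun τ => ∫ x in S.geom.fluid.core, S.jac q τ x * F τ x)
      (∫ x in S.geom.fluid.core, (S.jacRate q t x * F t x + S.jac q t x * F' x)) t := by
  -- On the core the deformation gradient is affine in `b`, which exhibits the Jacobian as a
  -- separated function of time and space.
  have e : (fun τ => ∫ x in S.geom.fluid.core, S.jac q τ x * F τ x) = fun τ =>
      ∫ x in S.geom.fluid.core,
        (1 + ∑ j, q.b τ j • grad (S.red.ale j) x : Matrix (Fin d) (Fin d) ℝ).det * F τ x := by
    funext τ
    refine setIntegral_congr_fun S.geom.fluid.isOpen_core.measurableSet fun x hx => ?_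
    simp only [jac, defGrad_eq hx]
  rw [e]
  have hsep : S.geom.fluid.TimeSep t fun τ x =>
      (1 + ∑ j, q.b τ j • grad (S.red.ale j) x : Matrix (Fin d) (Fin d) ℝ).det := by
    refine Mesh.TimeSep.det fun k l => ?_
    simp only [Matrix.add_apply, Matrix.sum_apply, Matrix.smul_apply, smul_eq_mul]
    exact .add _ _ (.const _) (.sum _ fun j _ =>
      .single _ _ (hsol.hasDerivAt_b ht j).differentiableAt
        ((S.red.ale_fe j).pwSmoothVec.grad_pwCont k l))
  refine ((hsep.mul hF).hasDerivAt_integral fun x hx => ?_).2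
  have hM : ∀ k l, HasDerivAt
      (fun τ => (1 + ∑ j, q.b τ j • grad (S.red.ale j) x : Matrix (Fin d) (Fin d) ℝ) k l)
      (grad (S.refAle q t) x k l) t := by
    intro k l
    rw [grad_refAle hx]
    simp only [Matrix.add_apply, Matrix.sum_apply, Matrix.smul_apply, smul_eq_mul]
    exact (HasDerivAt.fun_sum fun j _ => (hsol.hasDerivAt_b ht j).mul_const _).const_add _
  have hdet := hasDerivAt_det hd hM
  refine (hdet.fun_mul (hF' x hx)).congr_deriv ?_
  simp only [jacRate, jac, defGrad_eq hx]

/-- The test field moves with the ALE map, so its rate at a fixed reference point is zero; only the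
Jacobian and the velocity are differentiated. -/
theorem hasDerivAt_momentum (hd : d = 2 ∨ d = 3) (hiso : S.IsIsolated q T) {v : E d → E d}
    (hv : S.geom.fluid.PwSmoothVec v) :
    HasDerivAt (fun τ => ∫ x in S.OmegaF q τ,
        S.phys.rhoF * inner ℝ (S.uF q τ x) (S.push q τ v x))
      (∫ x in S.geom.fluid.core, (S.jacRate q t x * (S.phys.rhoF * inner ℝ (S.refVel q t x) (v x))
        + S.jac q t x * (S.phys.rhoF * inner ℝ (S.refAcc q t x) (v x)))) t := by
  have hev : (fun τ => ∫ x in S.OmegaF q τ,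
      S.phys.rhoF * inner ℝ (S.uF q τ x) (S.push q τ v x)) =ᶠ[𝓝 t] fun τ =>
      ∫ x in S.geom.fluid.core,
        S.jac q τ x * (S.phys.rhoF * inner ℝ (S.refVel q τ x) (v x)) := by
    -- The pullback and the removal of the lifting hold at all times near `t`, so no regularity of
    -- `cDir` is needed.
    filter_upwards [isOpen_Ioo.mem_nhds ht] with τ hτ
    rw [hsol.setIntegral_omegaF hτ]
    refine setIntegral_congr_fun S.geom.fluid.isOpen_core.measurableSet fun x hx => ?_
    have hx' := S.geom.fluid.core_subset_closedDomain hx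
    simp only [hsol.uF_phi hτ hiso hx', hsol.push_phi hτ v hx']
  refine HasDerivAt.congr_of_eventuallyEq ?_ hev
  refine hsol.hasDerivAt_integral_jac_mul ht hd
    (F := fun τ x => S.phys.rhoF * inner ℝ (S.refVel q τ x) (v x)) ?_ fun x _ => ?_
  · simp only [PiLp.inner_apply]
    refine .const_mul _ (.sum _ fun k _ => ?_)
    simpa using (Mesh.TimeSep.of_pwCont (hv k).pwCont).mul (hsol.timeSep_refVel ht k)
  · have := ((hsol.hasDerivAt_refVel ht x).inner ℝ (hasDerivAt_const t (v x))).const_mul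
      S.phys.rhoF
    simpa using this

/-- Compared with `hasDerivAt_momentum` at `v = refVel`, the term with the Jacobian rate is halved;
the other half enters the energy flux. -/
theorem hasDerivAt_kinF (hd : d = 2 ∨ d = 3) (hiso : S.IsIsolated q T) :
    HasDerivAt (S.kinF q)
      (∫ x in S.geom.fluid.core, (1 / 2 * S.jacRate q t x *
          (S.phys.rhoF * inner ℝ (S.refVel q t x) (S.refVel q t x))
        + S.jac q t x * (S.phys.rhoF * inner ℝ (S.refAcc q t x) (S.refVel q t x)))) t := by
  have hev : S.kinF q =ᶠ[𝓝 t] fun τ => 1 / 2 * ∫ x in S.geom.fluid.core,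
        S.jac q τ x * (S.phys.rhoF * inner ℝ (S.refVel q τ x) (S.refVel q τ x)) := by
    filter_upwards [isOpen_Ioo.mem_nhds ht] with τ hτ
    rw [kinF, hsol.setIntegral_omegaF hτ]
    congr 1
    refine setIntegral_congr_fun S.geom.fluid.isOpen_core.measurableSet fun x hx => ?_
    have hx' := S.geom.fluid.core_subset_closedDomain hx
    simp only [hsol.uF_phi hτ hiso hx', real_inner_self_eq_norm_sq]
  refine HasDerivAt.congr_of_eventuallyEq ?_ hev
  have h := (hsol.hasDerivAt_integral_jac_mul ht hd
    (F := fun τ x => S.phys.rhoF * inner ℝ (S.refVel q τ x) (S.refVel q τ x))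
    (F' := fun x => 2 * (S.phys.rhoF * inner ℝ (S.refAcc q t x) (S.refVel q t x))) ?_
    fun x _ => ?_).const_mul (1 / 2)
  · refine h.congr_deriv ?_
    rw [← integral_const_mul]
    refine integral_congr_ae (ae_of_all _ fun x => ?_)
    ring
  · simp only [PiLp.inner_apply]
    refine .const_mul _ (.sum _ fun k _ => ?_)
    simpa [pow_two] using (hsol.timeSep_refVel ht k).mul (hsol.timeSep_refVel ht k)
  · have hd := hsol.hasDerivAt_refVel ht x
    refine ((hd.inner ℝ hd).const_mul S.phys.rhoF).congr_deriv ?_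
    rw [real_inner_comm (S.refAcc q t x)]
    ring

theorem resF'_eq (hiso : S.IsIsolated q T) {v : E d → E d} (hv : S.geom.fluid.PwSmoothVec v) :
    S.resF' q t v = (∫ x in S.geom.fluid.core, S.jac q t x * S.spatialDensity q t v x)
      - ∫ x in S.geom.fluidNeu, inner ℝ (S.phys.gF t x) (v x) ∂(μHE[d - 1]) := by
  rw [resF', hsol.setIntegral_omegaF ht, image_fluidNeu]
  have hmeas := S.geom.measurableSet_fluidNeu
  congr 1
  · refine setIntegral_congr_fun S.geom.fluid.isOpen_core.measurableSet fun x hx => ?_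
    have hx' := S.geom.fluid.core_subset_closedDomain hx
    have hA : S.omegaF q t (S.Phi q t x) = S.refAle q t x := by
      rw [hsol.omegaF_eq ht, hsol.push_phi ht _ hx']
    have hgA : grad (S.omegaF q t) (S.Phi q t x) = S.spGrad q t (S.refAle q t) x := by
      rw [hsol.omegaF_eq ht, hsol.grad_push ht hx ((S.refAle_smooth q t).differentiableAt hx)]
      rfl
    have hgv : grad (S.push q t v) (S.Phi q t x) = S.spGrad q t v x :=
      hsol.grad_push ht hx (hv.differentiableAt hx)
    have hgU : grad (S.uF q t) (S.Phi q t x) = S.spGrad q t (S.refVel q t) x :=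
      hsol.grad_uF ht hiso hx
    have hp : S.pF q t (S.Phi q t x) = S.refPres q t x := hsol.push_phi ht _ hx'
    simp only [symGrad, divg, convect, hgA, hgv, hgU, hA, hp, hsol.uF_phi ht hiso hx',
      hsol.push_phi ht v hx', PiLp.sub_apply]
    rfl
  · refine setIntegral_congr_fun hmeas fun x hx => ?_
    have h := hsol.push_phi ht v (S.geom.fluid.bdry_subset_closedDomain hx.1.1)
    rw [phi_outer hx.1] at h
    simp only [h]

/-- The residual contains a `deriv`, which is additive only for differentiable functions. Once it is
an integral of a density, linearity in the test field is linearity of the integral. -/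
theorem resF_eq (hd : d = 2 ∨ d = 3) (hiso : S.IsIsolated q T) {v : E d → E d}
    (hv : S.geom.fluid.PwSmoothVec v) :
    S.resF q t v = (∫ x in S.geom.fluid.core, S.fluidDensity q t v x)
      - ∫ x in S.geom.fluidNeu, inner ℝ (S.phys.gF t x) (v x) ∂(μHE[d - 1]) := by
  have hmom : S.geom.fluid.PwCont fun x =>
      S.jacRate q t x * (S.phys.rhoF * inner ℝ (S.refVel q t x) (v x))
        + S.jac q t x * (S.phys.rhoF * inner ℝ (S.refAcc q t x) (v x)) :=
    (jacRate_pwCont.mul (((S.refVel_smooth q t).inner hv).pwCont.const_mul _)).add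
      ((hsol.jac_pwCont ht).mul (((S.refAcc_smooth q t).inner hv).pwCont.const_mul _))
  have hsp : S.geom.fluid.PwCont fun x => S.jac q t x * S.spatialDensity q t v x := by
    have h := (hsol.fluidDensity_pwCont ht hv).sub hmom
    refine h.congr fun x _ => ?_
    simp only [fluidDensity]
    ring
  rw [resF, (hsol.hasDerivAt_momentum ht hd hiso hv).deriv, hsol.resF'_eq ht hiso hv,
    ← add_sub_assoc, ← integral_add hmom.integrableOn hsp.integrableOn]
  rfl

omit hsol ht in
-- Single modes need not vanish on the Neumann part, so splitting the surface term over modes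
-- requires integrability. The test field is bounded on the compact closed domain.
theorem integrableOn_surfaceForce {v : E d → E d} (hv : S.geom.fluid.PwSmoothVec v) :
    IntegrableOn (fun x => inner ℝ (S.phys.gF t x) (v x)) S.geom.fluidNeu (μHE[d - 1]) := by
  have hmeas := S.geom.measurableSet_fluidNeu
  have hsub : S.geom.fluidNeu ⊆ S.geom.fluid.closedDomain := fun x hx =>
    S.geom.fluid.bdry_subset_closedDomain hx.1.1
  have hg := S.phys.gF_integrable t
  have hvm : AEStronglyMeasurable v ((μHE[d - 1]).restrict S.geom.fluidNeu) :=
    (hv.continuousOn.mono hsub).aestronglyMeasurable hmeas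
  obtain ⟨C, hC⟩ := S.geom.fluid.isCompact_closedDomain.exists_bound_of_continuousOn hv.continuousOn
  refine (hg.norm.mul_const C).mono' (hg.aestronglyMeasurable.inner hvm) ?_
  filter_upwards [ae_restrict_mem hmeas] with x hx
  refine (norm_inner_le_norm _ _).trans ?_
  gcongr
  exact hC x (hsub hx)

theorem resF_add (hd : d = 2 ∨ d = 3) (hiso : S.IsIsolated q T) {v w : E d → E d}
    (hv : S.geom.fluid.PwSmoothVec v) (hw : S.geom.fluid.PwSmoothVec w) :
    S.resF q t (fun x => v x + w x) = S.resF q t v + S.resF q t w := by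
  rw [hsol.resF_eq ht hd hiso hv, hsol.resF_eq ht hd hiso hw, hsol.resF_eq ht hd hiso (hv.add hw)]
  simp only [inner_add_right]
  rw [integral_add (integrableOn_surfaceForce hv) (integrableOn_surfaceForce hw),
    setIntegral_congr_fun S.geom.fluid.isOpen_core.measurableSet fun x hx =>
      fluidDensity_add (hv.differentiableAt hx) (hw.differentiableAt hx),
    integral_add (hsol.fluidDensity_pwCont ht hv).integrableOn
      (hsol.fluidDensity_pwCont ht hw).integrableOn]
  ring

theorem resF_smul (hd : d = 2 ∨ d = 3) (hiso : S.IsIsolated q T) {v : E d → E d}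
    (hv : S.geom.fluid.PwSmoothVec v) (c : ℝ) :
    S.resF q t (fun x => c • v x) = c * S.resF q t v := by
  rw [hsol.resF_eq ht hd hiso hv, hsol.resF_eq ht hd hiso (hv.const_smul c)]
  simp only [inner_smul_right]
  rw [integral_const_mul,
    setIntegral_congr_fun S.geom.fluid.isOpen_core.measurableSet fun x hx =>
      fluidDensity_smul (hv.differentiableAt hx) c,
    integral_const_mul]
  ring

theorem resF_sum (hd : d = 2 ∨ d = 3) (hiso : S.IsIsolated q T) {ι : Type*} (s : Finset ι)
    (c : ι → ℝ) {v : ι → E d → E d} (hv : ∀ i, S.geom.fluid.PwSmoothVec (v i)) :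
    S.resF q t (fun x => ∑ i ∈ s, c i • v i x) = ∑ i ∈ s, c i * S.resF q t (v i) := by
  classical
  induction s using Finset.induction_on with
  | empty =>
    -- The zero test field is written as `0 • id`, so homogeneity settles the empty sum.
    have h := hsol.resF_smul ht hd hiso (Mesh.PwSmoothVec.id (K := S.geom.fluid)) 0
    simpa using h
  | insert a s ha ih =>
    simp only [Finset.sum_insert ha]
    rw [hsol.resF_add ht hd hiso ((hv a).const_smul _)
      (.sum _ fun i _ => (hv i).const_smul _), ih, hsol.resF_smul ht hd hiso (hv a)]

theorem resF_refVel (hd : d = 2 ∨ d = 3) (hiso : S.IsIsolated q T) :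
    S.resF q t (S.refVel q t) = ∑ i, q.aF t i * S.resF q t (S.red.zF i)
      + ∑ j, deriv q.b t j * S.resF q t (S.red.eF j) := by
  have hz := fun i => (S.red.zF_fe i).pwSmoothVec
  have he := fun j => (S.red.eF_fe j).pwSmoothVec
  rw [← hsol.resF_sum ht hd hiso _ _ hz, ← hsol.resF_sum ht hd hiso _ _ he,
    ← hsol.resF_add ht hd hiso (.sum _ fun i _ => (hz i).const_smul _)
      (.sum _ fun i _ => (he i).const_smul _)]
  rfl

end IsSolution

end ROM

/-! ### Pointwise algebra of the kinetic energy flux. -/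

section

variable {d : ℕ}

theorem mul_adjugate_eq {G : Matrix (Fin d) (Fin d) ℝ} (hG : G.det ≠ 0)
    (M : Matrix (Fin d) (Fin d) ℝ) : M * G.adjugate = G.det • (M * G⁻¹) := by
  rw [Matrix.inv_def, Ring.inverse_eq_inv', Matrix.mul_smul, smul_smul, mul_inv_cancel₀ hG,
    one_smul]

theorem grad_normSq_smul {u w : E d → E d} {x : E d} (hu : DifferentiableAt ℝ u x)
    (hw : DifferentiableAt ℝ w x) :
    grad (fun y => inner ℝ (u y) (u y) • w y) x = inner ℝ (u x) (u x) • grad w x +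
      (2 : ℝ) • Matrix.of fun i j => w x i * ∑ k, u x k * grad u x k j := by
  have hf : DifferentiableAt ℝ (fun y => inner ℝ (u y) (u y)) x := hu.inner ℝ hu
  ext i j
  simp only [grad, Matrix.of_apply, fderiv_fun_smul hf hw, Matrix.add_apply, Matrix.smul_apply]
  simp only [_root_.add_apply, _root_.smul_apply,
    ContinuousLinearMap.smulRight_apply, fderiv_inner_apply ℝ hu hu, PiLp.add_apply,
    PiLp.smul_apply, smul_eq_mul]
  have h : inner ℝ (u x) (fderiv ℝ u x (EuclideanSpace.single j 1)) =
      ∑ k, u x k * fderiv ℝ u x (EuclideanSpace.single j 1) k := by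
    simp [PiLp.inner_apply, mul_comm]
  rw [real_inner_comm (u x) (fderiv ℝ u x _), h]
  ring

theorem trace_of_mul (u w : Fin d → ℝ) (g a : Matrix (Fin d) (Fin d) ℝ) :
    ((Matrix.of fun i j => w i * ∑ k, u k * g k j) * a).trace =
      ∑ i, ∑ j, w j * (g * a) i j * u i := by
  simp only [Matrix.trace, Matrix.diag_apply, Matrix.mul_apply, Matrix.of_apply, Finset.mul_sum,
    Finset.sum_mul]
  have h : ∀ i, ∑ j, ∑ k, w i * (u k * g k j) * a j i = ∑ k, ∑ j, w i * (g k j * a j i) * u k :=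
    fun i => by
      rw [Finset.sum_comm]
      exact Finset.sum_congr rfl fun k _ => Finset.sum_congr rfl fun j _ => by ring
  simp only [h]
  rw [Finset.sum_comm]

/-- This is `div(|u|² w) = |u|² div w + 2 ((w · ∇)u) · u` in current coordinates, multiplied by the
Jacobian: `∇f G⁻¹` is the spatial gradient of a transported field `f`. -/
theorem trace_grad_normSq_smul_mul_adjugate {u w : E d → E d} {x : E d}
    (hu : DifferentiableAt ℝ u x) (hw : DifferentiableAt ℝ w x) {G : Matrix (Fin d) (Fin d) ℝ}
    (hG : G.det ≠ 0) :
    (grad (fun y => inner ℝ (u y) (u y) • w y) x * G.adjugate).trace =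
      G.det * (inner ℝ (u x) (u x) * (grad w x * G⁻¹).trace +
        2 * ∑ i, ∑ j, w x j * (grad u x * G⁻¹) i j * u x i) := by
  rw [mul_adjugate_eq hG, Matrix.trace_smul, grad_normSq_smul hu hw, add_mul, Matrix.smul_mul,
    Matrix.smul_mul, Matrix.trace_add, Matrix.trace_smul, Matrix.trace_smul, trace_of_mul]
  rfl

end

/-! ### Energy balance of the fluid. -/

namespace ROM

variable {d κ nu ns np m : ℕ} {S : ROM d κ nu ns np m} {q : Coords nu ns np m} {T t : ℝ}

namespace IsSolution

variable (hsol : S.IsSolution q T) (ht : t ∈ Set.Ioo 0 T)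
include hsol ht

/-- The flux of kinetic energy relative to the moving domain has zero total divergence. -/
theorem integral_flux_eq_zero (hd : d = 2 ∨ d = 3) (hiso : S.IsIsolated q T) :
    ∫ x in S.geom.fluid.core, (grad (fun y => inner ℝ (S.refVel q t y) (S.refVel q t y) •
      (S.refVel q t y - S.refAle q t y)) x * (S.defGrad q t x).adjugate).trace = 0 := by
  refine Mesh.PwSmoothVec.integral_trace_grad_mul_adjugate hd
    (.smul ((S.refVel_smooth q t).inner (S.refVel_smooth q t))
      ((S.refVel_smooth q t).sub (S.refAle_smooth q t))) (fun x hx => ?_) (S.phi_smooth q t)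
  -- On the interface the relative velocity is zero; on the rest of the boundary the fluid velocity
  -- is.
  by_cases h : x ∈ S.geom.interface
  · rw [refVel_interface h, sub_self, smul_zero]
  · rw [hsol.refVel_outer ht hiso ⟨hx, h⟩, inner_zero_left, zero_smul]

/-- The constraint holds only against the pressure modes, so the divergence need not vanish
pointwise; but the reduced pressure is a combination of these modes. -/
theorem integral_pressure_eq_zero (hiso : S.IsIsolated q T) :
    ∫ x in S.geom.fluid.core,
      S.jac q t x * (S.refPres q t x * (S.spGrad q t (S.refVel q t) x).trace) = 0 := by
  have hpc : ∀ i, S.geom.fluid.PwCont fun x =>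
      S.jac q t x * ((S.spGrad q t (S.refVel q t) x).trace * S.red.zP i x) := fun i =>
    (hsol.jac_pwCont ht).mul ((Mesh.PwCont.trace (hsol.spGrad_pwCont ht (S.refVel_smooth q t))).mul
      (S.red.zP_fe i).pwSmooth.pwCont)
  have hz : ∀ i, ∫ x in S.geom.fluid.core,
      S.jac q t x * ((S.spGrad q t (S.refVel q t) x).trace * S.red.zP i x) = 0 := by
    intro i
    have h := hsol.incompr_eq t ht i
    rw [incompr, neg_eq_zero, hsol.setIntegral_omegaF ht] at h
    rw [← h]
    refine setIntegral_congr_fun S.geom.fluid.isOpen_core.measurableSet fun x hx => ?_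
    simp only [divg, hsol.grad_uF ht hiso hx,
      hsol.push_phi ht _ (S.geom.fluid.core_subset_closedDomain hx)]
    rfl
  calc _ = ∫ x in S.geom.fluid.core, ∑ i, q.aP t i *
        (S.jac q t x * ((S.spGrad q t (S.refVel q t) x).trace * S.red.zP i x)) := by
        refine integral_congr_ae (ae_of_all _ fun x => ?_)
        simp only [refPres, Finset.mul_sum, Finset.sum_mul]
        exact Finset.sum_congr rfl fun i _ => by ring
    _ = 0 := by
        rw [integral_finsetSum _ fun i _ => ((hpc i).const_mul _).integrableOn]
        simp only [integral_const_mul, hz, mul_zero, Finset.sum_const_zero]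

/-- The power of the fluid residual: the rate of the kinetic energy plus the dissipation. -/
theorem hasDerivAt_kinF_resF (hd : d = 2 ∨ d = 3) (hiso : S.IsIsolated q T) :
    HasDerivAt (S.kinF q) (S.resF q t (S.refVel q t) - S.dissF q t) t := by
  refine (hsol.hasDerivAt_kinF ht hd hiso).congr_deriv ?_
  have hU := S.refVel_smooth q t
  have hA := S.refAle_smooth q t
  have hJ := hsol.jac_pwCont ht
  have hsp := hsol.spGrad_pwCont ht hU
  have hkin : S.geom.fluid.PwCont fun x => 1 / 2 * S.jacRate q t x *
          (S.phys.rhoF * inner ℝ (S.refVel q t x) (S.refVel q t x))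
        + S.jac q t x * (S.phys.rhoF * inner ℝ (S.refAcc q t x) (S.refVel q t x)) :=
    ((jacRate_pwCont.const_mul _).mul ((hU.inner hU).pwCont.const_mul _)).add
      (hJ.mul (((S.refAcc_smooth q t).inner hU).pwCont.const_mul _))
  have hdis : S.geom.fluid.PwCont fun x => S.jac q t x *
      contr (symPart (S.spGrad q t (S.refVel q t) x)) (symPart (S.spGrad q t (S.refVel q t) x)) :=
    hJ.mul (.contr (.symPart hsp) (.symPart hsp))
  have hpr : S.geom.fluid.PwCont fun x =>
      S.jac q t x * (S.refPres q t x * (S.spGrad q t (S.refVel q t) x).trace) :=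
    hJ.mul ((S.refPres_smooth q t).pwCont.mul (.trace hsp))
  have hfl : S.geom.fluid.PwCont fun x =>
      (grad (fun y => inner ℝ (S.refVel q t y) (S.refVel q t y) •
      (S.refVel q t y - S.refAle q t y)) x * (S.defGrad q t x).adjugate).trace :=
    .trace (.matMul (Mesh.PwSmoothVec.grad_pwCont (.smul (hU.inner hU) (hU.sub hA)))
      (.adjugate (S.phi_smooth q t).grad_pwCont))
  have hdiss : S.dissF q t = 2 * S.phys.muF * ∫ x in S.geom.fluid.core, S.jac q t x *
      contr (symPart (S.spGrad q t (S.refVel q t) x))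
        (symPart (S.spGrad q t (S.refVel q t) x)) := by
    rw [dissF, hsol.setIntegral_omegaF ht]
    congr 1
    refine setIntegral_congr_fun S.geom.fluid.isOpen_core.measurableSet fun x hx => ?_
    simp only [symGrad, hsol.grad_uF ht hiso hx]
    rfl
  -- The surface force may be nonzero; it does no work because the velocity vanishes there.
  have hneu : ∫ x in S.geom.fluidNeu, inner ℝ (S.phys.gF t x) (S.refVel q t x) ∂(μHE[d - 1]) =
      0 := by
    have hmeas := S.geom.measurableSet_fluidNeu
    rw [setIntegral_congr_fun (g := fun _ => (0 : ℝ)) hmeas fun x hx => by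
      simp only [hsol.refVel_outer ht hiso hx.1, inner_zero_right]]
    simp
  -- With `J' = J div ω`, the terms beyond kinetic rate, dissipation and pressure are `ρJ (-½ div ω
  -- |u|² + ((u - ω) · ∇)u · u + ½ div u |u|²)`, which is `½ρJ div(|u|² (u - ω))`. The term `½ρ (div
  -- u) u` is what makes this exact for a velocity that is only discretely divergence free.
  have hpt : Set.EqOn (S.fluidDensity q t (S.refVel q t)) (fun x =>
      (1 / 2 * S.jacRate q t x * (S.phys.rhoF * inner ℝ (S.refVel q t x) (S.refVel q t x))
        + S.jac q t x * (S.phys.rhoF * inner ℝ (S.refAcc q t x) (S.refVel q t x)))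
      + 2 * S.phys.muF * (S.jac q t x * contr (symPart (S.spGrad q t (S.refVel q t) x))
        (symPart (S.spGrad q t (S.refVel q t) x)))
      - S.jac q t x * (S.refPres q t x * (S.spGrad q t (S.refVel q t) x).trace)
      + S.phys.rhoF / 2 * (grad (fun y => inner ℝ (S.refVel q t y) (S.refVel q t y) •
      (S.refVel q t y - S.refAle q t y)) x * (S.defGrad q t x).adjugate).trace)
      S.geom.fluid.core := by
    intro x hx
    have hdet : (S.defGrad q t x).det ≠ 0 := ((hsol.isDeformation ht).det_grad_pos hx).ne'
    have hUd := hU.differentiableAt hx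
    have hAd := hA.differentiableAt hx
    have hflux := trace_grad_normSq_smul_mul_adjugate hUd (hUd.fun_sub hAd) hdet
    rw [grad_sub hUd hAd, sub_mul, Matrix.trace_sub] at hflux
    have hrate : S.jacRate q t x = S.jac q t x * (S.spGrad q t (S.refAle q t) x).trace := by
      rw [jacRate, mul_adjugate_eq hdet, Matrix.trace_smul]
      rfl
    simp only [fluidDensity, spatialDensity, hflux, hrate, PiLp.sub_apply]
    simp only [spGrad, jac]
    ring
  rw [hsol.resF_eq ht hd hiso hU, hneu, hdiss,
    setIntegral_congr_fun S.geom.fluid.isOpen_core.measurableSet hpt,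
    integral_add ((hkin.add (hdis.const_mul _)).sub hpr).integrableOn
      (hfl.const_mul _).integrableOn,
    integral_sub (hkin.add (hdis.const_mul _)).integrableOn hpr.integrableOn,
    integral_add hkin.integrableOn (hdis.const_mul _).integrableOn, integral_const_mul,
    integral_const_mul, hsol.integral_flux_eq_zero ht hd hiso,
    hsol.integral_pressure_eq_zero ht hiso]
  ring

end IsSolution

end ROM

/-! ### The solid residual, energy balance of the solid, and coupling. -/

theorem Mesh.PwCont.piolaStress {d : ℕ} {K : Mesh d} {M : E d → Matrix (Fin d) (Fin d) ℝ}
    (h : ∀ i j, K.PwCont fun x => M x i j) (mod : ElasticModel) (lam mu : ℝ) (i j : Fin d) :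
    K.PwCont fun x => piolaStress mod lam mu (M x) i j := by
  have hstrain : ∀ i j, K.PwCont fun x => strain mod (M x) i j := fun i j =>
    -- A field constant in time is separated, so the closure property for strains applies; the time
    -- 0 is arbitrary.
    (Mesh.TimeSep.strain (t := 0) mod (M := fun _ x => M x)
      (fun i j => .of_pwCont (h i j)) i j).pwCont 0
  have hhooke : ∀ i j, K.PwCont fun x => hookeStress lam mu (strain mod (M x)) i j := fun i j => by
    simp only [hookeStress, Matrix.add_apply, Matrix.smul_apply, smul_eq_mul]
    exact ((hstrain i j).const_mul _).add (((trace hstrain).const_mul _).mul (.const _))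
  cases mod with
  | linear => exact hhooke i j
  | svk =>
    refine matMul (M := fun x => 1 + M x) (fun i j => ?_) hhooke i j
    simp only [Matrix.add_apply]
    exact (const _).add (h i j)

theorem contr_add {d : ℕ} (A B C : Matrix (Fin d) (Fin d) ℝ) :
    contr A (B + C) = contr A B + contr A C := by
  simp [contr_eq_trace, mul_add]

theorem contr_smul {d : ℕ} (c : ℝ) (A B : Matrix (Fin d) (Fin d) ℝ) :
    contr A (c • B) = c * contr A B := by
  simp [contr_eq_trace]

namespace ROM

variable {d κ nu ns np m : ℕ} (S : ROM d κ nu ns np m) (q : Coords nu ns np m)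

/-- The velocity of the solid as a combination of the modes. -/
def modalVelS (t : ℝ) (x : E d) : E d :=
  ∑ i, deriv q.aS t i • S.red.zS i x + ∑ j, deriv q.b t j • S.red.eS j x

/-- The acceleration of the solid as a combination of the modes. -/
def modalAccS (t : ℝ) (x : E d) : E d :=
  ∑ i, deriv (deriv q.aS) t i • S.red.zS i x + ∑ j, deriv (deriv q.b) t j • S.red.eS j x

theorem dS_smooth (t : ℝ) : S.geom.solid.PwSmoothVec (S.dS q t) :=
  .add (.sum _ fun i _ => (S.red.zS_fe i).pwSmoothVec.const_smul _)
    (.sum _ fun j _ => (S.red.eS_fe j).pwSmoothVec.const_smul _)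

theorem modalVelS_smooth (t : ℝ) : S.geom.solid.PwSmoothVec (S.modalVelS q t) :=
  .add (.sum _ fun i _ => (S.red.zS_fe i).pwSmoothVec.const_smul _)
    (.sum _ fun j _ => (S.red.eS_fe j).pwSmoothVec.const_smul _)

theorem modalAccS_smooth (t : ℝ) : S.geom.solid.PwSmoothVec (S.modalAccS q t) :=
  .add (.sum _ fun i _ => (S.red.zS_fe i).pwSmoothVec.const_smul _)
    (.sum _ fun j _ => (S.red.eS_fe j).pwSmoothVec.const_smul _)

variable {S} in
theorem grad_modes {x : E d} (hx : x ∈ S.geom.solid.core) (a : Fin ns → ℝ) (b : Fin m → ℝ) :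
    grad (fun y => ∑ i, a i • S.red.zS i y + ∑ j, b j • S.red.eS j y) x =
      ∑ i, a i • grad (S.red.zS i) x + ∑ j, b j • grad (S.red.eS j) x := by
  have hz : ∀ i, DifferentiableAt ℝ (S.red.zS i) x := fun i =>
    (S.red.zS_fe i).pwSmoothVec.differentiableAt hx
  have he : ∀ j, DifferentiableAt ℝ (S.red.eS j) x := fun j =>
    (S.red.eS_fe j).pwSmoothVec.differentiableAt hx
  rw [grad_add (DifferentiableAt.fun_sum fun i _ => (hz i).fun_const_smul _)
    (DifferentiableAt.fun_sum fun j _ => (he j).fun_const_smul _),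
    grad_sum _ fun i _ => (hz i).fun_const_smul _, grad_sum _ fun j _ => (he j).fun_const_smul _]
  simp only [fun i => grad_smul (hz i) (a i), fun j => grad_smul (he j) (b j)]

/-- The integrand of the solid residual. -/
def solidDensity (t : ℝ) (w : E d → E d) (x : E d) : ℝ :=
  S.phys.rhoS * inner ℝ (S.modalAccS q t x) (w x)
  + contr (piolaStress S.phys.model S.phys.lamS S.phys.muS (grad (S.dS q t) x)) (grad w x)

variable {S q} {T t : ℝ}

theorem stressPower_pwCont {w : E d → E d} (hw : S.geom.solid.PwSmoothVec w) :
    S.geom.solid.PwCont fun x =>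
      contr (piolaStress S.phys.model S.phys.lamS S.phys.muS (grad (S.dS q t) x)) (grad w x) :=
  .contr (.piolaStress (S.dS_smooth q t).grad_pwCont _ _ _) hw.grad_pwCont

theorem inertia_pwCont {w : E d → E d} (hw : S.geom.solid.PwSmoothVec w) :
    S.geom.solid.PwCont fun x => S.phys.rhoS * inner ℝ (S.modalAccS q t x) (w x) :=
  ((S.modalAccS_smooth q t).inner hw).pwCont.const_mul _

theorem integrableOn_solidDensity {w : E d → E d} (hw : S.geom.solid.PwSmoothVec w) :
    IntegrableOn (S.solidDensity q t w) S.geom.solid.core :=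
  ((inertia_pwCont hw).add (stressPower_pwCont hw)).integrableOn

namespace IsSolution

variable (hsol : S.IsSolution q T) (ht : t ∈ Set.Ioo 0 T)
include hsol ht

theorem velS_eq : S.velS q t = S.modalVelS q t := by
  funext x
  refine HasDerivAt.deriv ?_
  exact (HasDerivAt.fun_sum fun i _ => (hsol.hasDerivAt_aS ht i).smul_const _).fun_add
    (HasDerivAt.fun_sum fun j _ => (hsol.hasDerivAt_b ht j).smul_const _)

theorem hasDerivAt_velS (x : E d) :
    HasDerivAt (fun τ => S.velS q τ x) (S.modalAccS q t x) t := by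
  have hev : (fun τ => S.velS q τ x) =ᶠ[𝓝 t] fun τ => S.modalVelS q τ x := by
    filter_upwards [isOpen_Ioo.mem_nhds ht] with τ hτ
    rw [hsol.velS_eq hτ]
  refine HasDerivAt.congr_of_eventuallyEq ?_ hev
  exact (HasDerivAt.fun_sum fun i _ => (hsol.hasDerivAt_deriv_aS ht i).smul_const _).fun_add
    (HasDerivAt.fun_sum fun j _ => (hsol.hasDerivAt_deriv_b ht j).smul_const _)

/-- The prescribed traction vanishes on the Neumann part, so no surface term survives and no
integrability of `gS` enters the later linearity. -/
theorem resS_eq (hiso : S.IsIsolated q T) {w : E d → E d} (hw : S.geom.solid.PwSmoothVec w) :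
    S.resS q t w = ∫ x in S.geom.solid.core, S.solidDensity q t w x := by
  have hacc : S.accS q t = S.modalAccS q t := funext fun x => (hsol.hasDerivAt_velS ht x).deriv
  have hmeas := S.geom.measurableSet_solidNeu
  have hneu : ∫ x in S.geom.solidNeu, inner ℝ (S.phys.gS t x) (w x) ∂(μHE[d - 1]) = 0 := by
    rw [setIntegral_congr_fun (g := fun _ => (0 : ℝ)) hmeas fun x hx => by
      simp only [hiso.solid t ht x hx, inner_zero_left]]
    simp
  rw [resS, resS', hneu, sub_zero, hacc, Mesh.setIntegral_domain, Mesh.setIntegral_domain,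
    ← integral_add (inertia_pwCont hw).integrableOn (stressPower_pwCont hw).integrableOn]
  rfl

theorem resS_add (hiso : S.IsIsolated q T) {v w : E d → E d} (hv : S.geom.solid.PwSmoothVec v)
    (hw : S.geom.solid.PwSmoothVec w) :
    S.resS q t (fun x => v x + w x) = S.resS q t v + S.resS q t w := by
  rw [hsol.resS_eq ht hiso hv, hsol.resS_eq ht hiso hw, hsol.resS_eq ht hiso (hv.add hw),
    ← integral_add (integrableOn_solidDensity hv) (integrableOn_solidDensity hw)]
  refine setIntegral_congr_fun S.geom.solid.isOpen_core.measurableSet fun x hx => ?_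
  simp only [solidDensity, grad_add (hv.differentiableAt hx) (hw.differentiableAt hx),
    inner_add_right, contr_add]
  ring

theorem resS_smul (hiso : S.IsIsolated q T) {v : E d → E d} (hv : S.geom.solid.PwSmoothVec v)
    (c : ℝ) : S.resS q t (fun x => c • v x) = c * S.resS q t v := by
  rw [hsol.resS_eq ht hiso hv, hsol.resS_eq ht hiso (hv.const_smul c), ← integral_const_mul]
  refine setIntegral_congr_fun S.geom.solid.isOpen_core.measurableSet fun x hx => ?_
  simp only [solidDensity, grad_smul (hv.differentiableAt hx), inner_smul_right, contr_smul]
  ring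

theorem resS_sum (hiso : S.IsIsolated q T) {ι : Type*} (s : Finset ι) (c : ι → ℝ)
    {v : ι → E d → E d} (hv : ∀ i, S.geom.solid.PwSmoothVec (v i)) :
    S.resS q t (fun x => ∑ i ∈ s, c i • v i x) = ∑ i ∈ s, c i * S.resS q t (v i) := by
  classical
  induction s using Finset.induction_on with
  | empty =>
    have h := hsol.resS_smul ht hiso (Mesh.PwSmoothVec.id (K := S.geom.solid)) 0
    simpa using h
  | insert a s ha ih =>
    simp only [Finset.sum_insert ha]
    rw [hsol.resS_add ht hiso ((hv a).const_smul _) (.sum _ fun i _ => (hv i).const_smul _), ih,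
      hsol.resS_smul ht hiso (hv a)]

theorem resS_modalVelS (hiso : S.IsIsolated q T) :
    S.resS q t (S.modalVelS q t) = ∑ i, deriv q.aS t i * S.resS q t (S.red.zS i)
      + ∑ j, deriv q.b t j * S.resS q t (S.red.eS j) := by
  have hz := fun i => (S.red.zS_fe i).pwSmoothVec
  have he := fun j => (S.red.eS_fe j).pwSmoothVec
  rw [← hsol.resS_sum ht hiso _ _ hz, ← hsol.resS_sum ht hiso _ _ he,
    ← hsol.resS_add ht hiso (.sum _ fun i _ => (hz i).const_smul _)
      (.sum _ fun i _ => (he i).const_smul _)]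
  rfl

theorem hasDerivAt_kinS : HasDerivAt (S.kinS q)
    (∫ x in S.geom.solid.core,
      S.phys.rhoS * inner ℝ (S.modalAccS q t x) (S.modalVelS q t x)) t := by
  have hev : S.kinS q =ᶠ[𝓝 t] fun τ => 1 / 2 * ∫ x in S.geom.solid.core,
      S.phys.rhoS * inner ℝ (S.modalVelS q τ x) (S.modalVelS q τ x) := by
    filter_upwards [isOpen_Ioo.mem_nhds ht] with τ hτ
    rw [kinS, hsol.velS_eq hτ, Mesh.setIntegral_domain]
    simp only [real_inner_self_eq_norm_sq]
  refine HasDerivAt.congr_of_eventuallyEq ?_ hev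
  have hcoord : ∀ k, S.geom.solid.TimeSep t fun τ x => S.modalVelS q τ x k := by
    intro k
    have e : (fun τ x => S.modalVelS q τ x k) = fun τ x =>
        (∑ i, deriv q.aS τ i * S.red.zS i x k) + ∑ j, deriv q.b τ j * S.red.eS j x k := by
      funext τ x
      simp [modalVelS]
    rw [e]
    exact .add _ _ (.sum _ fun i _ => .single _ _ (hsol.hasDerivAt_deriv_aS ht i).differentiableAt
        ((S.red.zS_fe i).pwSmoothVec k).pwCont)
      (.sum _ fun j _ => .single _ _ (hsol.hasDerivAt_deriv_b ht j).differentiableAt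
        ((S.red.eS_fe j).pwSmoothVec k).pwCont)
  have hsep : S.geom.solid.TimeSep t fun τ x =>
      S.phys.rhoS * inner ℝ (S.modalVelS q τ x) (S.modalVelS q τ x) := by
    simp only [PiLp.inner_apply]
    refine .const_mul _ (.sum _ fun k _ => ?_)
    simpa [pow_two] using (hcoord k).mul (hcoord k)
  have h := (hsep.hasDerivAt_integral (f' := fun x =>
    2 * (S.phys.rhoS * inner ℝ (S.modalAccS q t x) (S.modalVelS q t x))) fun x _ => ?_).2.const_mul
    (1 / 2)
  · refine h.congr_deriv ?_
    rw [integral_const_mul]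
    ring
  · have hd : HasDerivAt (fun τ => S.modalVelS q τ x) (S.modalAccS q t x) t :=
      (HasDerivAt.fun_sum fun i _ => (hsol.hasDerivAt_deriv_aS ht i).smul_const _).fun_add
        (HasDerivAt.fun_sum fun j _ => (hsol.hasDerivAt_deriv_b ht j).smul_const _)
    refine ((hd.inner ℝ hd).const_mul S.phys.rhoS).congr_deriv ?_
    rw [real_inner_comm (S.modalAccS q t x)]
    ring

/-- On the core the displacement gradient is separated and the energy density is polynomial in it,
so the rate is taken under the integral; pointwise it is the stress power. -/
theorem hasDerivAt_storedS : HasDerivAt (S.storedS q)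
    (∫ x in S.geom.solid.core,
      contr (piolaStress S.phys.model S.phys.lamS S.phys.muS (grad (S.dS q t) x))
        (grad (S.modalVelS q t) x)) t := by
  let M : ℝ → E d → Matrix (Fin d) (Fin d) ℝ := fun τ x =>
    ∑ i, q.aS τ i • grad (S.red.zS i) x + ∑ j, q.b τ j • grad (S.red.eS j) x
  have hM : ∀ τ, ∀ x ∈ S.geom.solid.core, grad (S.dS q τ) x = M τ x := fun τ x hx =>
    grad_modes hx _ _
  have e : S.storedS q = fun τ => ∫ x in S.geom.solid.core,
      storedDensity S.phys.lamS S.phys.muS (strain S.phys.model (M τ x)) := by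
    funext τ
    rw [storedS, Mesh.setIntegral_domain]
    refine setIntegral_congr_fun S.geom.solid.isOpen_core.measurableSet fun x hx => ?_
    simp only [hM τ x hx]
  rw [e]
  have hsep : ∀ k l, S.geom.solid.TimeSep t fun τ x => M τ x k l := by
    intro k l
    simp only [M, Matrix.add_apply, Matrix.sum_apply, Matrix.smul_apply, smul_eq_mul]
    exact .add _ _ (.sum _ fun i _ => .single _ _ (hsol.hasDerivAt_aS ht i).differentiableAt
        ((S.red.zS_fe i).pwSmoothVec.grad_pwCont k l))
      (.sum _ fun j _ => .single _ _ (hsol.hasDerivAt_b ht j).differentiableAt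
        ((S.red.eS_fe j).pwSmoothVec.grad_pwCont k l))
  refine ((Mesh.TimeSep.storedDensity S.phys.lamS S.phys.muS
    (Mesh.TimeSep.strain S.phys.model hsep)).hasDerivAt_integral fun x hx => ?_).2
  rw [hM t x hx]
  refine hasDerivAt_storedDensity_strain _ _ _ fun k l => ?_
  have e' : grad (S.modalVelS q t) x = _ := grad_modes hx _ _
  rw [e']
  simp only [M, Matrix.add_apply, Matrix.sum_apply, Matrix.smul_apply, smul_eq_mul]
  exact (HasDerivAt.fun_sum fun i _ => (hsol.hasDerivAt_aS ht i).mul_const _).fun_add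
    (HasDerivAt.fun_sum fun j _ => (hsol.hasDerivAt_b ht j).mul_const _)

/-- The power of the solid residual is the rate of the energy of the solid. -/
theorem hasDerivAt_kinS_add_storedS (hiso : S.IsIsolated q T) :
    HasDerivAt (fun τ => S.kinS q τ + S.storedS q τ) (S.resS q t (S.modalVelS q t)) t := by
  have hv := S.modalVelS_smooth q t
  refine ((hsol.hasDerivAt_kinS ht).fun_add (hsol.hasDerivAt_storedS ht)).congr_deriv ?_
  rw [hsol.resS_eq ht hiso hv,
    ← integral_add (inertia_pwCont hv).integrableOn (stressPower_pwCont hv).integrableOn]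
  rfl

/-- The Galerkin equations, tested with the velocity of the coupled system. -/
theorem resS_add_resF_eq_zero (hd : d = 2 ∨ d = 3) (hiso : S.IsIsolated q T) :
    S.resS q t (S.modalVelS q t) + S.resF q t (S.refVel q t) = 0 := by
  -- Both velocities carry the port coefficients `β̇_j`, so the port contributions pair up into the
  -- coupled port equations, while the bubble contributions vanish separately.
  rw [hsol.resS_modalVelS ht hiso, hsol.resF_refVel ht hd hiso]
  simp only [hsol.fluid_eq t ht, hsol.solid_eq t ht, mul_zero, Finset.sum_const_zero, zero_add,
    ← Finset.sum_add_distrib, ← mul_add, hsol.port_eq t ht]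

end IsSolution

end ROM

end FSI

end

theorem lemma1 {d κ nu ns np m : ℕ} (hd : d = 2 ∨ d = 3) (hκ : 2 ≤ κ)
    (S : FSI.ROM d κ nu ns np m) (q : FSI.Coords nu ns np m) (T : ℝ)
    (hsol : S.IsSolution q T) (hiso : S.IsIsolated q T) (t : ℝ) (ht : t ∈ Set.Ioo 0 T) :
    DifferentiableAt ℝ (fun τ => S.kinF q τ + S.kinS q τ + S.storedS q τ) t ∧
      deriv (fun τ => S.kinF q τ + S.kinS q τ + S.storedS q τ) t + S.dissF q t = 0 := by
  have h := ((hsol.hasDerivAt_kinF_resF ht hd hiso).fun_add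
    (hsol.hasDerivAt_kinS_add_storedS ht hiso))
  simp only [← add_assoc] at h
  refine ⟨h.differentiableAt, ?_⟩
  rw [h.deriv]
  -- The energy rate is the total power of the residuals minus the dissipation, and the total power
  -- is zero.
  linear_combination hsol.resS_add_resF_eq_zero ht hd hiso
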